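/- **Notation.** For a graph $G$ on a finite set $V$ and a set $S$ of potential edges (2-element subsets of $V$), $G[S]$ is the set of edges of $G$ in $S$ and $\mathrm{par}(S)\in\{0,1\}$ is the parity of its size. $S(X,Y)=\{\{x,y\}: x\in X,\ y\in Y,\ x\ne y\}$, $S(v,Y)=S(\{v\},Y)$, and for a vertex set $X$ we write $G[X]$, $\mathrm{par}(X)$ for $G[\binom X2]$, $\mathrm{par}(\binom X2)$. For integers $q\ge 1$, "$q \bmod s$" takes values in $\{1,\dots,s\}$. A random variable $X$ is $\varepsilon$-close to $X'$ if they have the same support and $1-\varepsilon\le \Pr[X'=x]/\Pr[X=x]\le(1-\varepsilon)^{-1}$ for all $x$ in it. For $0<\alpha<\frac12$ and $0<p<1$, an ($\alpha$-)partially revealed $p$-graph on $V$, $|V|=n$, with revealed part $A\subseteq V$, $|A|\le n^{1-2\alpha}$, is a random graph with the law of $G(n,p)$ on $V$ conditioned on a feasible assignment of $G[A]$, of the parities of $\deg_G(a)$ for all $a\in A$, and of the parity of $|E(G)|$. **$(U,W)$-removal.** Let $V=A\sqcup U\sqcup W$ with ordered $A$, $U$, let $\overline u_1,\overline u_2,\dots$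 be the vertices of $A$ followed by those of $U$, and let $W=W_\#\sqcup W_1\sqcup\dots\sqcup W_s$. Start with $R=\varnothing$, $q=1$. For each $\overline u=\overline u_1,\overline u_2,\dots$ in turn, reveal $\mathrm{par}(S(\overline u,V\setminus R))$. If it is $0$, remove $\overline u$ (add it to $R$). If it is $1$, let $j=q\bmod s$ and reveal $G[S(\overline u,W_j\setminus R)]$ and $\mathrm{par}(S(w,V\setminus R))$ for all $w\in W_j\setminus R$; if some $w\in W_j\setminus R$ has $\overline uw\in E(G)$ and $\mathrm{par}(S(w,V\setminus R))=0$, pick one such $w$ (by a rule depending only on what was revealed and removed so far), remove first $w$ and then $\overline u$, and increase $q$ by $1$; otherwise the removal fails. If it never fails, it succeeds, and $R$ denotes the final sequence of removed vertices. Let $\mathcal I_A,\mathcal I_U,\mathcal I_W$ be the families of the stars centered in $A,U,W$ whose parities were revealed, and $\mathcal I_e$ the family of the stars $S(\overline u,W_j\setminus R)$ on which $G$ was revealed. **Set-up.** Let $G$ be an $\alpha$-partially revealed $p$-graph on $V$, $|V|=n$, with revealed part $A$. Partition $V\setminus A=B\sqcup C$ with $|B|,|C|$ differing by at most $1$ and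 fix orderings of $A$, $B$, $C$. Let $s=\Theta(n^{1/2+\alpha})$. Cut the ordering of $B$ into $s+1$ consecutive intervals of sizes pairwise differing by at most $1$, called, from last to first, $B_\#,B_1,\dots,B_s$; similarly $C_\#,C_1,\dots,C_s$. Run on $G$ the $(B,C)$-removal ($U=B$, $W=C$) and the $(C,B)$-removal ($U=C$, $W=B$). If both succeed, let $R_{BC}$, $R_{CB}$ be their removed sequences, $V_C=V\setminus R_{BC}\subseteq C$ and $V_B=V\setminus R_{CB}\subseteq B$. Let $\beta_1,\dots,\beta_{i_B}$ be the vertices of $B$ in $R_{CB}$, in this order. Let $\eta=\Theta(n^{1/2-\alpha})$ and put $$D_B^P=\bigcup_{i=1}^{\eta}B_i,\quad D_B^Q=\bigcup_{i=i_B-\eta+1}^{i_B}B_{i\bmod s},\quad A_B=(B_\#\cup D_B^P\cup D_B^Q)\cap V_B,$$ $$B^P=\{\beta_1,\dots,\beta_\eta\},\quad B^Q=\{\beta_{i_B-\eta+1},\dots,\beta_{i_B}\},\quad T_B^P=(V_B\cup B^Q)\setminus(D_B^P\cup B_\#),\quad T_B^Q=V_B\setminus A_B,$$ $$\Sigma_B=\tbinom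 B2\setminus\left(\tbinom{V_B}2\cup S(B^P,T_B^P)\cup S(B^Q,T_B^Q)\right),$$ and define $D_C^P,D_C^Q,A_C,C^P,C^Q,T_C^P,T_C^Q,\Sigma_C$ in the same way from $C$, $V_C$ and $R_{BC}$. Here $\eta$ is chosen small enough that $D_B^P,D_B^Q,D_C^P,D_C^Q$ have size at most $0.01\,n^{1-2\alpha}$. Let $\Gamma$ be the following information: $G[A]$, the parities $\mathrm{par}(S(a,V))$ for $a\in A$, and $\mathrm{par}(V)$; for both removals, the stars in $\mathcal I_A,\mathcal I_U,\mathcal I_W$ with their parities and the stars in $\mathcal I_e$ with $G$ on them; $G[A_B]$ and $G[A_C]$; $\mathrm{par}(S(a,V_B))$ for $a\in A_B$ and $\mathrm{par}(S(a,V_C))$ for $a\in A_C$; $\mathrm{par}(V_B)$ and $\mathrm{par}(V_C)$; all of $G$ outside $\binom B2\cup\binom C2$; $G[\Sigma_B]$ and $G[\Sigma_C]$. Let $\mathcal E$ be the event that both removals succeed and $|V_B|,|V_C|\in[\frac n4-o(n),\frac n4+o(n)]$. **Proposition.** Fix $0<\alpha<\frac12$, $0<p<1$ and the constants implied in $s=\Theta(n^{1/2+\alpha})$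 and $\eta=\Theta(n^{1/2-\alpha})$. There is a constant $\kappa>0$ such that, for every choice of the $o(n)$ term in $\mathcal E$, the following holds for all sufficiently large $n$, uniformly over all the choices above. Let $\Gamma_0\in\mathrm{supp}(\Gamma)$ be such that $\mathcal E$ holds when $\Gamma=\Gamma_0$. Let $G_B$ and $G_C$ be independent random graphs on $V_B$ and $V_C$ (which are determined by $\Gamma_0$), where $G_B$ has the law of the $p$-random graph on $V_B$ conditioned on $G_B[A_B]$, on the parities of the degrees of the vertices of $A_B$ and on the parity of the number of edges being those prescribed by $\Gamma_0$ for $G[V_B]$, and similarly for $G_C$ with $A_C$. Then $G_B$ and $G_C$ are $\alpha$-partially revealed $p$-graphs on $V_B$, $V_C$ with revealed parts $A_B$, $A_C$ (in particular $|A_B|\le|V_B|^{1-2\alpha}$ and $|A_C|\le|V_C|^{1-2\alpha}$), and the random graph $G[V_B]\cup G[V_C]$, conditioned on $\Gamma=\Gamma_0$, is $e^{-\kappa n^{1/2-\alpha}}$-close to $G_B\cup G_C$. -/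

import Mathlib

open MeasureTheory

namespace EvenDegenerate

/-! ### Potential edges, parities, closeness in distribution -/

/-- `S(X, Y)`: the potential edges between `X` and `Y`. In particular `S(X, X)` is the set of all
2-element subsets of `X`, and `S({v}, Y)` is the star from `v` to `Y`. -/
def potentialEdges {V : Type*} (X Y : Set V) : Set (Sym2 V) :=
  {e | ∃ x ∈ X, ∃ y ∈ Y, x ≠ y ∧ e = s(x, y)}

/-- `par_G(S)`: the parity of the number of edges of `G` in `S`. -/
noncomputable def par {V : Type*} (G : SimpleGraph V) (S : Set (Sym2 V)) : ZMod 2 :=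
  ((G.edgeSet ∩ S).ncard : ZMod 2)

/-- The law `ν` is `ε`-close to the law `μ` (laws on a discrete space): they have the same
support, and on it the ratio of the probabilities lies in `[1 - ε, (1 - ε)⁻¹]`. -/
def IsClose {X : Type*} [MeasurableSpace X] (ε : ℝ) (μ ν : Measure X) : Prop :=
  (∀ x, μ {x} ≠ 0 ↔ ν {x} ≠ 0) ∧
    ∀ x, μ {x} ≠ 0 →
      1 - ε ≤ ν.real {x} / μ.real {x} ∧ ν.real {x} / μ.real {x} ≤ (1 - ε)⁻¹

/-! ### Partially revealed `p`-graphs -/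

/-- The event that a graph has the same revealed information as `H`: the same induced graph on
`A`, the same parity of the degree of every vertex of `A` (the number of edges in the star of the
vertex), and the same parity of the total number of edges. -/
def sameRevealed {V : Type*} (A : Set V) (H : SimpleGraph V) : Set (SimpleGraph V) :=
  {G | (∀ x ∈ A, ∀ y ∈ A, (G.Adj x y ↔ H.Adj x y)) ∧
    (∀ x ∈ A, par G (potentialEdges {x} Set.univ) = par H (potentialEdges {x} Set.univ)) ∧
    par G (potentialEdges Set.univ Set.univ) = par H (potentialEdges Set.univ Set.univ)}

/-- The law of `G(V, p)` conditioned on having the revealed information (with revealed part `A`)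
that `H` has. For `0 < p < 1` the feasible assignments of this information are exactly those
realized by some graph `H`. -/
noncomputable def revealedLaw {V : Type*} (p : unitInterval) (A : Set V) (H : SimpleGraph V) :
    Measure (SimpleGraph V) :=
  ProbabilityTheory.cond (SimpleGraph.binomialRandom V p) (sameRevealed A H)

/-- `μ` is the law of an `α`-partially revealed `p`-graph on `V` with revealed part `A`. -/
def IsPartiallyRevealed {V : Type*} (α : ℝ) (p : unitInterval) (A : Set V)
    (μ : Measure (SimpleGraph V)) : Prop :=
  (A.ncard : ℝ) ≤ (Nat.card V : ℝ) ^ (1 - 2 * α) ∧ ∃ H : SimpleGraph V, μ = revealedLaw p A H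

/-! ### Revealing information

Revealing something about a set `S` of potential edges is recorded by the pair of `S` and the
revealed value. -/

/-- The information `G[S]`. -/
def graphInfo {V : Type*} (G : SimpleGraph V) (S : Set (Sym2 V)) : Set (Sym2 V) × Set (Sym2 V) :=
  (S, G.edgeSet ∩ S)

/-- The information `par_G(S)`. -/
noncomputable def parInfo {V : Type*} (G : SimpleGraph V) (S : Set (Sym2 V)) :
    Set (Sym2 V) × ZMod 2 :=
  (S, par G S)

/-! ### The `(U, W)`-removal -/

/-- The state of the removal after some rounds. -/
structure RemovalState (V : Type*) where
  /-- the vertices removed so far, in order of removal -/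
  removed : List V
  /-- one plus the number of vertices removed from `W` so far -/
  q : ℕ
  /-- the parities revealed of stars centered at vertices of `A` -/
  parA : Set (Set (Sym2 V) × ZMod 2)
  /-- the parities revealed of stars centered at vertices of `U` -/
  parU : Set (Set (Sym2 V) × ZMod 2)
  /-- the parities revealed of stars centered at vertices of `W` -/
  parW : Set (Set (Sym2 V) × ZMod 2)
  /-- the graphs revealed on stars from a vertex of `A ∪ U` to a block of `W` -/
  graphs : Set (Set (Sym2 V) × Set (Sym2 V))

/-- The state before the first round. -/
def RemovalState.init (V : Type*) : RemovalState V := ⟨[], 1, ∅, ∅, ∅, ∅⟩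

/-- The set of vertices not removed yet. -/
def RemovalState.rest {V : Type*} (st : RemovalState V) : Set V := {v | v ∉ st.removed}

/-- `q mod s` with values in `{1, …, s}` (for `q ≥ 1`). -/
def cyc (s q : ℕ) : ℕ := (q - 1) % s + 1

/-- The effect of revealing the parity of the star from `u` to the remaining vertices. The flag
tells whether `u` is in `A` or in `U`. -/
noncomputable def revealCenter {V : Type*} (G : SimpleGraph V) (isA : Bool) (u : V)
    (st : RemovalState V) : RemovalState V :=
  if isA then { st with parA := insert (parInfo G (potentialEdges {u} st.rest)) st.parA }
  else { st with parU := insert (parInfo G (potentialEdges {u} st.rest)) st.parU }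

/-- The effect of revealing the graph between `u` and `X`, and the parities of the stars from all
`w ∈ X` to the remaining vertices. -/
noncomputable def revealBlock {V : Type*} (G : SimpleGraph V) (u : V) (X : Set V)
    (st : RemovalState V) : RemovalState V :=
  { st with
    graphs := insert (graphInfo G (potentialEdges {u} X)) st.graphs
    parW := st.parW ∪ {i | ∃ w ∈ X, i = parInfo G (potentialEdges {w} st.rest)} }

open Classical in
/-- One round of the removal, which aims to remove `u`; `none` means failure. Here `blocks j` is
the block `W_j` for `1 ≤ j ≤ s`, and `pick` is the rule that picks one of the possible vertices
`w`; it may depend on everything revealed and removed so far. -/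
noncomputable def removalRound {V : Type*} (G : SimpleGraph V) (blocks : ℕ → Set V) (s : ℕ)
    (pick : RemovalState V → Set V → V) (st : RemovalState V) (x : Bool × V) :
    Option (RemovalState V) :=
  let u := x.2
  let st₁ := revealCenter G x.1 u st
  if par G (potentialEdges {u} st.rest) = 0 then
    some { st₁ with removed := st.removed ++ [u] }
  else
    let X : Set V := blocks (cyc s st.q) ∩ st.rest
    let st₂ := revealBlock G u X st₁
    let candidates : Set V :=
      {w | w ∈ X ∧ G.Adj u w ∧ par G (potentialEdges {w} st.rest) = 0}
    if candidates.Nonempty then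
      some { st₂ with
        removed := st.removed ++ [pick st₂ candidates, u]
        q := st.q + 1 }
    else none

/-- The `(U, W)`-removal on `G`, with `A` and `U` given by the lists `a` and `u`: the final state
if it succeeds, and `none` if it fails. -/
noncomputable def removal {V : Type*} (G : SimpleGraph V) (a u : List V) (blocks : ℕ → Set V)
    (s : ℕ) (pick : RemovalState V → Set V → V) : Option (RemovalState V) :=
  (a.map (fun v => (true, v)) ++ u.map (fun v => (false, v))).foldlM
    (removalRound G blocks s pick) (RemovalState.init V)

/-! ### The set-up of the two removals -/

/-- `0 = r 0 ≤ r 1 ≤ ⋯ ≤ r (s + 1) = m` cut `{1, …, m}` into `s + 1` intervals whose lengths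
pairwise differ by at most one. -/
structure IsCut (m s : ℕ) (r : ℕ → ℕ) : Prop where
  zero : r 0 = 0
  last : r (s + 1) = m
  mono : ∀ i ≤ s, r i ≤ r (i + 1)
  balanced : ∀ i ≤ s, ∀ j ≤ s, r (i + 1) - r i ≤ r (j + 1) - r j + 1

/-- For an ordering `l = (l₁, l₂, …)` the block number `j` consists of the `lₖ` with
`r (s - j) < k ≤ r (s - j + 1)`. The block number `0` is the one denoted by `#`; so the blocks
`#, 1, …, s` are decreasing in the order. (Lists are indexed from `0`.) -/
def block {V : Type*} (l : List V) (s : ℕ) (r : ℕ → ℕ) (j : ℕ) : Set V :=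
  {v | ∃ k, r (s - j) ≤ k ∧ k < r (s - j + 1) ∧ l[k]? = some v}

/-- The choices made before the two removals are run: orderings of `A`, `B`, `C`, where
`V = A ⊔ B ⊔ C` with `B`, `C` balanced, the number `s`, the cuts of `B` and `C` into `s + 1`
blocks, the number `η`, and for each removal a rule for picking the vertices `w`. -/
structure Setup (V : Type*) where
  a : List V
  b : List V
  c : List V
  nodup : (a ++ b ++ c).Nodup
  cover : ∀ v, v ∈ a ++ b ++ c
  balanced : b.length ≤ c.length + 1 ∧ c.length ≤ b.length + 1
  s : ℕ
  η : ℕ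
  cutB : ℕ → ℕ
  cutC : ℕ → ℕ
  isCutB : IsCut b.length s cutB
  isCutC : IsCut c.length s cutC
  pickBC : RemovalState V → Set V → V
  pickCB : RemovalState V → Set V → V
  pickBC_mem : ∀ st X, X.Nonempty → pickBC st X ∈ X
  pickCB_mem : ∀ st X, X.Nonempty → pickCB st X ∈ X

/-- The revealed part `A`. -/
def Setup.A {V : Type*} (S : Setup V) : Set V := {v | v ∈ S.a}

/-- The `(B, C)`-removal. -/
noncomputable def Setup.removalBC {V : Type*} (S : Setup V) (G : SimpleGraph V) :
    Option (RemovalState V) :=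
  removal G S.a S.b (block S.c S.s S.cutC) S.s S.pickBC

/-- The `(C, B)`-removal. -/
noncomputable def Setup.removalCB {V : Type*} (S : Setup V) (G : SimpleGraph V) :
    Option (RemovalState V) :=
  removal G S.a S.c (block S.b S.s S.cutB) S.s S.pickCB

/-! ### The vertex sets defined from the two removals

The sets for `B` are defined from the `(C, B)`-removal in exactly the same way as those for `C`
from the `(B, C)`-removal. So they are defined for a `Side`, and the comments are for `B`. -/

/-- One side of the set-up after a successful removal. -/
structure Side (V : Type*) where
  /-- the ordering of `B` -/
  order : List V
  s : ℕ
  η : ℕ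
  cut : ℕ → ℕ
  /-- the sequence `R_CB` of the vertices removed in the `(C, B)`-removal -/
  removed : List V

namespace Side

variable {V : Type*} (x : Side V)

/-- `B` -/
def all : Set V := {v | v ∈ x.order}

/-- `V_B` -/
def left : Set V := {v | v ∉ x.removed}

/-- `B_#` for `j = 0`, and `B_j` for `1 ≤ j ≤ s` -/
def blk (j : ℕ) : Set V := block x.order x.s x.cut j

open Classical in
/-- `β_1, β_2, …`: the vertices removed from `B`, in the order of removal -/
noncomputable def beta : List V := x.removed.filter (fun v => v ∈ x.order)

/-- `i_B`: the number of vertices removed from `B` -/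
noncomputable def num : ℕ := x.beta.length

/-- `D_B^P`: the union of `B_1, …, B_η` -/
def DP : Set V := ⋃ j ∈ Finset.Icc 1 x.η, x.blk j

/-- `D_B^Q`: the union of the `η` blocks with the numbers `i_B - η + 1, …, i_B` modulo `s` -/
noncomputable def DQ : Set V := ⋃ k ∈ Finset.range x.η, x.blk (cyc x.s (x.num - k))

/-- `A_B` -/
noncomputable def revealed : Set V := (x.blk 0 ∪ x.DP ∪ x.DQ) ∩ x.left

/-- `B^P`: the first `η` vertices removed from `B` -/
noncomputable def P : Set V := {v | v ∈ x.beta.take x.η}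

/-- `B^Q`: the last `η` vertices removed from `B` -/
noncomputable def Q : Set V := {v | v ∈ x.beta.drop (x.num - x.η)}

/-- `T_B^P` -/
noncomputable def TP : Set V := (x.left ∪ x.Q) \ (x.DP ∪ x.blk 0)

/-- `T_B^Q` -/
noncomputable def TQ : Set V := x.left \ x.revealed

/-- `Σ_B` -/
noncomputable def sigma : Set (Sym2 V) :=
  potentialEdges x.all x.all \
    (potentialEdges x.left x.left ∪ potentialEdges x.P x.TP ∪ potentialEdges x.Q x.TQ)

end Side

/-- The `B`-side, given the final state of the `(C, B)`-removal. -/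
def Setup.sideB {V : Type*} (S : Setup V) (stCB : RemovalState V) : Side V :=
  ⟨S.b, S.s, S.η, S.cutB, stCB.removed⟩

/-- The `C`-side, given the final state of the `(B, C)`-removal. -/
def Setup.sideC {V : Type*} (S : Setup V) (stBC : RemovalState V) : Side V :=
  ⟨S.c, S.s, S.η, S.cutC, stBC.removed⟩

/-- If both removals succeed on `G`: the `B`-side and the `C`-side. -/
noncomputable def Setup.outcome {V : Type*} (S : Setup V) (G : SimpleGraph V) :
    Option (Side V × Side V) :=
  (S.removalBC G).bind fun stBC => (S.removalCB G).map fun stCB => (S.sideB stCB, S.sideC stBC)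

/-! ### The revealed information `Γ` -/

/-- The information on one side that is revealed after the removals: `G[A_B]`, `par(J_{A_B})`,
`par(V_B)` and `G[Σ_B]`. -/
structure SideInfo (V : Type*) where
  graphRevealed : Set (Sym2 V) × Set (Sym2 V)
  parStars : Set (Set (Sym2 V) × ZMod 2)
  parLeft : Set (Sym2 V) × ZMod 2
  graphSigma : Set (Sym2 V) × Set (Sym2 V)

/-- See `SideInfo`. -/
noncomputable def Side.info {V : Type*} (x : Side V) (G : SimpleGraph V) : SideInfo V where
  graphRevealed := graphInfo G (potentialEdges x.revealed x.revealed)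
  parStars := {i | ∃ v ∈ x.revealed, i = parInfo G (potentialEdges {v} x.left)}
  parLeft := parInfo G (potentialEdges x.left x.left)
  graphSigma := graphInfo G x.sigma

/-- The values of `Γ`. -/
structure Info (V : Type*) where
  /-- `G[A]` -/
  graphA : Set (Sym2 V) × Set (Sym2 V)
  /-- the parities of the degrees of the vertices of `A` -/
  parStarsA : Set (Set (Sym2 V) × ZMod 2)
  /-- `par(V)` -/
  parV : Set (Sym2 V) × ZMod 2
  /-- `par(I_A)` in the `(B, C)`-removal -/
  parABC : Set (Set (Sym2 V) × ZMod 2)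
  /-- `par(I_A)` in the `(C, B)`-removal -/
  parACB : Set (Set (Sym2 V) × ZMod 2)
  /-- `par(I_B^P)`: stars centered in `B` in the `(B, C)`-removal -/
  parBP : Set (Set (Sym2 V) × ZMod 2)
  /-- `par(I_B^Q)`: stars centered in `B` in the `(C, B)`-removal -/
  parBQ : Set (Set (Sym2 V) × ZMod 2)
  /-- `par(I_C^P)`: stars centered in `C` in the `(C, B)`-removal -/
  parCP : Set (Set (Sym2 V) × ZMod 2)
  /-- `par(I_C^Q)`: stars centered in `C` in the `(B, C)`-removal -/
  parCQ : Set (Set (Sym2 V) × ZMod 2)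
  /-- `G[I_e]` in the `(B, C)`-removal -/
  graphsBC : Set (Set (Sym2 V) × Set (Sym2 V))
  /-- `G[I_e]` in the `(C, B)`-removal -/
  graphsCB : Set (Set (Sym2 V) × Set (Sym2 V))
  /-- the further information on the `B`-side -/
  infoB : SideInfo V
  /-- the further information on the `C`-side -/
  infoC : SideInfo V
  /-- `G` without `G[B]` and `G[C]` -/
  graphCross : Set (Sym2 V) × Set (Sym2 V)

/-- The random variable `Γ`, as a function of the graph; `none` if one of the removals fails. -/
noncomputable def Setup.Gam {V : Type*} (S : Setup V) (G : SimpleGraph V) : Option (Info V) :=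
  (S.removalBC G).bind fun stBC => (S.removalCB G).map fun stCB =>
    { graphA := graphInfo G (potentialEdges S.A S.A)
      parStarsA := {i | ∃ v ∈ S.A, i = parInfo G (potentialEdges {v} Set.univ)}
      parV := parInfo G (potentialEdges Set.univ Set.univ)
      parABC := stBC.parA
      parACB := stCB.parA
      parBP := stBC.parU
      parBQ := stCB.parW
      parCP := stCB.parU
      parCQ := stBC.parW
      graphsBC := stBC.graphs
      graphsCB := stCB.graphs
      infoB := (S.sideB stCB).info G
      infoC := (S.sideC stBC).info G
      graphCross := graphInfo G (potentialEdges Set.univ Set.univ \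
        (potentialEdges (S.sideB stCB).all (S.sideB stCB).all ∪
          potentialEdges (S.sideC stBC).all (S.sideC stBC).all)) }

/-! ### The leftover graphs -/

/-- The random graph `G[V_B] ∪ G[V_C]`, as a function of `G` (a graph on `V` with no edges outside
`V_B` and `V_C`); the sets `V_B` and `V_C` are those that `G` leads to. -/
noncomputable def Setup.leftover {V : Type*} (S : Setup V) (G : SimpleGraph V) : SimpleGraph V :=
  match S.outcome G with
  | some (x, y) => (G.induce x.left).spanningCoe ⊔ (G.induce y.left).spanningCoe
  | none => ⊥

/-- The law of the graph `G_B` (for the `B`-side): the partially revealed `p`-graph on `V_B` with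
revealed part `A_B` that agrees with `H[V_B]`. -/
noncomputable def Side.law {V : Type*} (x : Side V) (p : unitInterval) (H : SimpleGraph V) :
    Measure (SimpleGraph x.left) :=
  revealedLaw p (Subtype.val ⁻¹' x.revealed) (H.induce x.left)

/-- The law of the union `G_B ∪ G_C` of two independent graphs, on disjoint vertex sets `X` and
`Y`, as a graph on `V`. -/
noncomputable def unionLaw {V : Type*} {X Y : Set V} (μ : Measure (SimpleGraph X))
    (ν : Measure (SimpleGraph Y)) : Measure (SimpleGraph V) :=
  (μ.prod ν).map fun g => g.1.spanningCoe ⊔ g.2.spanningCoe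

end EvenDegenerate

/-!
Fix the graph `G₀` and describe another graph `G` by the symmetric matrix `D = G - G₀` over
`ZMod 2`. A removal is a deterministic function of what it reveals (`removal_replay`), so
`Γ(G) = Γ(G₀)` holds if and only if `D` satisfies a system of linear equations: `D` vanishes on the
revealed pairs, and the revealed stars have even sums (`Setup.Run.Gam_eq_iff`).

The pairs of `B` at which `D` is free are those inside `V_B` and those of the two rectangles
`S(B^P, T_B^P)` and `S(B^Q, T_B^Q)`. The point is that, once `D` on `V_B` is given and satisfies the
equations inside `V_B`, the remaining equations only prescribe the sums of the rows and columns of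
the two rectangles. The stars centered in `B` in the removal that removes all of `B` are forward
stars in the order of `B`; since `B^P` comes after `T_B^P` in this order, they give the column sums
of the first rectangle (`Side.BaseEq.forwardEq_iff`). The stars in the blocks of the other removal
give the row sums of both rectangles and the column sums of the second
(`Side.BaseEq.backwardEq_iff`). The column and row sums prescribed for a rectangle have the same
total by double counting and because the number of edges in `V_B` has the prescribed parity, so
they are compatible.

A random 0-1 matrix with independent entries has given compatible parities of its `r` row sums and
`c` column sums with probability almost independent of these parities: a Fourier expansion over the
characters of rows and columns bounds the relative error by `parityError l r c`, where
`l ≥ |1 - 2p|` bounds the bias of one entry. Hence the probability of `Γ = Γ₀` together with given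
feasible leftover graphs is a constant times the product of the probabilities of these graphs, up
to a factor close to one (`Setup.Run.fiber_bounds`), and normalizing gives the closeness
(`Setup.Run.isClose`). Finally `r = η` has the order of `n ^ (1 / 2 - α)` and `c` the order of `n`,
so that the error is at most `exp (-κ n ^ (1 / 2 - α))` (`parityError_le`).
-/

namespace EvenDegenerate

/-! ### Parities of the rows and columns of a random binary matrix -/

/-- The weight of the value `z` of a `p`-random bit. -/
noncomputable def bitWeight (p : ℝ) (z : ZMod 2) : ℝ := if z = 1 then p else 1 - p

/-- The nontrivial character of `ZMod 2`. -/
noncomputable def sign (z : ZMod 2) : ℝ := if z = 0 then 1 else -1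

theorem sign_zero : sign 0 = 1 := by simp [sign]

theorem sign_add (a b : ZMod 2) : sign (a + b) = sign a * sign b := by
  have h : ∀ z : ZMod 2, z = 0 ∨ z = 1 := by decide
  have h2 : (1 + 1 : ZMod 2) = 0 := by decide
  rcases h a with rfl | rfl <;> rcases h b with rfl | rfl <;> simp [sign, h2]

theorem sign_sum {ι : Type*} (s : Finset ι) (f : ι → ZMod 2) :
    sign (∑ i ∈ s, f i) = ∏ i ∈ s, sign (f i) := by
  classical
  induction s using Finset.induction_on with
  | empty => simp [sign_zero]
  | insert a s ha ih => rw [Finset.sum_insert ha, Finset.prod_insert ha, sign_add, ih]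

theorem abs_sign (z : ZMod 2) : |sign z| = 1 := by
  unfold sign; split_ifs <;> simp

theorem sum_bitWeight (p : ℝ) : ∑ z, bitWeight p z = 1 := by
  have : (Finset.univ : Finset (ZMod 2)) = {0, 1} := rfl
  rw [this, Finset.sum_pair (by decide)]
  simp [bitWeight]

theorem sum_bitWeight_mul_sign (p : ℝ) (m : ZMod 2) :
    ∑ z, bitWeight p z * sign (z * m) = if m = 0 then 1 else 1 - 2 * p := by
  have : (Finset.univ : Finset (ZMod 2)) = {0, 1} := rfl
  rw [this, Finset.sum_pair (by decide)]
  have h : ∀ z : ZMod 2, z = 0 ∨ z = 1 := by decide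
  rcases h m with rfl | rfl <;> simp [bitWeight, sign]
  ring

/-- The function counting the parity of the memberships `i ∈ S` and `j ∈ T`. -/
noncomputable def mismatch {ι κ : Type*} [DecidableEq ι] [DecidableEq κ] (S : Finset ι)
    (T : Finset κ) (e : ι × κ) : ZMod 2 :=
  (if e.1 ∈ S then 1 else 0) + (if e.2 ∈ T then 1 else 0)

theorem prod_indicator_eq {ι : Type*} [Fintype ι] (z : ι → ZMod 2) :
    (∏ i, (1 + sign (z i)) / 2) = if ∀ i, z i = 0 then 1 else 0 := by
  have h : ∀ i, (1 + sign (z i)) / 2 = if z i = 0 then 1 else 0 := by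
    intro i
    unfold sign; split_ifs <;> norm_num
  simp only [h]
  rw [Finset.prod_ite_zero]
  simp

/-- Fourier expansion of the probability that the parities of the rows and columns of a random
binary matrix have prescribed values. -/
theorem sum_bitWeight_parities {ι κ : Type*} [Fintype ι] [Fintype κ] [DecidableEq ι]
    [DecidableEq κ] (p : ℝ) (ρ : ι → ZMod 2) (γ : κ → ZMod 2) :
    (∑ X : ι × κ → ZMod 2, (∏ e, bitWeight p (X e)) *
      (if (∀ i, ∑ j, X (i, j) = ρ i) ∧ ∀ j, ∑ i, X (i, j) = γ j then 1 else 0)) =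
    (1 / 2) ^ (Fintype.card ι + Fintype.card κ) * ∑ S : Finset ι, ∑ T : Finset κ,
      sign (∑ i ∈ S, ρ i + ∑ j ∈ T, γ j) *
        ∏ e, if mismatch S T e = 0 then 1 else 1 - 2 * p := by
  have key : ∀ X : ι × κ → ZMod 2,
      (if (∀ i, ∑ j, X (i, j) = ρ i) ∧ ∀ j, ∑ i, X (i, j) = γ j then (1 : ℝ) else 0) =
      (1 / 2) ^ (Fintype.card ι + Fintype.card κ) * ∑ S : Finset ι, ∑ T : Finset κ,
        sign (∑ i ∈ S, ρ i + ∑ j ∈ T, γ j) * ∏ e, sign (X e * mismatch S T e) := by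
    intro X
    have h1 : (if (∀ i, ∑ j, X (i, j) = ρ i) ∧ ∀ j, ∑ i, X (i, j) = γ j then (1 : ℝ) else 0) =
        (∏ i, (1 + sign (∑ j, X (i, j) + ρ i)) / 2) *
          ∏ j, (1 + sign (∑ i, X (i, j) + γ j)) / 2 := by
      have h0 : ∀ a b : ZMod 2, a + b = 0 ↔ a = b := by decide
      rw [prod_indicator_eq, prod_indicator_eq]
      simp only [h0]
      split_ifs <;> simp_all
    rw [h1, Finset.prod_div_distrib, Finset.prod_div_distrib, Finset.prod_one_add,
      Finset.prod_one_add, Finset.powerset_univ, Finset.powerset_univ, Finset.prod_const,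
      Finset.prod_const, Finset.card_univ, Finset.card_univ, div_mul_div_comm,
      Finset.sum_mul_sum, ← pow_add, one_div, inv_pow, ← div_eq_inv_mul]
    congr 1
    refine Finset.sum_congr rfl fun S _ => Finset.sum_congr rfl fun T _ => ?_
    rw [← sign_sum, ← sign_sum, ← sign_sum, ← sign_add, ← sign_add]
    congr 1
    simp only [mismatch, mul_add, Finset.sum_add_distrib, mul_ite, mul_one, mul_zero,
      Fintype.sum_prod_type]
    have e1 : ∀ (f : ι → ZMod 2), ∑ i ∈ S, f i = ∑ i, if i ∈ S then f i else 0 := by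
      intro f; simp
    have e2 : ∀ (f : κ → ZMod 2), ∑ i ∈ T, f i = ∑ i, if i ∈ T then f i else 0 := by
      intro f; simp
    have e3 : ∑ j ∈ T, ∑ i, X (i, j) = ∑ i, ∑ j, if j ∈ T then X (i, j) else 0 := by
      rw [Finset.sum_comm]
      exact Finset.sum_congr rfl fun i _ => e2 _
    have e4 : ∑ i ∈ S, ∑ j, X (i, j) = ∑ i, ∑ j, if i ∈ S then X (i, j) else 0 := by
      rw [e1]
      refine Finset.sum_congr rfl fun i _ => ?_
      split_ifs <;> simp
    rw [e3, e4]
    ring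
  simp only [key]
  rw [Finset.mul_sum]
  simp_rw [Finset.mul_sum]
  rw [Finset.sum_comm]
  refine Finset.sum_congr rfl fun S _ => ?_
  rw [Finset.sum_comm]
  refine Finset.sum_congr rfl fun T _ => ?_
  have h2 := Finset.prod_univ_sum (fun _ : ι × κ => (Finset.univ : Finset (ZMod 2)))
    (fun e z => bitWeight p z * sign (z * mismatch S T e))
  simp only [sum_bitWeight_mul_sign, Fintype.piFinset_univ] at h2
  rw [h2, Finset.mul_sum, Finset.mul_sum]
  refine Finset.sum_congr rfl fun X _ => ?_
  rw [Finset.prod_mul_distrib]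
  ring

theorem sum_prod_mismatch {ι κ : Type*} [Fintype ι] [Fintype κ] [DecidableEq ι] [DecidableEq κ]
    (l : ℝ) (S : Finset ι) :
    ∑ T : Finset κ, ∏ e : ι × κ, (if mismatch S T e = 0 then 1 else l) =
      (l ^ S.card + l ^ (Fintype.card ι - S.card)) ^ Fintype.card κ := by
  have key : ∀ T : Finset κ, ∏ e : ι × κ, (if mismatch S T e = 0 then 1 else l) =
      (l ^ (Fintype.card ι - S.card)) ^ T.card * (l ^ S.card) ^ (Fintype.card κ - T.card) := by
    intro T
    rw [Fintype.prod_prod_type_right]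
    have : ∀ j, ∏ i, (if mismatch S T (i, j) = 0 then 1 else l) =
        if j ∈ T then l ^ (Fintype.card ι - S.card) else l ^ S.card := by
      intro j
      by_cases hj : j ∈ T
      · have : ∀ i, (if mismatch S T (i, j) = 0 then 1 else l) = if i ∈ S then 1 else l := by
          intro i
          have h2 : (1 + 1 : ZMod 2) = 0 := by decide
          by_cases hi : i ∈ S <;> simp [mismatch, hi, hj, h2]
        simp only [this, hj, if_true]
        rw [Finset.prod_ite]
        simp [Finset.filter_not, ← Finset.compl_eq_univ_sdiff, Finset.card_compl]
      · have : ∀ i, (if mismatch S T (i, j) = 0 then 1 else l) = if i ∈ S then l else 1 := by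
          intro i
          by_cases hi : i ∈ S <;> simp [mismatch, hi, hj]
        simp only [this, hj, if_false]
        rw [Finset.prod_ite]
        simp
    simp only [this]
    rw [Finset.prod_ite]
    simp [Finset.filter_not, ← Finset.compl_eq_univ_sdiff, Finset.card_compl]
  simp only [key]
  rw [Fintype.sum_pow_mul_eq_add_pow, add_comm]

theorem pow_add_pow_le {l : ℝ} (h0 : 0 ≤ l) (h1 : l ≤ 1) {a r : ℕ} (ha : 1 ≤ a) (har : a < r) :
    l ^ a + l ^ (r - a) ≤ l + l ^ (r - 1) := by
  obtain ⟨b, rfl⟩ := Nat.exists_eq_add_of_le' ha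
  obtain ⟨c, rfl⟩ := Nat.exists_eq_add_of_lt har
  have e1 : b + 1 + c + 1 - (b + 1) = c + 1 := by omega
  have e2 : b + 1 + c + 1 - 1 = b + c + 1 := by omega
  rw [e1, e2]
  have : 0 ≤ l * ((1 - l ^ c) * (1 - l ^ b)) :=
    mul_nonneg h0 (mul_nonneg (sub_nonneg.2 (pow_le_one₀ h0 h1)) (sub_nonneg.2 (pow_le_one₀ h0 h1)))
  have e3 : l * ((1 - l ^ c) * (1 - l ^ b)) = l + l ^ (b + c + 1) - (l ^ (b + 1) + l ^ (c + 1)) := by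
    ring
  linarith

/-- The bound for the relative error in the probability that the parities of the rows and columns
of a random `r × c` matrix have prescribed values, when `l` bounds the bias `|1 - 2p|` of an
entry. In the Fourier expansion over sets `S` of rows and `T` of columns, the term
`(1 + l ^ r) ^ c - 1` comes from `S = ∅` and from the set of all rows, and the second term from all
other `S`. -/
noncomputable def parityError (l : ℝ) (r c : ℕ) : ℝ :=
  (1 + l ^ r) ^ c - 1 + 2 ^ r * (l + l ^ (r - 1)) ^ c

theorem sum_mismatch_bound {ι : Type*} [Fintype ι] [Nonempty ι] {l : ℝ}
    (h0 : 0 ≤ l) (h1 : l ≤ 1) (c : ℕ) :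
    ∑ S : Finset ι, (l ^ S.card + l ^ (Fintype.card ι - S.card)) ^ c ≤
      2 + 2 * parityError l (Fintype.card ι) c := by
  classical
  set r := Fintype.card ι with hr
  have hne : (∅ : Finset ι) ≠ Finset.univ := by
    simpa using (Finset.univ_nonempty (α := ι)).ne_empty.symm
  have hB : 0 ≤ (l + l ^ (r - 1)) ^ c := by positivity
  have hle : ∀ S : Finset ι, (l ^ S.card + l ^ (r - S.card)) ^ c ≤
      (if S = ∅ then (1 + l ^ r) ^ c else 0) + (if S = Finset.univ then (1 + l ^ r) ^ c else 0) +
        (l + l ^ (r - 1)) ^ c := by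
    intro S
    by_cases hS : S = ∅
    · subst hS
      simp [hne, hB]
    by_cases hS' : S = Finset.univ
    · subst hS'
      simp [hne.symm, hB, ← hr, add_comm]
    · simp only [hS, hS', if_false, zero_add]
      gcongr ?_ ^ c
      refine pow_add_pow_le h0 h1 (Finset.card_pos.2 (Finset.nonempty_of_ne_empty hS)) ?_
      exact (Finset.card_lt_iff_ne_univ S).2 hS'
  refine (Finset.sum_le_sum fun S _ => hle S).trans ?_
  rw [Finset.sum_add_distrib, Finset.sum_add_distrib, Finset.sum_ite_eq', Finset.sum_ite_eq']
  simp only [Finset.mem_univ, if_true, Finset.sum_const, Finset.card_univ, Fintype.card_finset,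
    nsmul_eq_mul, parityError]
  push_cast
  have : (0:ℝ) ≤ 2 ^ r * (l + l ^ (r - 1)) ^ c := by positivity
  rw [← hr]
  linarith

/-- The probability that the parities of the rows and columns of a random binary matrix have
prescribed values, which must be compatible. -/
theorem parities_prob_bounds {ι κ : Type*} [Fintype ι] [Fintype κ] [DecidableEq ι]
    [DecidableEq κ] [Nonempty ι] {p l : ℝ} (hl : |1 - 2 * p| ≤ l) (hl1 : l ≤ 1)
    (ρ : ι → ZMod 2) (γ : κ → ZMod 2)
    (h : ∑ i, ρ i = ∑ j, γ j) :
    |(∑ X : ι × κ → ZMod 2, (∏ e, bitWeight p (X e)) *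
      (if (∀ i, ∑ j, X (i, j) = ρ i) ∧ ∀ j, ∑ i, X (i, j) = γ j then 1 else 0)) -
      2 * (1 / 2) ^ (Fintype.card ι + Fintype.card κ)| ≤
    2 * (1 / 2) ^ (Fintype.card ι + Fintype.card κ) *
      parityError l (Fintype.card ι) (Fintype.card κ) := by
  have h0 : 0 ≤ l := (abs_nonneg _).trans hl
  have e := sum_bitWeight_parities p ρ γ
  set K : ℝ := (1 / 2) ^ (Fintype.card ι + Fintype.card κ) with hK
  have hKpos : 0 < K := by positivity
  let g : Finset ι × Finset κ → ℝ := fun ST => sign (∑ i ∈ ST.1, ρ i + ∑ j ∈ ST.2, γ j) *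
        ∏ e, if mismatch ST.1 ST.2 e = 0 then 1 else 1 - 2 * p
  let f : Finset ι × Finset κ → ℝ := fun ST => ∏ e, if mismatch ST.1 ST.2 e = 0 then 1 else l
  have hgf : ∀ ST, |g ST| ≤ f ST := by
    intro ST
    simp only [g, f]
    rw [abs_mul, abs_sign, one_mul, Finset.abs_prod]
    refine Finset.prod_le_prod (fun _ _ => abs_nonneg _) fun e _ => ?_
    split_ifs
    · simp
    · exact hl
  have hsum : ∑ ST, f ST ≤ 2 + 2 * parityError l (Fintype.card ι) (Fintype.card κ) := by
    rw [Fintype.sum_prod_type]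
    simp only [f, sum_prod_mismatch]
    exact sum_mismatch_bound h0 hl1 _
  have hne : ((∅, ∅) : Finset ι × Finset κ) ≠ (Finset.univ, Finset.univ) := by
    intro h
    exact (Finset.univ_nonempty (α := ι)).ne_empty (Prod.ext_iff.1 h).1.symm
  -- the two main terms; they agree because the prescribed values are compatible
  have g1 : g (∅, ∅) = 1 := by simp [g, mismatch, sign_zero]
  have f1 : f (∅, ∅) = 1 := by simp [f, mismatch]
  have h2 : (1 + 1 : ZMod 2) = 0 := by decide
  have h3 : ∀ a : ZMod 2, a + a = 0 := by decide
  have g2 : g (Finset.univ, Finset.univ) = 1 := by simp [g, mismatch, h, h2, h3, sign_zero]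
  have f2 : f (Finset.univ, Finset.univ) = 1 := by simp [f, mismatch, h2]
  have hup : ∑ ST, g ST ≤ ∑ ST, f ST :=
    Finset.sum_le_sum fun ST _ => (le_abs_self _).trans (hgf ST)
  have hlow : 4 ≤ ∑ ST, (g ST + f ST) := by
    calc (4 : ℝ) = ∑ ST ∈ {((∅, ∅) : Finset ι × Finset κ), (Finset.univ, Finset.univ)},
          (g ST + f ST) := by
          rw [Finset.sum_pair hne, g1, f1, g2, f2]; norm_num
      _ ≤ _ := Finset.sum_le_sum_of_subset_of_nonneg (Finset.subset_univ _) fun ST _ _ => by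
          have := neg_le_of_abs_le (hgf ST)
          linarith
  rw [Finset.sum_add_distrib] at hlow
  have e' : (∑ X : ι × κ → ZMod 2, (∏ e, bitWeight p (X e)) *
      (if (∀ i, ∑ j, X (i, j) = ρ i) ∧ ∀ j, ∑ i, X (i, j) = γ j then 1 else 0)) =
      K * ∑ ST, g ST := by
    rw [Fintype.sum_prod_type, ← e]
  have e'' : (∑ X : ι × κ → ZMod 2, (∏ e, bitWeight p (X e)) *
      (if (∀ i, ∑ j, X (i, j) = ρ i) ∧ ∀ j, ∑ i, X (i, j) = γ j then 1 else 0)) -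
      2 * K = K * (∑ ST, g ST - 2) := by rw [e']; ring
  have e3 : 2 * K * parityError l (Fintype.card ι) (Fintype.card κ) =
    K * (2 * parityError l (Fintype.card ι) (Fintype.card κ)) := by ring
  rw [e3]
  rw [e'', abs_mul, abs_of_pos hKpos]
  refine mul_le_mul_of_nonneg_left ?_ hKpos.le
  rw [abs_le]
  constructor <;> linarith

/-! ### The binomial random graph as a product measure -/

open Classical in
/-- The indicator of the edge `e` in `G`, as an element of `ZMod 2`. -/
noncomputable def edgeBit {V : Type*} (G : SimpleGraph V) (e : Sym2 V) : ZMod 2 :=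
  if e ∈ G.edgeSet then 1 else 0

/-- The pairs of distinct vertices. -/
abbrev Pairs (V : Type*) := {e : Sym2 V // ¬ e.IsDiag}

theorem edgeBit_eq_iff {V : Type*} {G H : SimpleGraph V} {e : Sym2 V} :
    edgeBit G e = edgeBit H e ↔ (e ∈ G.edgeSet ↔ e ∈ H.edgeSet) := by
  unfold edgeBit
  split_ifs <;> simp_all

theorem edgeBit_eq_one {V : Type*} {G : SimpleGraph V} {e : Sym2 V} :
    edgeBit G e = 1 ↔ e ∈ G.edgeSet := by
  unfold edgeBit
  split_ifs <;> simp_all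

/-- Graphs correspond to binary functions on the pairs of distinct vertices. -/
noncomputable def graphEquiv (V : Type*) : SimpleGraph V ≃ (Pairs V → ZMod 2) where
  toFun G e := edgeBit G e
  invFun ω := SimpleGraph.fromEdgeSet {e | ∃ h, ω ⟨e, h⟩ = 1}
  left_inv G := by
    ext u v
    simp only [SimpleGraph.fromEdgeSet_adj, Set.mem_ofPred_eq, edgeBit_eq_one,
      SimpleGraph.mem_edgeSet, Sym2.mk_isDiag_iff, exists_prop]
    exact ⟨fun h => h.1.2, fun h => ⟨⟨h.ne, h⟩, h.ne⟩⟩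
  right_inv ω := by
    ext ⟨e, he⟩
    have h01 : ∀ a b : ZMod 2, (a = 1 ↔ b = 1) → a = b := by decide
    apply h01
    rw [edgeBit_eq_one, SimpleGraph.edgeSet_fromEdgeSet]
    constructor
    · rintro ⟨⟨h, h'⟩, -⟩
      exact h'
    · intro h
      exact ⟨⟨he, h⟩, by simpa using he⟩

instance {V : Type*} [Finite V] : MeasurableSingletonClass (SimpleGraph V) where
  measurableSet_singleton G := by
    have h : ({G} : Set (SimpleGraph V)) =
        ⋂ (u : V) (v : V), {G' | G'.Adj u v ↔ G.Adj u v} := by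
      ext G'
      simp only [Set.mem_singleton_iff, Set.mem_iInter, Set.mem_ofPred_eq, SimpleGraph.ext_iff,
        funext_iff, eq_iff_iff]
    rw [h]
    refine MeasurableSet.iInter fun u => MeasurableSet.iInter fun v => ?_
    exact (SimpleGraph.measurable_iff_adj.1 measurable_id u v).iff measurable_const |>.setOf

theorem binomialRandom_real_singleton {V : Type*} [Fintype V] [DecidableEq V]
    (p : unitInterval) (G : SimpleGraph V) :
    (SimpleGraph.binomialRandom V p).real {G} = ∏ e : Pairs V, bitWeight p (edgeBit G e) := by
  classical
  rw [measureReal_def, SimpleGraph.binomialRandom_singleton]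
  have h : ∀ e : Pairs V, bitWeight p (edgeBit G e) =
      if (e : Sym2 V) ∈ G.edgeSet then (p : ℝ) else 1 - p := by
    intro e
    simp [bitWeight, edgeBit_eq_one]
  simp only [h]
  rw [Finset.prod_ite]
  simp only [Finset.prod_const]
  have h1 : (Finset.univ.filter fun e : Pairs V => (e : Sym2 V) ∈ G.edgeSet).card =
      G.edgeSet.ncard := by
    rw [Set.ncard_eq_toFinset_card', ← Finset.card_map (Function.Embedding.subtype _)]
    congr 1
    ext e
    simp only [Finset.mem_map, Finset.mem_filter, Finset.mem_univ, true_and, Set.mem_toFinset,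
      Function.Embedding.coe_subtype, Subtype.exists, exists_and_left, exists_prop,
      exists_eq_right_right]
    constructor
    · exact fun h => h.1
    · exact fun h => ⟨h, G.not_isDiag_of_mem_edgeSet h⟩
  have h2 : (Finset.univ.filter fun e : Pairs V => (e : Sym2 V) ∉ G.edgeSet).card =
      (Nat.card V).choose 2 - G.edgeSet.ncard := by
    rw [Finset.filter_not, Finset.card_sdiff_of_subset (Finset.filter_subset _ _), h1,
      Finset.card_univ, Sym2.card_subtype_not_diag, Nat.card_eq_fintype_card]
  rw [h1, h2]
  simp

theorem binomialRandom_real_apply {V : Type*} [Fintype V] [DecidableEq V] (p : unitInterval)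
    (A : Set (SimpleGraph V)) [DecidablePred (· ∈ A)] :
    (SimpleGraph.binomialRandom V p).real A = ∑ ω : Pairs V → ZMod 2,
      (∏ e, bitWeight p (ω e)) * if (graphEquiv V).symm ω ∈ A then 1 else 0 := by
  classical
  have h1 : (SimpleGraph.binomialRandom V p).real A =
      ∑ G : SimpleGraph V, if G ∈ A then (SimpleGraph.binomialRandom V p).real {G} else 0 := by
    have : A = ((Finset.univ.filter (· ∈ A) : Finset (SimpleGraph V)) : Set (SimpleGraph V)) := by
      ext; simp
    conv_lhs => rw [this]
    rw [← sum_measureReal_singleton, Finset.sum_filter]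
  rw [h1]
  refine Fintype.sum_equiv (graphEquiv V) _ _ fun G => ?_
  rw [Equiv.symm_apply_apply, binomialRandom_real_singleton]
  simp [graphEquiv]

theorem sum_prod_bitWeight (p : ℝ) (ι : Type*) [Fintype ι] [DecidableEq ι] :
    ∑ X : ι → ZMod 2, ∏ e, bitWeight p (X e) = 1 := by
  have h := Finset.prod_univ_sum (fun _ : ι => (Finset.univ : Finset (ZMod 2)))
    (fun _ z => bitWeight p z)
  simp only [sum_bitWeight, Fintype.piFinset_univ, Finset.prod_const_one] at h
  exact h.symm

/-- An average over random bits does not change if the bits indexed by a subset are sampled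
again. -/
theorem sum_resample (p : ℝ) {I J : Type*} [Fintype I] [Fintype J] [DecidableEq I]
    [DecidableEq J] (φ : J ↪ I) (f : (I → ZMod 2) → ℝ) :
    ∑ ω : I → ZMod 2, (∏ e, bitWeight p (ω e)) * f ω =
      ∑ ω : I → ZMod 2, (∏ e, bitWeight p (ω e)) *
        ∑ X : J → ZMod 2, (∏ e, bitWeight p (X e)) * f (Function.extend φ X ω) := by
  have hl : ∑ ω : I → ZMod 2, (∏ e, bitWeight p (ω e)) * f ω =
      ∑ x : (I → ZMod 2) × (J → ZMod 2),
        (∏ e, bitWeight p (x.1 e)) * (∏ e, bitWeight p (x.2 e)) * f x.1 := by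
    rw [Fintype.sum_prod_type]
    refine Finset.sum_congr rfl fun ω _ => ?_
    have : ∀ X : J → ZMod 2,
        (∏ e, bitWeight p (ω e)) * (∏ e, bitWeight p (X e)) * f ω =
        ((∏ e, bitWeight p (ω e)) * f ω) * (∏ e, bitWeight p (X e)) := fun X => by ring
    simp only [this]
    rw [← Finset.mul_sum, sum_prod_bitWeight, mul_one]
  have hr : ∑ ω : I → ZMod 2, (∏ e, bitWeight p (ω e)) *
        ∑ X : J → ZMod 2, (∏ e, bitWeight p (X e)) * f (Function.extend φ X ω) =
      ∑ x : (I → ZMod 2) × (J → ZMod 2),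
        (∏ e, bitWeight p (x.1 e)) * (∏ e, bitWeight p (x.2 e)) * f (Function.extend φ x.2 x.1) := by
    rw [Fintype.sum_prod_type]
    refine Finset.sum_congr rfl fun ω _ => ?_
    rw [Finset.mul_sum]
    exact Finset.sum_congr rfl fun X _ => by ring
  rw [hl, hr]
  -- exchanging the old and the new bits is an involution that preserves the weights
  let σ : (I → ZMod 2) × (J → ZMod 2) → (I → ZMod 2) × (J → ZMod 2) :=
    fun x => (Function.extend φ x.2 x.1, x.1 ∘ φ)
  have hσ : Function.Involutive σ := by
    rintro ⟨ω, X⟩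
    refine Prod.ext ?_ ?_
    · funext e
      by_cases he : ∃ j, φ j = e
      · obtain ⟨j, rfl⟩ := he
        simp [σ, φ.injective.extend_apply]
      · simp [σ, Function.extend_apply' _ _ _ he]
    · funext j
      simp [σ, φ.injective.extend_apply]
  have hsplit : ∀ ω : I → ZMod 2, ∏ e, bitWeight p (ω e) =
      (∏ j, bitWeight p (ω (φ j))) * ∏ e ∈ (Finset.univ.map φ)ᶜ, bitWeight p (ω e) := by
    intro ω
    rw [← Finset.prod_mul_prod_compl (Finset.univ.map φ), Finset.prod_map]
  refine Fintype.sum_equiv (Function.Involutive.toPerm σ hσ) _ _ fun x => ?_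
  have h1 : (Function.Involutive.toPerm σ hσ) x = σ x := rfl
  rw [h1]
  have h2 : Function.extend φ (σ x).2 (σ x).1 = x.1 := congrArg Prod.fst (hσ x)
  rw [h2]
  congr 1
  rw [hsplit x.1, hsplit (σ x).1]
  have h3 : ∏ e ∈ (Finset.univ.map φ)ᶜ, bitWeight p ((σ x).1 e) =
      ∏ e ∈ (Finset.univ.map φ)ᶜ, bitWeight p (x.1 e) := by
    refine Finset.prod_congr rfl fun e he => ?_
    have : ¬ ∃ j, φ j = e := by simpa using he
    simp [σ, Function.extend_apply' _ _ _ this]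
  have h4 : ∏ j, bitWeight p ((σ x).1 (φ j)) = ∏ j, bitWeight p (x.2 j) :=
    Finset.prod_congr rfl fun j _ => by simp [σ, φ.injective.extend_apply]
  rw [h3, h4]
  simp only [σ, Function.comp_apply]
  ring

/-- The event that a random graph agrees with `H` on the set `K` of potential edges. -/
def agree {V : Type*} (K : Set (Sym2 V)) (H : SimpleGraph V) : Set (SimpleGraph V) :=
  {G | ∀ e ∈ K, (e ∈ G.edgeSet ↔ e ∈ H.edgeSet)}

theorem binomialRandom_real_agree {V : Type*} [Fintype V] [DecidableEq V] (p : unitInterval)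
    (K : Set (Sym2 V)) [DecidablePred (· ∈ K)] (H : SimpleGraph V) :
    (SimpleGraph.binomialRandom V p).real (agree K H) =
      ∏ e : Pairs V, if (e : Sym2 V) ∈ K then bitWeight p (edgeBit H e) else 1 := by
  classical
  rw [binomialRandom_real_apply]
  have h := Finset.prod_univ_sum
    (fun e : Pairs V => if (e : Sym2 V) ∈ K then {edgeBit H e} else Finset.univ)
    (fun _ z => bitWeight p z)
  have h1 : ∀ e : Pairs V,
      (∑ z ∈ (if (e : Sym2 V) ∈ K then {edgeBit H e} else Finset.univ), bitWeight p z) =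
        if (e : Sym2 V) ∈ K then bitWeight p (edgeBit H e) else 1 := by
    intro e
    split_ifs
    · simp
    · exact sum_bitWeight p
  simp only [h1] at h
  rw [h, ← Finset.sum_subset (Finset.subset_univ _)]
  · refine Finset.sum_congr rfl fun ω hω => ?_
    rw [if_pos, mul_one]
    intro e he
    by_cases hd : e.IsDiag
    · exact ⟨fun h => absurd hd (SimpleGraph.not_isDiag_of_mem_edgeSet _ h),
        fun h => absurd hd (SimpleGraph.not_isDiag_of_mem_edgeSet _ h)⟩
    · have := Fintype.mem_piFinset.1 hω ⟨e, hd⟩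
      simp only [he, if_true, Finset.mem_singleton] at this
      rw [← edgeBit_eq_iff, ← this]
      exact congrFun ((graphEquiv V).apply_symm_apply ω) ⟨e, hd⟩
  · intro ω _ hω
    rw [if_neg, mul_zero]
    contrapose! hω
    rw [Fintype.mem_piFinset]
    intro e
    split_ifs with he
    · have := edgeBit_eq_iff.2 (hω e he)
      rw [Finset.mem_singleton, ← this]
      exact (congrFun ((graphEquiv V).apply_symm_apply ω) e).symm
    · exact Finset.mem_univ _

/-- Disjoint sets of edges are independent. -/
theorem binomialRandom_real_agree_union {V : Type*} [Fintype V] (p : unitInterval)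
    {K L : Set (Sym2 V)} (hd : Disjoint K L) (H : SimpleGraph V) :
    (SimpleGraph.binomialRandom V p).real (agree (K ∪ L) H) =
      (SimpleGraph.binomialRandom V p).real (agree K H) *
        (SimpleGraph.binomialRandom V p).real (agree L H) := by
  classical
  simp only [binomialRandom_real_agree, ← Finset.prod_mul_distrib]
  refine Finset.prod_congr rfl fun e _ => ?_
  by_cases hK : (e : Sym2 V) ∈ K
  · simp [hK, Set.disjoint_left.1 hd hK]
  · simp [hK]

theorem mem_potentialEdges {V : Type*} {X Y : Set V} {u v : V} :
    s(u, v) ∈ potentialEdges X Y ↔ u ≠ v ∧ (u ∈ X ∧ v ∈ Y ∨ v ∈ X ∧ u ∈ Y) := by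
  constructor
  · rintro ⟨x, hx, y, hy, hne, h⟩
    rcases Sym2.eq_iff.1 h with ⟨rfl, rfl⟩ | ⟨rfl, rfl⟩
    · exact ⟨hne, Or.inl ⟨hx, hy⟩⟩
    · exact ⟨hne.symm, Or.inr ⟨hx, hy⟩⟩
  · rintro ⟨hne, ⟨hu, hv⟩ | ⟨hu, hv⟩⟩
    · exact ⟨u, hu, v, hv, hne, rfl⟩
    · exact ⟨v, hu, u, hv, hne.symm, Sym2.eq_swap⟩

/-- The subgraph of the random graph induced on `X` is a random graph. -/
theorem binomialRandom_real_agree_induce {V : Type*} [Fintype V] (p : unitInterval) (X : Set V)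
    (H : SimpleGraph V) :
    (SimpleGraph.binomialRandom V p).real (agree (potentialEdges X X) H) =
      (SimpleGraph.binomialRandom X p).real {H.induce X} := by
  classical
  rw [binomialRandom_real_agree, binomialRandom_real_singleton]
  symm
  let φ : Pairs X → Pairs V := fun e => ⟨Sym2.map Subtype.val e.1, by
    rw [Sym2.isDiag_map Subtype.val_injective]; exact e.2⟩
  have hφ : Function.Injective φ := by
    intro e e' h
    exact Subtype.ext (Sym2.map.injective Subtype.val_injective (congrArg Subtype.val h))
  have hmem : ∀ e : Pairs X, ((φ e : Pairs V) : Sym2 V) ∈ potentialEdges X X := by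
    rintro ⟨e, he⟩
    induction e using Sym2.ind with
    | _ u v =>
      simp only [φ, Sym2.map_mk, mem_potentialEdges]
      refine ⟨fun h => he ?_, Or.inl ⟨u.2, v.2⟩⟩
      simpa [Sym2.mk_isDiag_iff] using Subtype.ext h
  refine Fintype.prod_of_injective φ hφ _ _ ?_ ?_
  · intro e he
    rw [if_neg]
    rintro ⟨u, hu, v, hv, hne, h⟩
    refine he ⟨⟨s(⟨u, hu⟩, ⟨v, hv⟩), ?_⟩, ?_⟩
    · simpa [Sym2.mk_isDiag_iff] using hne
    · exact Subtype.ext h.symm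
  · intro e
    rw [if_pos (hmem e)]
    congr 1
    obtain ⟨e, he⟩ := e
    induction e using Sym2.ind with
    | _ u v => simp [φ, edgeBit]

/-! ### The parities of the rows and columns of a rectangle of edges -/

open Classical in
/-- The adjacency matrix with entries in `ZMod 2`. -/
noncomputable def adjBit {V : Type*} (G : SimpleGraph V) (u v : V) : ZMod 2 :=
  if G.Adj u v then 1 else 0

theorem adjBit_comm {V : Type*} (G : SimpleGraph V) (u v : V) : adjBit G u v = adjBit G v u := by
  by_cases h : G.Adj u v
  · rw [adjBit, adjBit, if_pos h, if_pos h.symm]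
  · rw [adjBit, adjBit, if_neg h, if_neg fun h' => h h'.symm]

theorem adjBit_self {V : Type*} (G : SimpleGraph V) (u : V) : adjBit G u u = 0 := by
  simp [adjBit]

theorem adjBit_eq_iff {V : Type*} {G H : SimpleGraph V} {u v : V} :
    adjBit G u v = adjBit H u v ↔ (G.Adj u v ↔ H.Adj u v) := by
  unfold adjBit
  split_ifs <;> simp_all

/-- The event that `G` has prescribed parities of the rows and columns of the rectangle with the
rows `P` and the columns `T`. -/
def paritiesEvent {V : Type*} (P T : Set V) (ρ γ : SimpleGraph V → V → ZMod 2) :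
    Set (SimpleGraph V) :=
  {G | (∀ b ∈ P, ∑ᶠ t ∈ T, adjBit G b t = ρ G b) ∧ ∀ t ∈ T, ∑ᶠ b ∈ P, adjBit G t b = γ G t}

/-- `G` and `G'` agree outside the rectangle with the rows `P` and the columns `T`. -/
def AgreeOff {V : Type*} (P T : Set V) (G G' : SimpleGraph V) : Prop :=
  ∀ u v, ¬ (u ∈ P ∧ v ∈ T) → ¬ (v ∈ P ∧ u ∈ T) → (G.Adj u v ↔ G'.Adj u v)

theorem finsum_mem_eq_sum_subtype {V : Type*} (T : Set V) [Fintype T] (f : V → ZMod 2) :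
    ∑ᶠ t ∈ T, f t = ∑ t : T, f t := by
  rw [← finsum_set_coe_eq_finsum_mem, finsum_eq_sum_of_fintype]

/-- Conditioning on an event that does not depend on a rectangle of edges, the parities of the
rows and columns of the rectangle have any compatible prescribed values with almost the same
probability. -/
theorem paritiesEvent_bounds {V : Type*} [Finite V] (p : unitInterval) {l : ℝ}
    (hl : |1 - 2 * (p : ℝ)| ≤ l) (hl1 : l ≤ 1) {P T : Set V} (hd : Disjoint P T)
    (hP : P.Nonempty) (A : Set (SimpleGraph V)) (ρ γ : SimpleGraph V → V → ZMod 2)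
    (hA : ∀ G G', AgreeOff P T G G' → G ∈ A → G' ∈ A)
    (hρ : ∀ G G', AgreeOff P T G G' → ∀ b ∈ P, ρ G b = ρ G' b)
    (hγ : ∀ G G', AgreeOff P T G G' → ∀ t ∈ T, γ G t = γ G' t)
    (hc : ∀ G ∈ A, ∑ᶠ b ∈ P, ρ G b = ∑ᶠ t ∈ T, γ G t) :
    2 * (1 / 2) ^ (P.ncard + T.ncard) * (1 - parityError l P.ncard T.ncard) *
        (SimpleGraph.binomialRandom V p).real A ≤
      (SimpleGraph.binomialRandom V p).real (A ∩ paritiesEvent P T ρ γ) ∧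
    (SimpleGraph.binomialRandom V p).real (A ∩ paritiesEvent P T ρ γ) ≤
      2 * (1 / 2) ^ (P.ncard + T.ncard) * (1 + parityError l P.ncard T.ncard) *
        (SimpleGraph.binomialRandom V p).real A := by
  classical
  cases nonempty_fintype V
  have : Nonempty P := hP.to_subtype
  let φ : P × T ↪ Pairs V := ⟨fun x => ⟨s((x.1 : V), (x.2 : V)), by
      rw [Sym2.mk_isDiag_iff]
      intro h
      exact Set.disjoint_left.1 hd x.1.2 (by rw [show (x.1 : V) = x.2 from h]; exact x.2.2)⟩, by
    rintro ⟨b, t⟩ ⟨b', t'⟩ h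
    rcases Sym2.eq_iff.1 (congrArg Subtype.val h) with ⟨h1, h2⟩ | ⟨h1, h2⟩
    · exact Prod.ext (Subtype.ext h1) (Subtype.ext h2)
    · exact absurd (show (b : V) ∈ T by rw [show (b : V) = t' from h1]; exact t'.2)
        (Set.disjoint_left.1 hd b.2)⟩
  set K : ℝ := 2 * (1 / 2) ^ (P.ncard + T.ncard) with hK
  set ε := parityError l P.ncard T.ncard with hε
  have hcP : Fintype.card P = P.ncard := by
    rw [← Nat.card_eq_fintype_card, Nat.card_coe_set_eq]
  have hcT : Fintype.card T = T.ncard := by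
    rw [← Nat.card_eq_fintype_card, Nat.card_coe_set_eq]
  have hext : ∀ (ω : Pairs V → ZMod 2) (X : P × T → ZMod 2),
      AgreeOff P T ((graphEquiv V).symm ω) ((graphEquiv V).symm (Function.extend φ X ω)) := by
    intro ω X u v h1 h2
    by_cases huv : u = v
    · subst huv; simp
    have hn : ¬ (s(u, v)).IsDiag := by simpa [Sym2.mk_isDiag_iff] using huv
    have e1 := congrFun ((graphEquiv V).apply_symm_apply ω) ⟨s(u, v), hn⟩
    have e2 := congrFun ((graphEquiv V).apply_symm_apply (Function.extend φ X ω)) ⟨s(u, v), hn⟩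
    rw [← SimpleGraph.mem_edgeSet, ← SimpleGraph.mem_edgeSet, ← edgeBit_eq_iff]
    change edgeBit _ _ = _ at e1 e2
    rw [e1, e2, Function.extend_apply']
    rintro ⟨⟨b, t⟩, h⟩
    rcases Sym2.eq_iff.1 (congrArg Subtype.val h) with ⟨rfl, rfl⟩ | ⟨rfl, rfl⟩
    · exact h1 ⟨b.2, t.2⟩
    · exact h2 ⟨b.2, t.2⟩
  have hrect : ∀ (ω : Pairs V → ZMod 2) (X : P × T → ZMod 2) (b : P) (t : T),
      adjBit ((graphEquiv V).symm (Function.extend φ X ω)) b t = X (b, t) := by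
    intro ω X b t
    have e2 := congrFun ((graphEquiv V).apply_symm_apply (Function.extend φ X ω)) (φ (b, t))
    rw [φ.injective.extend_apply] at e2
    rw [← e2]
    rfl
  have hsymm : ∀ {G G' : SimpleGraph V}, AgreeOff P T G G' → AgreeOff P T G' G :=
    fun h u v h1 h2 => (h u v h1 h2).symm
  -- the event after the edges of the rectangle are sampled again
  have hmem : ∀ (ω : Pairs V → ZMod 2) (X : P × T → ZMod 2),
      ((graphEquiv V).symm (Function.extend φ X ω) ∈ A ∩ paritiesEvent P T ρ γ) ↔
      (graphEquiv V).symm ω ∈ A ∧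
        (∀ b : P, ∑ t : T, X (b, t) = ρ ((graphEquiv V).symm ω) b) ∧
        ∀ t : T, ∑ b : P, X (b, t) = γ ((graphEquiv V).symm ω) t := by
    intro ω X
    have h := hext ω X
    have hA' : (graphEquiv V).symm (Function.extend φ X ω) ∈ A ↔ (graphEquiv V).symm ω ∈ A :=
      ⟨hA _ _ (hsymm h), hA _ _ h⟩
    simp only [Set.mem_inter_iff, hA', paritiesEvent, Set.mem_ofPred_eq,
      finsum_mem_eq_sum_subtype]
    refine and_congr_right fun _ => and_congr ?_ ?_
    · rw [Subtype.forall]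
      refine forall₂_congr fun b hb => ?_
      rw [hρ _ _ h b hb]
      simp only [← hrect ω X]
    · rw [Subtype.forall]
      refine forall₂_congr fun t ht => ?_
      rw [hγ _ _ h t ht]
      simp only [← hrect ω X, adjBit_comm _ t]
  have hB := binomialRandom_real_apply p (A ∩ paritiesEvent P T ρ γ)
  rw [sum_resample _ φ] at hB
  simp only [hmem] at hB
  rw [hB, binomialRandom_real_apply]
  have hinner : ∀ ω : Pairs V → ZMod 2,
      |(∑ X : P × T → ZMod 2, (∏ e, bitWeight p (X e)) *
        if ((graphEquiv V).symm ω ∈ A ∧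
          (∀ b : P, ∑ t : T, X (b, t) = ρ ((graphEquiv V).symm ω) b) ∧
          ∀ t : T, ∑ b : P, X (b, t) = γ ((graphEquiv V).symm ω) t) then (1 : ℝ) else 0) -
        K * (if (graphEquiv V).symm ω ∈ A then 1 else 0)| ≤
      K * ε * (if (graphEquiv V).symm ω ∈ A then 1 else 0) := by
    intro ω
    by_cases hω : (graphEquiv V).symm ω ∈ A
    · have hcc := hc _ hω
      rw [finsum_mem_eq_sum_subtype, finsum_mem_eq_sum_subtype] at hcc
      have := parities_prob_bounds hl hl1 (fun b : P => ρ ((graphEquiv V).symm ω) b)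
        (fun t : T => γ ((graphEquiv V).symm ω) t) hcc
      rw [hcP, hcT] at this
      simpa only [hω, true_and, if_true, mul_one] using this
    · simp [hω]
  have hW : ∀ ω : Pairs V → ZMod 2, 0 ≤ ∏ e, bitWeight p (ω e) := by
    intro ω
    refine Finset.prod_nonneg fun e _ => ?_
    unfold bitWeight
    split_ifs
    · exact p.2.1
    · linarith [p.2.2]
  constructor
  · rw [Finset.mul_sum]
    refine Finset.sum_le_sum fun ω _ => ?_
    have h := (abs_le.1 (hinner ω)).1
    have := mul_le_mul_of_nonneg_left h (hW ω)
    linarith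
  · rw [Finset.mul_sum]
    refine Finset.sum_le_sum fun ω _ => ?_
    have h := (abs_le.1 (hinner ω)).2
    have := mul_le_mul_of_nonneg_left h (hW ω)
    linarith

/-! ### The removal is determined by what it reveals -/

/-- The revealed information recorded in the state is correct for `G`. -/
def RemovalState.Agrees {V : Type*} (st : RemovalState V) (G : SimpleGraph V) : Prop :=
  (∀ i ∈ st.parA, par G i.1 = i.2) ∧ (∀ i ∈ st.parU, par G i.1 = i.2) ∧
    (∀ i ∈ st.parW, par G i.1 = i.2) ∧ ∀ i ∈ st.graphs, G.edgeSet ∩ i.1 = i.2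

/-- The information recorded in `st` is also recorded in `st'`. -/
def RemovalState.Sub {V : Type*} (st st' : RemovalState V) : Prop :=
  st.parA ⊆ st'.parA ∧ st.parU ⊆ st'.parU ∧ st.parW ⊆ st'.parW ∧ st.graphs ⊆ st'.graphs

theorem RemovalState.Sub.trans {V : Type*} {st st' st'' : RemovalState V} (h : st.Sub st')
    (h' : st'.Sub st'') : st.Sub st'' :=
  ⟨h.1.trans h'.1, h.2.1.trans h'.2.1, h.2.2.1.trans h'.2.2.1, h.2.2.2.trans h'.2.2.2⟩

theorem RemovalState.Agrees.mono {V : Type*} {st st' : RemovalState V} {G : SimpleGraph V}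
    (h : st'.Agrees G) (hs : st.Sub st') : st.Agrees G :=
  ⟨fun i hi => h.1 i (hs.1 hi), fun i hi => h.2.1 i (hs.2.1 hi),
    fun i hi => h.2.2.1 i (hs.2.2.1 hi), fun i hi => h.2.2.2 i (hs.2.2.2 hi)⟩

theorem revealCenter_removed {V : Type*} (G : SimpleGraph V) (isA : Bool) (u : V)
    (st : RemovalState V) : (revealCenter G isA u st).removed = st.removed := by
  unfold revealCenter; split_ifs <;> rfl

theorem revealCenter_graphs {V : Type*} (G : SimpleGraph V) (isA : Bool) (u : V)
    (st : RemovalState V) : (revealCenter G isA u st).graphs = st.graphs := by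
  unfold revealCenter; split_ifs <;> rfl

theorem revealCenter_parW {V : Type*} (G : SimpleGraph V) (isA : Bool) (u : V)
    (st : RemovalState V) : (revealCenter G isA u st).parW = st.parW := by
  unfold revealCenter; split_ifs <;> rfl

theorem revealCenter_q {V : Type*} (G : SimpleGraph V) (isA : Bool) (u : V)
    (st : RemovalState V) : (revealCenter G isA u st).q = st.q := by
  unfold revealCenter; split_ifs <;> rfl

theorem revealCenter_rest {V : Type*} (G : SimpleGraph V) (isA : Bool) (u : V)
    (st : RemovalState V) : (revealCenter G isA u st).rest = st.rest := by
  unfold RemovalState.rest; rw [revealCenter_removed]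

/-- The vertices `w` that can be removed before `u`. -/
def candidates {V : Type*} (G : SimpleGraph V) (blocks : ℕ → Set V) (s : ℕ)
    (st : RemovalState V) (u : V) : Set V :=
  {w | w ∈ blocks (cyc s st.q) ∩ st.rest ∧ G.Adj u w ∧ par G (potentialEdges {w} st.rest) = 0}

/-- The state after revealing all the information of a round in which a vertex `w` is needed. -/
noncomputable def revealRound {V : Type*} (G : SimpleGraph V) (blocks : ℕ → Set V) (s : ℕ)
    (st : RemovalState V) (x : Bool × V) : RemovalState V :=
  revealBlock G x.2 (blocks (cyc s st.q) ∩ st.rest) (revealCenter G x.1 x.2 st)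

theorem removalRound_eq_some {V : Type*} {G : SimpleGraph V} {blocks : ℕ → Set V} {s : ℕ}
    {pick : RemovalState V → Set V → V} {st st' : RemovalState V} {x : Bool × V} :
    removalRound G blocks s pick st x = some st' ↔
    (par G (potentialEdges {x.2} st.rest) = 0 ∧
      st' = { revealCenter G x.1 x.2 st with removed := st.removed ++ [x.2] }) ∨
    (par G (potentialEdges {x.2} st.rest) ≠ 0 ∧ (candidates G blocks s st x.2).Nonempty ∧
      st' = { revealRound G blocks s st x with
        removed := st.removed ++ [pick (revealRound G blocks s st x)
          (candidates G blocks s st x.2), x.2]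
        q := st.q + 1 }) := by
  unfold removalRound
  by_cases h : par G (potentialEdges {x.2} st.rest) = 0
  · simp [h, eq_comm]
  · by_cases h' : (candidates G blocks s st x.2).Nonempty
    · have h'' := h'
      unfold candidates at h''
      simp only [h, if_false, h'', if_true, false_and, ne_eq, not_false_eq_true, true_and,
        false_or, h', Option.some_inj]
      exact eq_comm
    · have h'' := h'
      unfold candidates at h''
      simp only [h, if_false, h'', false_and, ne_eq, not_false_eq_true, h', and_false, or_false,
        reduceCtorEq]

theorem sub_revealCenter {V : Type*} (G : SimpleGraph V) (isA : Bool) (u : V)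
    (st : RemovalState V) : st.Sub (revealCenter G isA u st) := by
  unfold revealCenter RemovalState.Sub
  split_ifs <;> simp [Set.subset_insert]

theorem sub_revealRound {V : Type*} (G : SimpleGraph V) (blocks : ℕ → Set V) (s : ℕ)
    (st : RemovalState V) (x : Bool × V) :
    (revealCenter G x.1 x.2 st).Sub (revealRound G blocks s st x) := by
  unfold revealRound revealBlock RemovalState.Sub
  simp [Set.subset_insert]

theorem sub_of_removalRound {V : Type*} {G : SimpleGraph V} {blocks : ℕ → Set V} {s : ℕ}
    {pick : RemovalState V → Set V → V} {st st' : RemovalState V} {x : Bool × V}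
    (h : removalRound G blocks s pick st x = some st') : st.Sub st' := by
  rcases removalRound_eq_some.1 h with ⟨-, rfl⟩ | ⟨-, -, rfl⟩
  · exact sub_revealCenter G x.1 x.2 st
  · exact (sub_revealCenter G x.1 x.2 st).trans (sub_revealRound G blocks s st x)

theorem sub_of_foldlM {V : Type*} {G : SimpleGraph V} {blocks : ℕ → Set V} {s : ℕ}
    {pick : RemovalState V → Set V → V} (L : List (Bool × V)) {st st' : RemovalState V}
    (h : L.foldlM (removalRound G blocks s pick) st = some st') : st.Sub st' := by
  induction L generalizing st with
  | nil =>
    cases h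
    exact ⟨subset_rfl, subset_rfl, subset_rfl, subset_rfl⟩
  | cons x L ih =>
    rw [List.foldlM_cons] at h
    obtain ⟨st₁, h1, h2⟩ := Option.bind_eq_some_iff.1 h
    exact (sub_of_removalRound h1).trans (ih h2)

theorem agrees_revealCenter {V : Type*} {G : SimpleGraph V} (isA : Bool) (u : V)
    {st : RemovalState V} (h : st.Agrees G) : (revealCenter G isA u st).Agrees G := by
  unfold revealCenter
  obtain ⟨h1, h2, h3, h4⟩ := h
  split_ifs
  · refine ⟨?_, h2, h3, h4⟩
    rintro i (rfl | hi)
    · rfl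
    · exact h1 i hi
  · refine ⟨h1, ?_, h3, h4⟩
    rintro i (rfl | hi)
    · rfl
    · exact h2 i hi

theorem agrees_revealBlock {V : Type*} {G : SimpleGraph V} (u : V) (X : Set V)
    {st : RemovalState V} (h : st.Agrees G) : (revealBlock G u X st).Agrees G := by
  obtain ⟨h1, h2, h3, h4⟩ := h
  refine ⟨h1, h2, ?_, ?_⟩
  · rintro i (hi | ⟨w, -, rfl⟩)
    · exact h3 i hi
    · rfl
  · rintro i (rfl | hi)
    · rfl
    · exact h4 i hi

theorem agrees_of_foldlM {V : Type*} {G : SimpleGraph V} {blocks : ℕ → Set V} {s : ℕ}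
    {pick : RemovalState V → Set V → V} (L : List (Bool × V)) {st st' : RemovalState V}
    (hst : st.Agrees G)
    (h : L.foldlM (removalRound G blocks s pick) st = some st') : st'.Agrees G := by
  induction L generalizing st with
  | nil =>
    cases h
    exact hst
  | cons x L ih =>
    rw [List.foldlM_cons] at h
    obtain ⟨st₁, h1, h2⟩ := Option.bind_eq_some_iff.1 h
    refine ih ?_ h2
    rcases removalRound_eq_some.1 h1 with ⟨-, rfl⟩ | ⟨-, -, rfl⟩
    · exact agrees_revealCenter x.1 x.2 hst
    · exact agrees_revealBlock _ _ (agrees_revealCenter x.1 x.2 hst)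

/-- What the state after a removal has recorded is correct. -/
theorem agrees_of_removal {V : Type*} {G : SimpleGraph V} {a u : List V} {blocks : ℕ → Set V}
    {s : ℕ} {pick : RemovalState V → Set V → V} {st : RemovalState V}
    (h : removal G a u blocks s pick = some st) : st.Agrees G :=
  agrees_of_foldlM _ ⟨by simp [RemovalState.init], by simp [RemovalState.init],
    by simp [RemovalState.init], by simp [RemovalState.init]⟩ h

theorem removalRound_replay {V : Type*} {G G₀ : SimpleGraph V} {blocks : ℕ → Set V} {s : ℕ}
    {pick : RemovalState V → Set V → V} {st st' : RemovalState V} {x : Bool × V}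
    (h : removalRound G₀ blocks s pick st x = some st') (hG : st'.Agrees G) :
    removalRound G blocks s pick st x = some st' := by
  have hc : ∀ st'', (revealCenter G₀ x.1 x.2 st).Sub st'' → st''.Agrees G →
      par G (potentialEdges {x.2} st.rest) = par G₀ (potentialEdges {x.2} st.rest) ∧
      revealCenter G x.1 x.2 st = revealCenter G₀ x.1 x.2 st := by
    intro st'' hs hA
    have hp : par G (potentialEdges {x.2} st.rest) = par G₀ (potentialEdges {x.2} st.rest) := by
      unfold revealCenter at hs
      split_ifs at hs with hx
      · exact hA.1 (parInfo G₀ (potentialEdges {x.2} st.rest)) (hs.1 (Set.mem_insert _ _))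
      · exact hA.2.1 (parInfo G₀ (potentialEdges {x.2} st.rest)) (hs.2.1 (Set.mem_insert _ _))
    refine ⟨hp, ?_⟩
    unfold revealCenter parInfo
    rw [hp]
  rw [removalRound_eq_some] at h ⊢
  rcases h with ⟨h0, rfl⟩ | ⟨h0, hne, rfl⟩
  · obtain ⟨hp, hr⟩ := hc { revealCenter G₀ x.1 x.2 st with removed := st.removed ++ [x.2] }
      ⟨subset_rfl, subset_rfl, subset_rfl, subset_rfl⟩ hG
    exact Or.inl ⟨hp.trans h0, by rw [hr]⟩
  · have hs : (revealRound G₀ blocks s st x).Agrees G := hG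
    obtain ⟨hp, hr⟩ := hc _ (sub_revealRound G₀ blocks s st x) hs
    set X := blocks (cyc s st.q) ∩ st.rest with hX
    have hrest : (revealCenter G₀ x.1 x.2 st).rest = st.rest := revealCenter_rest _ _ _ _
    have hw : ∀ w ∈ X,
        par G (potentialEdges {w} st.rest) = par G₀ (potentialEdges {w} st.rest) := by
      intro w hw
      refine hs.2.2.1 (parInfo G₀ (potentialEdges {w} st.rest)) (Or.inr ⟨w, hw, ?_⟩)
      rw [hrest]
    have hg : G.edgeSet ∩ potentialEdges {x.2} X = G₀.edgeSet ∩ potentialEdges {x.2} X :=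
      hs.2.2.2 (graphInfo G₀ (potentialEdges {x.2} X)) (Set.mem_insert _ _)
    have hadj : ∀ w ∈ X, (G.Adj x.2 w ↔ G₀.Adj x.2 w) := by
      intro w hw
      by_cases hxw : x.2 = w
      · subst hxw; simp
      · have hm : s(x.2, w) ∈ potentialEdges {x.2} X :=
          mem_potentialEdges.2 ⟨hxw, Or.inl ⟨rfl, hw⟩⟩
        have := Set.ext_iff.1 hg s(x.2, w)
        simpa [hm] using this
    have hcand : candidates G blocks s st x.2 = candidates G₀ blocks s st x.2 := by
      ext w
      refine and_congr_right fun hwX => ?_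
      rw [hadj w hwX, hw w hwX]
    have hrr : revealRound G blocks s st x = revealRound G₀ blocks s st x := by
      unfold revealRound revealBlock
      rw [hr, ← hX]
      congr 1
      · congr 1
        ext i
        refine exists_congr fun w => and_congr_right fun hwX => ?_
        rw [hrest, parInfo, parInfo, hw w hwX]
      · rw [graphInfo, graphInfo, hg]
    refine Or.inr ⟨by rwa [hp], by rwa [hcand], ?_⟩
    rw [hrr, hcand]

/-- If `G` agrees with `G₀` on everything that was revealed in a removal on `G₀`, then the removal
on `G` is the same. -/
theorem removal_replay {V : Type*} {G G₀ : SimpleGraph V} {a u : List V} {blocks : ℕ → Set V}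
    {s : ℕ} {pick : RemovalState V → Set V → V} {st : RemovalState V}
    (h : removal G₀ a u blocks s pick = some st) (hG : st.Agrees G) :
    removal G a u blocks s pick = some st := by
  have key : ∀ (L : List (Bool × V)) (st₀ : RemovalState V),
      L.foldlM (removalRound G₀ blocks s pick) st₀ = some st →
      L.foldlM (removalRound G blocks s pick) st₀ = some st := by
    intro L
    induction L with
    | nil => exact fun _ h => h
    | cons x L ih =>
      intro st₀ h
      rw [List.foldlM_cons] at h ⊢
      obtain ⟨st₁, h1, h2⟩ := Option.bind_eq_some_iff.1 h
      exact Option.bind_eq_some_iff.2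
        ⟨st₁, removalRound_replay h1 (hG.mono (sub_of_foldlM L h2)), ih _ h2⟩
  exact key _ _ h

/-! ### The stars revealed in the removal -/

/-- The position of `v` in the list `l`, counted from `0`. -/
noncomputable def rank {V : Type*} (l : List V) (v : V) : ℕ := sInf {k | l[k]? = some v}

theorem rank_eq {V : Type*} {l : List V} (hl : l.Nodup) {k : ℕ} {v : V} (h : l[k]? = some v) :
    rank l v = k := by
  have h1 : l[rank l v]? = some v := Nat.sInf_mem (s := {k | l[k]? = some v}) ⟨k, h⟩
  obtain ⟨h2, h3⟩ := List.getElem?_eq_some_iff.1 h1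
  obtain ⟨h4, h5⟩ := List.getElem?_eq_some_iff.1 h
  exact (hl.getElem_inj_iff).1 (h3.trans h5.symm)

theorem getElem?_rank {V : Type*} {l : List V} {v : V} (h : v ∈ l) :
    l[rank l v]? = some v := by
  obtain ⟨k, hk⟩ := List.getElem?_of_mem h
  exact Nat.sInf_mem (s := {k | l[k]? = some v}) ⟨k, hk⟩

theorem rank_lt {V : Type*} {l : List V} {v : V} (h : v ∈ l) : rank l v < l.length :=
  (List.getElem?_eq_some_iff.1 (getElem?_rank h)).1

theorem rank_inj {V : Type*} {l : List V} {u v : V} (hu : u ∈ l) (hv : v ∈ l)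
    (h : rank l u = rank l v) : u = v := by
  have h1 := getElem?_rank hu
  rw [h, getElem?_rank hv] at h1
  exact (Option.some_inj.1 h1).symm

theorem rank_append {V : Type*} {a u : List V} (h : (a ++ u).Nodup) {v : V} (hv : v ∈ u) :
    rank (a ++ u) v = a.length + rank u v := by
  apply rank_eq h
  rw [List.getElem?_append_right (by omega), Nat.add_sub_cancel_left]
  exact getElem?_rank hv

open Classical in
/-- The vertices of `w` in the list `r`, in the order of `r`. -/
noncomputable def removedFrom {V : Type*} (w r : List V) : List V := r.filter (fun v => v ∈ w)

/-- What is known about the state of the `(U, W)`-removal after `k` rounds. Here `a`, `u`, `w` are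
the orderings of `A`, `U`, `W`. The set of ends of a revealed star is only described on the vertices
at which graphs with the same `Γ` can differ: on `A ∪ U` for a star centered in `U`, and on `W` for
a star centered in `W`. -/
structure RemovalInv {V : Type*} (G : SimpleGraph V) (a u w : List V) (blocks : ℕ → Set V)
    (s : ℕ) (k : ℕ) (st : RemovalState V) : Prop where
  nodup : st.removed.Nodup
  mem_removed : ∀ v ∈ a ++ u, (v ∈ st.removed ↔ rank (a ++ u) v < k)
  q_eq : st.q = (removedFrom w st.removed).length + 1
  mem_block : ∀ m v, (removedFrom w st.removed)[m]? = some v → v ∈ blocks (cyc s (m + 1))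
  parA : ∀ i ∈ st.parA, ∃ v ∈ a, ∃ X, i = parInfo G (potentialEdges {v} X)
  parU : ∀ i ∈ st.parU, ∃ v ∈ u, ∃ X, (∀ y ∈ a ++ u, (y ∈ X ↔ rank (a ++ u) v ≤ rank (a ++ u) y)) ∧
    i = parInfo G (potentialEdges {v} X)
  exists_parU : ∀ v ∈ u, rank (a ++ u) v < k →
    ∃ X, (∀ y ∈ a ++ u, (y ∈ X ↔ rank (a ++ u) v ≤ rank (a ++ u) y)) ∧
      parInfo G (potentialEdges {v} X) ∈ st.parU
  parW : ∀ i ∈ st.parW, ∃ m < (removedFrom w st.removed).length, ∃ v ∈ blocks (cyc s (m + 1)),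
    v ∉ (removedFrom w st.removed).take m ∧
    ∃ X, (∀ y ∈ w, (y ∈ X ↔ y ∉ (removedFrom w st.removed).take m)) ∧
      i = parInfo G (potentialEdges {v} X)
  exists_parW : ∀ m < (removedFrom w st.removed).length, ∀ v ∈ blocks (cyc s (m + 1)),
    v ∉ (removedFrom w st.removed).take m →
    ∃ X, (∀ y ∈ w, (y ∈ X ↔ y ∉ (removedFrom w st.removed).take m)) ∧
      parInfo G (potentialEdges {v} X) ∈ st.parW
  graphs : ∀ i ∈ st.graphs, ∃ v ∈ a ++ u, ∃ X ⊆ {y | y ∈ w},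
    i = graphInfo G (potentialEdges {v} X)

theorem RemovalInv.of_init {V : Type*} (G : SimpleGraph V) (a u w : List V)
    (blocks : ℕ → Set V) (s : ℕ) : RemovalInv G a u w blocks s 0 (RemovalState.init V) where
  nodup := by simp [RemovalState.init]
  mem_removed := by simp [RemovalState.init]
  q_eq := by simp [RemovalState.init, removedFrom]
  mem_block := by simp [RemovalState.init, removedFrom]
  parA := by simp [RemovalState.init]
  parU := by simp [RemovalState.init]
  exists_parU := by simp
  parW := by simp [RemovalState.init]
  exists_parW := by simp [RemovalState.init, removedFrom]
  graphs := by simp [RemovalState.init]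

section Step

variable {V : Type*} {G : SimpleGraph V} {a u w : List V} {blocks : ℕ → Set V} {s k : ℕ}
  {st st' : RemovalState V} {x : Bool × V}

theorem RemovalInv.mem_rest_iff (h : RemovalInv G a u w blocks s k st) {y : V}
    (hy : y ∈ a ++ u) : y ∈ st.rest ↔ k ≤ rank (a ++ u) y := by
  rw [← not_lt, ← h.mem_removed y hy]
  rfl

theorem mem_rest_iff_removedFrom {y : V} (hy : y ∈ w) :
    y ∈ st.rest ↔ y ∉ removedFrom w st.removed := by
  simp [RemovalState.rest, removedFrom, hy]

/-- The center `x` of the round is revealed; the flag of `x` tells which list it belongs to. -/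
theorem RemovalInv.revealCenter (h : RemovalInv G a u w blocks s k st)
    (hx : if x.1 then x.2 ∈ a else x.2 ∈ u) (hk : rank (a ++ u) x.2 = k) :
    (∀ i ∈ (revealCenter G x.1 x.2 st).parA, ∃ v ∈ a, ∃ X, i = parInfo G (potentialEdges {v} X)) ∧
    (∀ i ∈ (revealCenter G x.1 x.2 st).parU, ∃ v ∈ u, ∃ X,
      (∀ y ∈ a ++ u, (y ∈ X ↔ rank (a ++ u) v ≤ rank (a ++ u) y)) ∧
        i = parInfo G (potentialEdges {v} X)) ∧
    (∀ v ∈ u, (v ∈ a → False) → rank (a ++ u) v < k + 1 →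
      ∃ X, (∀ y ∈ a ++ u, (y ∈ X ↔ rank (a ++ u) v ≤ rank (a ++ u) y)) ∧
        parInfo G (potentialEdges {v} X) ∈ (EvenDegenerate.revealCenter G x.1 x.2 st).parU) := by
  have hX : ∀ y ∈ a ++ u, (y ∈ st.rest ↔ rank (a ++ u) x.2 ≤ rank (a ++ u) y) := by
    intro y hy
    rw [h.mem_rest_iff hy, hk]
  unfold EvenDegenerate.revealCenter
  split_ifs at hx ⊢ with hb
  · refine ⟨?_, h.parU, ?_⟩
    · rintro i (rfl | hi)
      · exact ⟨x.2, hx, _, rfl⟩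
      · exact h.parA i hi
    · intro v hv hva hvk
      refine h.exists_parU v hv (lt_of_le_of_ne (Nat.lt_succ_iff.1 hvk) fun he => hva ?_)
      rw [rank_inj (List.mem_append_right a hv) (List.mem_append_left u hx) (he.trans hk.symm)]
      exact hx
  · refine ⟨h.parA, ?_, ?_⟩
    · rintro i (rfl | hi)
      · exact ⟨x.2, hx, _, hX, rfl⟩
      · exact h.parU i hi
    · intro v hv hva hvk
      by_cases he : rank (a ++ u) v = k
      · have : v = x.2 := rank_inj (List.mem_append_right a hv) (List.mem_append_right a hx)
          (he.trans hk.symm)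
        subst this
        exact ⟨st.rest, hX, Set.mem_insert _ _⟩
      · obtain ⟨X, hX1, hX2⟩ := h.exists_parU v hv (by omega)
        exact ⟨X, hX1, Set.mem_insert_of_mem _ hX2⟩

theorem RemovalInv.step {pick : RemovalState V → Set V → V} (h : RemovalInv G a u w blocks s k st)
    (hnd : (a ++ u ++ w).Nodup) (hblocks : ∀ j, blocks j ⊆ {v | v ∈ w})
    (hpick : ∀ st X, X.Nonempty → pick st X ∈ X)
    (hx : if x.1 then x.2 ∈ a else x.2 ∈ u) (hk : rank (a ++ u) x.2 = k)
    (hround : removalRound G blocks s pick st x = some st') :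
    RemovalInv G a u w blocks s (k + 1) st' := by
  have hnd' := List.nodup_append'.1 hnd
  have hdis : ∀ v ∈ a ++ u, v ∉ w := fun v h1 h2 => hnd'.2.2 h1 h2
  have hau := List.nodup_append'.1 hnd'.1
  have hxau : x.2 ∈ a ++ u := by
    split_ifs at hx
    · exact List.mem_append_left _ hx
    · exact List.mem_append_right _ hx
  have hxw := hdis _ hxau
  have hxr : x.2 ∉ st.removed := by
    rw [h.mem_removed _ hxau, hk]; exact lt_irrefl k
  have hle : ∀ v ∈ a ++ u, (rank (a ++ u) v < k + 1 ↔ rank (a ++ u) v < k ∨ v = x.2) := by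
    intro v hv
    constructor
    · intro hlt
      rcases Nat.lt_succ_iff_lt_or_eq.1 hlt with h1 | h1
      · exact Or.inl h1
      · exact Or.inr (rank_inj hv hxau (h1.trans hk.symm))
    · rintro (h1 | rfl)
      · omega
      · omega
  obtain ⟨hA, hU, hU'⟩ := h.revealCenter hx hk
  rcases removalRound_eq_some.1 hround with ⟨-, rfl⟩ | ⟨-, hne, rfl⟩
  · have hrem : removedFrom w (st.removed ++ [x.2]) = removedFrom w st.removed := by
      simp [removedFrom, hxw]
    constructor
    case nodup =>
      exact List.nodup_append'.2 ⟨h.nodup, by simp, by simpa using hxr⟩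
    case mem_removed =>
      intro v hv
      rw [hle v hv, ← h.mem_removed v hv]
      simp
    case q_eq => simp only [hrem, revealCenter_q, h.q_eq]
    case mem_block => simpa only [hrem] using h.mem_block
    case parA => exact hA
    case parU => exact hU
    case exists_parU => exact fun v hv hvk => hU' v hv (fun hva => hau.2.2 hva hv) hvk
    case parW => simpa only [hrem, revealCenter_parW] using h.parW
    case exists_parW => simpa only [hrem, revealCenter_parW] using h.exists_parW
    case graphs => simpa only [revealCenter_graphs] using h.graphs
  · set y := pick (revealRound G blocks s st x) (candidates G blocks s st x.2) with hy
    obtain ⟨⟨hyb, hyr⟩, -, -⟩ : y ∈ candidates G blocks s st x.2 := hpick _ _ hne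
    have hyw : y ∈ w := hblocks _ hyb
    have hyx : y ≠ x.2 := fun e => hxw (e ▸ hyw)
    set β := removedFrom w st.removed with hβ
    have hrem : removedFrom w (st.removed ++ [y, x.2]) = β ++ [y] := by
      simp [hβ, removedFrom, hxw, hyw]
    have htake : ∀ m ≤ β.length, (β ++ [y]).take m = β.take m := fun m hm =>
      List.take_append_of_le_length hm
    have hlen : (β ++ [y]).length = β.length + 1 := by simp
    have hXrest : ∀ z ∈ w, (z ∈ st.rest ↔ z ∉ (β ++ [y]).take β.length) := by
      intro z hz
      rw [htake _ le_rfl, List.take_length]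
      exact mem_rest_iff_removedFrom hz
    constructor
    case nodup =>
      refine List.nodup_append'.2 ⟨h.nodup, by simp [hyx], ?_⟩
      intro z hz hz'
      simp only [List.mem_cons, List.not_mem_nil, or_false] at hz'
      rcases hz' with rfl | rfl
      · exact hyr hz
      · exact hxr hz
    case mem_removed =>
      intro v hv
      have hvy : v ≠ y := fun e => hdis v hv (e ▸ hyw)
      rw [hle v hv, ← h.mem_removed v hv]
      simp [hvy]
    case q_eq => simp only [hrem, hlen, h.q_eq]; rfl
    case mem_block =>
      intro m v hm
      simp only [hrem] at hm
      rcases lt_or_ge m β.length with hlt | hge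
      · rw [List.getElem?_append_left hlt] at hm
        exact h.mem_block m v hm
      · have hm' : m = β.length := by
          have := (List.getElem?_eq_some_iff.1 hm).1
          omega
        subst hm'
        simp only [List.getElem?_concat_length, Option.some_inj] at hm
        rw [← hm, ← h.q_eq]
        exact hyb
    case parA => exact hA
    case parU => exact hU
    case exists_parU => exact fun v hv hvk => hU' v hv (fun hva => hau.2.2 hva hv) hvk
    case parW =>
      simp only [hrem, hlen]
      rintro i (hi | ⟨v, ⟨hvb, hvr⟩, rfl⟩)
      · rw [revealCenter_parW] at hi
        obtain ⟨m, hm, v, hv, hvm, X, hX, rfl⟩ := h.parW i hi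
        refine ⟨m, Nat.lt_succ_of_lt hm, v, hv, by rwa [htake m hm.le], X, ?_, rfl⟩
        rwa [htake m hm.le]
      · refine ⟨β.length, by omega, v, by rwa [← h.q_eq], (hXrest v (hblocks _ hvb)).1 hvr,
          st.rest, hXrest, ?_⟩
        rw [revealCenter_rest]
    case exists_parW =>
      simp only [hrem, hlen]
      intro m hm v hv hvm
      rcases Nat.lt_succ_iff_lt_or_eq.1 hm with hlt | rfl
      · rw [htake m hlt.le] at hvm ⊢
        obtain ⟨X, hX1, hX2⟩ := h.exists_parW m hlt v hv hvm
        refine ⟨X, hX1, Or.inl ?_⟩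
        rw [revealCenter_parW]
        exact hX2
      · refine ⟨st.rest, hXrest, Or.inr ⟨v, ⟨by rwa [h.q_eq], ?_⟩, ?_⟩⟩
        · exact (hXrest v (hblocks _ hv)).2 hvm
        · rw [revealCenter_rest]
    case graphs =>
      rintro i (rfl | hi)
      · exact ⟨x.2, hxau, _, fun z hz => hblocks _ hz.1, rfl⟩
      · rw [revealCenter_graphs] at hi
        exact h.graphs i hi

end Step

theorem removal_inv {V : Type*} {G : SimpleGraph V} {a u w : List V} {blocks : ℕ → Set V} {s : ℕ}
    {pick : RemovalState V → Set V → V} {st : RemovalState V}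
    (hnd : (a ++ u ++ w).Nodup) (hblocks : ∀ j, blocks j ⊆ {v | v ∈ w})
    (hpick : ∀ st X, X.Nonempty → pick st X ∈ X)
    (h : removal G a u blocks s pick = some st) :
    RemovalInv G a u w blocks s (a ++ u).length st := by
  set L : List (Bool × V) := a.map (fun v => (true, v)) ++ u.map (fun v => (false, v)) with hL
  have hLlen : L.length = (a ++ u).length := by simp [hL]
  have hsnd : L.map Prod.snd = a ++ u := by simp [hL, Function.comp_def]
  have hflag : ∀ x ∈ L, if x.1 then x.2 ∈ a else x.2 ∈ u := by
    intro x hx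
    simp only [hL, List.mem_append, List.mem_map] at hx
    rcases hx with ⟨v, hv, rfl⟩ | ⟨v, hv, rfl⟩ <;> simpa
  have key : ∀ (L' : List (Bool × V)) (k : ℕ) (st₀ : RemovalState V), L.drop k = L' →
      k ≤ L.length → RemovalInv G a u w blocks s k st₀ →
      L'.foldlM (removalRound G blocks s pick) st₀ = some st →
      RemovalInv G a u w blocks s (a ++ u).length st := by
    intro L'
    induction L' with
    | nil =>
      intro k st₀ hk hk' hinv hf
      cases hf
      have : L.length ≤ k := List.drop_eq_nil_iff.1 hk
      rwa [← hLlen, le_antisymm this hk']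
    | cons x L' ih =>
      intro k st₀ hk hk' hinv hf
      rw [List.foldlM_cons] at hf
      obtain ⟨st₁, h1, h2⟩ := Option.bind_eq_some_iff.1 hf
      have hkl : k < L.length := by
        by_contra hcon
        rw [List.drop_eq_nil_of_le (not_lt.1 hcon)] at hk
        cases hk
      have hxk : L[k]? = some x := by
        have := congrArg List.head? hk
        simpa [List.head?_drop] using this
      have hxL : x ∈ L := List.mem_of_getElem? hxk
      have hrank : rank (a ++ u) x.2 = k := by
        apply rank_eq (List.nodup_append'.1 hnd).1
        rw [← hsnd, List.getElem?_map, hxk]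
        rfl
      refine ih (k + 1) st₁ ?_ hkl
        (hinv.step hnd hblocks hpick (hflag x hxL) hrank h1) h2
      rw [← List.drop_drop, hk]
      rfl
  exact key L 0 _ (by simp) (Nat.zero_le _) (RemovalInv.of_init G a u w blocks s) h

/-! ### The combinatorics of one side -/

theorem finsum_mem_eq_of_support {V : Type*} {f : V → ZMod 2} {X Y : Set V}
    (h : ∀ y, f y ≠ 0 → (y ∈ X ↔ y ∈ Y)) : ∑ᶠ y ∈ X, f y = ∑ᶠ y ∈ Y, f y :=
  finsum_mem_inter_support_eq' f X Y h

theorem add_eq_zero_iff_zmod {a b : ZMod 2} : a + b = 0 ↔ a = b := by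
  revert a b; decide

theorem mem_take_iff_rank {V : Type*} {l : List V} (hl : l.Nodup) {v : V} {q : ℕ} :
    v ∈ l.take q ↔ v ∈ l ∧ rank l v < q := by
  constructor
  · intro h
    obtain ⟨k, hk⟩ := List.getElem?_of_mem h
    rw [List.getElem?_take] at hk
    split_ifs at hk with hkq
    exact ⟨List.mem_of_getElem? hk, by rwa [rank_eq hl hk]⟩
  · rintro ⟨h1, h2⟩
    refine List.mem_of_getElem? (i := rank l v) ?_
    rw [List.getElem?_take, if_pos h2, getElem?_rank h1]

theorem mem_drop_iff_rank {V : Type*} {l : List V} (hl : l.Nodup) {v : V} {q : ℕ} :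
    v ∈ l.drop q ↔ v ∈ l ∧ q ≤ rank l v := by
  constructor
  · intro h
    obtain ⟨k, hk⟩ := List.getElem?_of_mem h
    rw [List.getElem?_drop] at hk
    exact ⟨List.mem_of_getElem? hk, by rw [rank_eq hl hk]; omega⟩
  · rintro ⟨h1, h2⟩
    refine List.mem_of_getElem? (i := rank l v - q) ?_
    rw [List.getElem?_drop, Nat.add_sub_cancel' h2, getElem?_rank h1]

theorem cyc_eq_self {s j : ℕ} (h1 : 1 ≤ j) (h2 : j ≤ s) : cyc s j = j := by
  unfold cyc
  rw [Nat.mod_eq_of_lt (by omega)]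
  omega

namespace Side

variable {V : Type*}

/-- What is known about a side after a successful removal if `η` and `s` are not too large. -/
structure Regular (x : Side V) : Prop where
  nodup : x.order.Nodup
  beta_nodup : x.beta.Nodup
  left_subset : x.left ⊆ x.all
  isCut : IsCut x.order.length x.s x.cut
  mem_blk : ∀ m v, x.beta[m]? = some v → v ∈ x.blk (cyc x.s (m + 1))
  η_le : x.η ≤ x.s
  s_le : x.s ≤ x.num
  two_η_le : 2 * x.η ≤ x.num

theorem _root_.EvenDegenerate.IsCut.le_of_le {m s : ℕ} {r : ℕ → ℕ} (h : IsCut m s r) {i j : ℕ}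
    (hij : i ≤ j) (hj : j ≤ s + 1) : r i ≤ r j := by
  induction j, hij using Nat.le_induction with
  | base => exact le_rfl
  | succ j hij ih => exact (ih (by omega)).trans (h.mono j (by omega))

theorem mem_beta_iff {x : Side V} {v : V} : v ∈ x.beta ↔ v ∈ x.all ∧ v ∉ x.left := by
  simp [beta, all, left, and_comm]

theorem beta_subset_all {x : Side V} {v : V} (h : v ∈ x.beta) : v ∈ x.all := (mem_beta_iff.1 h).1

theorem revealed_subset_left (x : Side V) : x.revealed ⊆ x.left := Set.inter_subset_right

/-- The vertices of the blocks `#, 1, …, η`. -/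
def top (x : Side V) : Set V := x.DP ∪ x.blk 0

namespace Regular

variable {x : Side V}

theorem mem_blk_iff (hx : x.Regular) {j : ℕ} {v : V} :
    v ∈ x.blk j ↔ v ∈ x.all ∧ x.cut (x.s - j) ≤ rank x.order v ∧
      rank x.order v < x.cut (x.s - j + 1) := by
  constructor
  · rintro ⟨k, h1, h2, h3⟩
    rw [rank_eq hx.nodup h3]
    exact ⟨List.mem_of_getElem? h3, h1, h2⟩
  · rintro ⟨h1, h2, h3⟩
    exact ⟨_, h2, h3, getElem?_rank h1⟩

theorem exists_blk (hx : x.Regular) {v : V} (hv : v ∈ x.all) : ∃ j ≤ x.s, v ∈ x.blk j := by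
  have hlt : rank x.order v < x.cut (x.s + 1) := by
    rw [hx.isCut.last]; exact rank_lt hv
  have hex : ∃ i, rank x.order v < x.cut (i + 1) := ⟨x.s, hlt⟩
  classical
  let i := Nat.find hex
  have hi : rank x.order v < x.cut (i + 1) := Nat.find_spec hex
  have his : i ≤ x.s := Nat.find_min' hex hlt
  refine ⟨x.s - i, Nat.sub_le _ _, hx.mem_blk_iff.2 ⟨hv, ?_⟩⟩
  rw [Nat.sub_sub_self his]
  refine ⟨?_, hi⟩
  rcases Nat.eq_zero_or_pos i with h0 | h0
  · rw [h0, hx.isCut.zero]; exact Nat.zero_le _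
  · have := Nat.find_min hex (m := i - 1) (Nat.sub_lt h0 one_pos)
    rw [Nat.sub_add_cancel (show 1 ≤ i from h0)] at this
    exact not_lt.1 this

theorem mem_top_iff (hx : x.Regular) {v : V} :
    v ∈ x.top ↔ v ∈ x.all ∧ x.cut (x.s - x.η) ≤ rank x.order v := by
  have hηs := hx.η_le
  constructor
  · rintro (h | h)
    · simp only [DP, Set.mem_iUnion, Finset.mem_Icc] at h
      obtain ⟨j, ⟨h1, h2⟩, h3⟩ := h
      obtain ⟨h4, h5, -⟩ := hx.mem_blk_iff.1 h3
      have := hx.isCut.le_of_le (i := x.s - x.η) (j := x.s - j) (by omega) (by omega)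
      exact ⟨h4, this.trans h5⟩
    · obtain ⟨h4, h5, -⟩ := hx.mem_blk_iff.1 h
      have := hx.isCut.le_of_le (i := x.s - x.η) (j := x.s - 0) (by omega) (by omega)
      exact ⟨h4, this.trans h5⟩
  · rintro ⟨h1, h2⟩
    obtain ⟨j, hj, hv⟩ := hx.exists_blk h1
    rcases Nat.eq_zero_or_pos j with rfl | hj0
    · exact Or.inr hv
    · left
      simp only [DP, Set.mem_iUnion, Finset.mem_Icc]
      refine ⟨j, ⟨hj0, ?_⟩, hv⟩
      by_contra hcon
      have h3 := (hx.mem_blk_iff.1 hv).2.2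
      have := hx.isCut.le_of_le (i := x.s - j + 1) (j := x.s - x.η) (by omega) (by omega)
      omega

theorem mem_top_of_rank_le (hx : x.Regular) {u v : V} (hu : u ∈ x.top) (hv : v ∈ x.all)
    (h : rank x.order u ≤ rank x.order v) : v ∈ x.top :=
  hx.mem_top_iff.2 ⟨hv, (hx.mem_top_iff.1 hu).2.trans h⟩

theorem mem_blk_rank (hx : x.Regular) {v : V} (hv : v ∈ x.beta) :
    v ∈ x.blk (cyc x.s (rank x.beta v + 1)) := hx.mem_blk _ _ (getElem?_rank hv)

theorem mem_P_iff (hx : x.Regular) {v : V} : v ∈ x.P ↔ v ∈ x.beta ∧ rank x.beta v < x.η :=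
  mem_take_iff_rank hx.beta_nodup

theorem mem_Q_iff (hx : x.Regular) {v : V} :
    v ∈ x.Q ↔ v ∈ x.beta ∧ x.num - x.η ≤ rank x.beta v :=
  mem_drop_iff_rank hx.beta_nodup

/-- The vertices of the block treated in a round with `q < η` are in the blocks `1, …, η`. -/
theorem mem_top_of_lt (hx : x.Regular) {q : ℕ} (hq : q < x.η) {v : V}
    (hv : v ∈ x.blk (cyc x.s (q + 1))) : v ∈ x.top := by
  have := hx.η_le
  rw [cyc_eq_self (by omega) (by omega)] at hv
  left
  simp only [DP, Set.mem_iUnion, Finset.mem_Icc]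
  exact ⟨q + 1, ⟨by omega, by omega⟩, hv⟩

theorem P_subset_top (hx : x.Regular) {v : V} (hv : v ∈ x.P) : v ∈ x.top :=
  hx.mem_top_of_lt (hx.mem_P_iff.1 hv).2 (hx.mem_blk_rank (hx.mem_P_iff.1 hv).1)

theorem P_subset_all (hx : x.Regular) {v : V} (hv : v ∈ x.P) : v ∈ x.all :=
  beta_subset_all (hx.mem_P_iff.1 hv).1

theorem Q_subset_all (hx : x.Regular) {v : V} (hv : v ∈ x.Q) : v ∈ x.all :=
  beta_subset_all (hx.mem_Q_iff.1 hv).1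

theorem notMem_left_of_P (hx : x.Regular) {v : V} (hv : v ∈ x.P) : v ∉ x.left :=
  (mem_beta_iff.1 (hx.mem_P_iff.1 hv).1).2

theorem notMem_left_of_Q (hx : x.Regular) {v : V} (hv : v ∈ x.Q) : v ∉ x.left :=
  (mem_beta_iff.1 (hx.mem_Q_iff.1 hv).1).2

theorem notMem_Q_of_P (hx : x.Regular) {v : V} (hv : v ∈ x.P) : v ∉ x.Q := by
  intro h
  have h1 := (hx.mem_P_iff.1 hv).2
  have h2 := (hx.mem_Q_iff.1 h).2
  have := hx.two_η_le
  omega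

theorem mem_TQ_iff {v : V} : v ∈ x.TQ ↔ v ∈ x.left ∧ v ∉ x.top ∧ v ∉ x.DQ := by
  simp only [TQ, revealed, top, Set.mem_sdiff, Set.mem_inter_iff, Set.mem_union]
  tauto

theorem TQ_subset_TP {v : V} (hv : v ∈ x.TQ) : v ∈ x.TP :=
  ⟨Or.inl (mem_TQ_iff.1 hv).1, (mem_TQ_iff.1 hv).2.1⟩

theorem TP_subset_all (hx : x.Regular) {v : V} (hv : v ∈ x.TP) : v ∈ x.all := by
  rcases hv.1 with h | h
  · exact hx.left_subset h
  · exact hx.Q_subset_all h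

theorem notMem_TP_of_P (hx : x.Regular) {v : V} (hv : v ∈ x.P) : v ∉ x.TP := fun h =>
  h.2 (hx.P_subset_top hv)

theorem disjoint_P_TP (hx : x.Regular) : Disjoint x.P x.TP :=
  Set.disjoint_left.2 fun _ hv => hx.notMem_TP_of_P hv

theorem disjoint_Q_TQ (hx : x.Regular) : Disjoint x.Q x.TQ :=
  Set.disjoint_left.2 fun _ hv h => hx.notMem_left_of_Q hv h.1

theorem mem_revealed_of_top {v : V} (hv : v ∈ x.left) (ht : v ∈ x.top) : v ∈ x.revealed := by
  refine ⟨?_, hv⟩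
  rcases ht with h | h
  · exact Or.inl (Or.inr h)
  · exact Or.inl (Or.inl h)

end Regular

/-! ### The revealed information as a system of linear equations -/

/-- The entries of `f` above `b` in the order of the side. -/
noncomputable def above (x : Side V) (f : V → V → ZMod 2) (b y : V) : ZMod 2 :=
  if rank x.order b ≤ rank x.order y then f b y else 0

/-- The equations which say that the symmetric matrix `f` (the difference of the adjacency matrices
of two graphs) vanishes on the part of the side outside `V_B`, `S(B^P, T_B^P)` and `S(B^Q, T_B^Q)`,
and that the information revealed inside `V_B` is the same for both graphs. -/
structure BaseEq (x : Side V) (f : V → V → ZMod 2) : Prop where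
  symm : ∀ u v, f u v = f v u
  diag : ∀ u, f u u = 0
  sigma : ∀ u v, s(u, v) ∈ x.sigma → f u v = 0
  revealed : ∀ u ∈ x.revealed, ∀ v ∈ x.revealed, f u v = 0
  star : ∀ u ∈ x.revealed, ∑ᶠ y ∈ x.left, f u y = 0
  pairs : ∑ᶠ u ∈ x.left, ∑ᶠ y ∈ x.left, x.above f u y = 0

/-- The equations for the stars centered in `B` in the `(B, C)`-removal. -/
def ForwardEq (x : Side V) (f : V → V → ZMod 2) : Prop :=
  ∀ b ∈ x.all, ∑ᶠ y ∈ x.all, x.above f b y = 0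

/-- The equations for the stars centered in `B` in the `(C, B)`-removal. -/
def BackwardEq (x : Side V) (f : V → V → ZMod 2) : Prop :=
  ∀ q < x.num, ∀ w ∈ x.blk (cyc x.s (q + 1)), w ∉ x.beta.take q →
    ∑ᶠ y ∈ {y | y ∈ x.all ∧ y ∉ x.beta.take q}, f w y = 0

/-- The equations for the rows and columns of `S(B^P, T_B^P)`. -/
def PEq (x : Side V) (f : V → V → ZMod 2) : Prop :=
  (∀ b ∈ x.P, ∑ᶠ t ∈ x.TP, f b t = 0) ∧
    ∀ t ∈ x.TP, ∑ᶠ b ∈ x.P, f t b = ∑ᶠ y ∈ x.all \ x.P, x.above f t y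

/-- The equations for the rows and columns of `S(B^Q, T_B^Q)`. -/
def QEq (x : Side V) (f : V → V → ZMod 2) : Prop :=
  (∀ b ∈ x.Q, ∑ᶠ t ∈ x.TQ, f b t = 0) ∧ ∀ t ∈ x.TQ, ∑ᶠ b ∈ x.Q, f t b = ∑ᶠ y ∈ x.left, f t y

namespace BaseEq

variable {x : Side V} {f : V → V → ZMod 2}

theorem cases_of_ne_zero (hf : x.BaseEq f) {u v : V} (hu : u ∈ x.all) (hv : v ∈ x.all)
    (h : f u v ≠ 0) : (u ∈ x.left ∧ v ∈ x.left) ∨ (u ∈ x.P ∧ v ∈ x.TP) ∨ (v ∈ x.P ∧ u ∈ x.TP) ∨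
      (u ∈ x.Q ∧ v ∈ x.TQ) ∨ (v ∈ x.Q ∧ u ∈ x.TQ) := by
  by_contra hcon
  refine h ?_
  by_cases huv : u = v
  · rw [huv]; exact hf.diag v
  refine hf.sigma u v ⟨mem_potentialEdges.2 ⟨huv, Or.inl ⟨hu, hv⟩⟩, ?_⟩
  rintro ((h | h) | h) <;> rw [mem_potentialEdges] at h <;> tauto

theorem above_ne_zero {b y : V} (h : x.above f b y ≠ 0) :
    rank x.order b ≤ rank x.order y ∧ f b y ≠ 0 := by
  unfold above at h
  split_ifs at h with h1
  · exact ⟨h1, h⟩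
  · exact absurd rfl h

variable (hx : x.Regular) (hf : x.BaseEq f)
include hx hf

/-- Every edge of the part of the side that is not known contributes to the forward star of a
vertex of `T_B^P`. -/
theorem above_eq_zero {b y : V} (hb : b ∈ x.all) (hbT : b ∉ x.TP) (hy : y ∈ x.all) :
    x.above f b y = 0 := by
  by_contra hne
  obtain ⟨hr, hne⟩ := above_ne_zero hne
  have htop : b ∈ x.top → y ∈ x.top := fun h => hx.mem_top_of_rank_le h hy hr
  rcases hf.cases_of_ne_zero hb hy hne with ⟨h1, h2⟩ | ⟨h1, h2⟩ | ⟨h1, h2⟩ | ⟨h1, h2⟩ | ⟨h1, h2⟩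
  · by_cases hbt : b ∈ x.top
    · exact hne (hf.revealed _ (Regular.mem_revealed_of_top h1 hbt) _
        (Regular.mem_revealed_of_top h2 (htop hbt)))
    · exact hbT ⟨Or.inl h1, hbt⟩
  · exact h2.2 (htop (hx.P_subset_top h1))
  · exact hbT h2
  · by_cases hbt : b ∈ x.top
    · exact (Regular.mem_TQ_iff.1 h2).2.1 (htop hbt)
    · exact hbT ⟨Or.inr h1, hbt⟩
  · exact hbT (Regular.TQ_subset_TP h2)

theorem forwardEq_iff [Finite V] : x.ForwardEq f ↔
    ∀ t ∈ x.TP, ∑ᶠ b ∈ x.P, f t b = ∑ᶠ y ∈ x.all \ x.P, x.above f t y := by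
  have key : ∀ t ∈ x.TP, (∑ᶠ y ∈ x.all, x.above f t y = 0 ↔
      ∑ᶠ b ∈ x.P, f t b = ∑ᶠ y ∈ x.all \ x.P, x.above f t y) := by
    intro t ht
    rw [← add_eq_zero_iff_zmod (a := ∑ᶠ b ∈ x.P, f t b)]
    have h1 : x.all = x.P ∪ (x.all \ x.P) :=
      (Set.union_sdiff_cancel fun _ h => hx.P_subset_all h).symm
    conv_lhs => rw [h1]
    rw [finsum_mem_union Set.disjoint_sdiff_right (Set.toFinite _) (Set.toFinite _)]
    have h2 : ∑ᶠ y ∈ x.P, x.above f t y = ∑ᶠ y ∈ x.P, f t y := by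
      refine finsum_mem_congr rfl fun y hy => ?_
      unfold above
      rw [if_pos]
      by_contra hcon
      exact ht.2 (hx.mem_top_of_rank_le (hx.P_subset_top hy) (hx.TP_subset_all ht)
        (not_le.1 hcon).le)
    rw [h2]
  constructor
  · exact fun h t ht => (key t ht).1 (h t (hx.TP_subset_all ht))
  · intro h b hb
    by_cases hbT : b ∈ x.TP
    · exact (key b hbT).2 (h b hbT)
    · exact finsum_mem_eq_zero_of_forall_eq_zero fun y hy => hf.above_eq_zero hx hb hbT hy

omit hf in
/-- The vertices of `T_B^P` are not in a block treated while `B^P` is being removed. -/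
theorem not_P_TP {q : ℕ} {w y : V} (hw : w ∈ x.blk (cyc x.s (q + 1)))
    (hyq : y ∉ x.beta.take q) (hy : y ∈ x.P) : w ∉ x.TP := by
  intro hwT
  rw [mem_take_iff_rank hx.beta_nodup] at hyq
  obtain ⟨h1, h2⟩ := hx.mem_P_iff.1 hy
  exact hwT.2 (hx.mem_top_of_lt (q := q) (by by_contra; exact hyq ⟨h1, by omega⟩) hw)

theorem backwardEq_iff [Finite V] : x.BackwardEq f ↔
    (∀ b ∈ x.P, ∑ᶠ t ∈ x.TP, f b t = 0) ∧ x.QEq f := by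
  have hlq : ∀ {v q}, v ∈ x.left → v ∉ x.beta.take q := fun hv h =>
    (mem_beta_iff.1 (List.mem_of_mem_take h)).2 hv
  -- the equation for a star centered in `B^P`
  have kP : ∀ q < x.num, ∀ w ∈ x.P, w ∉ x.beta.take q →
      ∑ᶠ y ∈ {y | y ∈ x.all ∧ y ∉ x.beta.take q}, f w y = ∑ᶠ t ∈ x.TP, f w t := by
    intro q hq w hwP hwq
    have hwη := hx.mem_P_iff.1 hwP
    have hqη : q < x.η := by
      by_contra hcon
      exact hwq ((mem_take_iff_rank hx.beta_nodup).2 ⟨hwη.1, by omega⟩)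
    refine finsum_mem_eq_of_support fun y hy => ?_
    constructor
    · rintro ⟨hya, -⟩
      rcases hf.cases_of_ne_zero (hx.P_subset_all hwP) hya hy with
        ⟨h1, h2⟩ | ⟨h1, h2⟩ | ⟨h1, h2⟩ | ⟨h1, h2⟩ | ⟨h1, h2⟩
      · exact absurd h1 (hx.notMem_left_of_P hwP)
      · exact h2
      · exact absurd h2 (hx.notMem_TP_of_P hwP)
      · exact absurd h1 (hx.notMem_Q_of_P hwP)
      · exact absurd (Regular.TQ_subset_TP h2) (hx.notMem_TP_of_P hwP)
    · intro hyT
      refine ⟨hx.TP_subset_all hyT, ?_⟩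
      rcases hyT.1 with h | h
      · exact hlq h
      · intro hyq
        have h1 := ((mem_take_iff_rank hx.beta_nodup).1 hyq).2
        have h2 := (hx.mem_Q_iff.1 h).2
        have := hx.two_η_le
        omega
  -- the equation for a star centered in `B^Q`
  have kQ : ∀ q < x.num, ∀ w ∈ x.Q, w ∈ x.blk (cyc x.s (q + 1)) →
      ∑ᶠ y ∈ {y | y ∈ x.all ∧ y ∉ x.beta.take q}, f w y = ∑ᶠ t ∈ x.TQ, f w t := by
    intro q hq w hwQ hwb
    refine finsum_mem_eq_of_support fun y hy => ?_
    constructor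
    · rintro ⟨hya, hyq⟩
      rcases hf.cases_of_ne_zero (hx.Q_subset_all hwQ) hya hy with
        ⟨h1, h2⟩ | ⟨h1, h2⟩ | ⟨h1, h2⟩ | ⟨h1, h2⟩ | ⟨h1, h2⟩
      · exact absurd h1 (hx.notMem_left_of_Q hwQ)
      · exact absurd hwQ (hx.notMem_Q_of_P h1)
      · exact absurd h2 (not_P_TP hx hwb hyq h1)
      · exact h2
      · exact absurd h2.1 (hx.notMem_left_of_Q hwQ)
    · intro hyT
      exact ⟨hx.left_subset hyT.1, hlq hyT.1⟩
  -- the equation for a star centered in `T_B^Q`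
  have kT : ∀ q < x.num, ∀ w ∈ x.TQ, w ∈ x.blk (cyc x.s (q + 1)) →
      (∑ᶠ y ∈ {y | y ∈ x.all ∧ y ∉ x.beta.take q}, f w y = 0 ↔
        ∑ᶠ b ∈ x.Q, f w b = ∑ᶠ y ∈ x.left, f w y) := by
    intro q hq w hwT hwb
    have hqQ : q + 1 ≤ x.num - x.η := by
      by_contra hcon
      refine (Regular.mem_TQ_iff.1 hwT).2.2 ?_
      simp only [DQ, Set.mem_iUnion, Finset.mem_range]
      exact ⟨x.num - (q + 1), by omega, by rwa [show x.num - (x.num - (q + 1)) = q + 1 by omega]⟩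
    rw [← add_eq_zero_iff_zmod (a := ∑ᶠ b ∈ x.Q, f w b),
      ← finsum_mem_union _ (Set.toFinite _) (Set.toFinite _)]
    · refine Eq.congr (finsum_mem_eq_of_support fun y hy => ?_) rfl
      constructor
      · rintro ⟨hya, hyq⟩
        rcases hf.cases_of_ne_zero (hx.left_subset hwT.1) hya hy with
          ⟨h1, h2⟩ | ⟨h1, h2⟩ | ⟨h1, h2⟩ | ⟨h1, h2⟩ | ⟨h1, h2⟩
        · exact Or.inr h2
        · exact absurd hwT.1 (hx.notMem_left_of_P h1)
        · exact absurd h2 (not_P_TP hx hwb hyq h1)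
        · exact absurd hwT.1 (hx.notMem_left_of_Q h1)
        · exact Or.inl h1
      · rintro (h | h)
        · refine ⟨hx.Q_subset_all h, fun hyq => ?_⟩
          have h1 := ((mem_take_iff_rank hx.beta_nodup).1 hyq).2
          have h2 := (hx.mem_Q_iff.1 h).2
          omega
        · exact ⟨hx.left_subset h, hlq h⟩
    · exact Set.disjoint_left.2 fun y hy h => hx.notMem_left_of_Q hy h
  have hηs := hx.η_le
  have hsn := hx.s_le
  constructor
  · intro h
    refine ⟨fun b hb => ?_, fun b hb => ?_, fun w hw => ?_⟩
    · have hb' := (hx.mem_P_iff.1 hb).1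
      have hq : rank x.beta b < x.num := rank_lt hb'
      have hn : b ∉ x.beta.take (rank x.beta b) := fun h =>
        lt_irrefl _ ((mem_take_iff_rank hx.beta_nodup).1 h).2
      rw [← kP _ hq b hb hn]
      exact h _ hq b (hx.mem_blk_rank hb') hn
    · have hb' := (hx.mem_Q_iff.1 hb).1
      have hq : rank x.beta b < x.num := rank_lt hb'
      have hn : b ∉ x.beta.take (rank x.beta b) := fun h =>
        lt_irrefl _ ((mem_take_iff_rank hx.beta_nodup).1 h).2
      rw [← kQ _ hq b hb (hx.mem_blk_rank hb')]
      exact h _ hq b (hx.mem_blk_rank hb') hn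
    · obtain ⟨j, hj, hwj⟩ := hx.exists_blk (hx.left_subset hw.1)
      have hj0 : j ≠ 0 := by
        rintro rfl
        exact (Regular.mem_TQ_iff.1 hw).2.1 (Or.inr hwj)
      -- the block `j` of `w` is treated when `j - 1` vertices of `B` have been removed
      have hwb : w ∈ x.blk (cyc x.s (j - 1 + 1)) := by
        rwa [Nat.sub_add_cancel (by omega), cyc_eq_self (by omega) hj]
      have hq : j - 1 < x.num := by omega
      exact (kT _ hq w hw hwb).1 (h _ hq w hwb (hlq hw.1))
  · rintro ⟨hP, hQ1, hQ2⟩ q hq w hwb hwq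
    have hwa : w ∈ x.all := (hx.mem_blk_iff.1 hwb).1
    by_cases hwP : w ∈ x.P
    · rw [kP q hq w hwP hwq]; exact hP w hwP
    by_cases hwQ : w ∈ x.Q
    · rw [kQ q hq w hwQ hwb]; exact hQ1 w hwQ
    by_cases hwT : w ∈ x.TQ
    · exact (kT q hq w hwT hwb).2 (hQ2 w hwT)
    by_cases hwl : w ∈ x.left
    · -- `w` is in the revealed part of `V_B`
      have hwr : w ∈ x.revealed := by
        by_contra hcon
        exact hwT ⟨hwl, hcon⟩
      rw [← hf.star w hwr]
      refine finsum_mem_eq_of_support fun y hy => ?_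
      constructor
      · rintro ⟨hya, hyq⟩
        rcases hf.cases_of_ne_zero hwa hya hy with
          ⟨h1, h2⟩ | ⟨h1, h2⟩ | ⟨h1, h2⟩ | ⟨h1, h2⟩ | ⟨h1, h2⟩
        · exact h2
        · exact absurd h1 hwP
        · exact absurd h2 (not_P_TP hx hwb hyq h1)
        · exact absurd h1 hwQ
        · exact absurd h2 hwT
      · intro h
        exact ⟨hx.left_subset h, hlq h⟩
    · refine finsum_mem_eq_zero_of_forall_eq_zero fun y hy => ?_
      by_contra hne
      rcases hf.cases_of_ne_zero hwa hy.1 hne with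
        ⟨h1, h2⟩ | ⟨h1, h2⟩ | ⟨h1, h2⟩ | ⟨h1, h2⟩ | ⟨h1, h2⟩
      · exact hwl h1
      · exact hwP h1
      · rcases h2.1 with h | h
        · exact hwl h
        · exact hwQ h
      · exact hwQ h1
      · exact hwT h2

theorem forward_and_backward_iff [Finite V] :
    x.ForwardEq f ∧ x.BackwardEq f ↔ x.PEq f ∧ x.QEq f := by
  rw [hf.forwardEq_iff hx, hf.backwardEq_iff hx, PEq]
  tauto

omit hx in
/-- The prescribed parities of the rows and columns of `S(B^Q, T_B^Q)` are compatible: both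
count the edges of `V_B` with an end in `T_B^Q`, by the handshake lemma. -/
theorem compatible_Q [Finite V] : ∑ᶠ t ∈ x.TQ, ∑ᶠ y ∈ x.left, f t y = 0 := by
  classical
  have h1 : ∑ᶠ t ∈ x.TQ, ∑ᶠ y ∈ x.left, f t y = ∑ᶠ t ∈ x.left, ∑ᶠ y ∈ x.left, f t y := by
    refine finsum_mem_eq_of_support fun t ht => ⟨fun h => h.1, fun h => ⟨h, fun hr => ?_⟩⟩
    exact ht (hf.star t hr)
  rw [h1]
  have h2 : ∀ g : V → ZMod 2, ∑ᶠ t ∈ x.left, g t = ∑ t ∈ (Set.toFinite x.left).toFinset, g t :=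
    fun g => finsum_mem_eq_finite_toFinset_sum g _
  simp only [h2]
  rw [← Finset.sum_product']
  refine Finset.sum_involution (fun a _ => (a.2, a.1)) ?_ ?_ ?_ ?_
  · rintro ⟨u, v⟩ -
    rw [add_eq_zero_iff_zmod]
    exact hf.symm u v
  · rintro ⟨u, v⟩ - hne h
    simp only [Prod.mk.injEq] at h
    obtain ⟨rfl, -⟩ := h
    exact hne (hf.diag v)
  · rintro ⟨u, v⟩ h
    simp only [Finset.mem_product] at h ⊢
    exact h.symm
  · rintro ⟨u, v⟩ -
    rfl

/-- The prescribed parities of the rows and columns of `S(B^P, T_B^P)` are compatible: the forward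
stars of the vertices of `T_B^P` contain every edge of `V_B` and of `S(B^Q, T_B^Q)` that is not
known, and the parities of these edge sets are prescribed. -/
theorem compatible_P [Finite V] (hQ : ∀ b ∈ x.Q, ∑ᶠ t ∈ x.TQ, f b t = 0) :
    ∑ᶠ t ∈ x.TP, ∑ᶠ y ∈ x.all \ x.P, x.above f t y = 0 := by
  have h1 : ∑ᶠ t ∈ x.TP, ∑ᶠ y ∈ x.all \ x.P, x.above f t y =
      ∑ᶠ t ∈ x.all \ x.P, ∑ᶠ y ∈ x.all \ x.P, x.above f t y := by
    refine finsum_mem_eq_of_support fun t ht => ?_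
    constructor
    · exact fun h => ⟨hx.TP_subset_all h, fun hP => hx.notMem_TP_of_P hP h⟩
    · intro h
      by_contra hcon
      exact ht (finsum_mem_eq_zero_of_forall_eq_zero fun y hy =>
        hf.above_eq_zero hx h.1 hcon hy.1)
  set Y : Set V := {v | v ∈ x.beta ∧ v ∉ x.P} with hY
  have hdis : Disjoint x.left Y := Set.disjoint_left.2 fun v h1 h2 => (mem_beta_iff.1 h2.1).2 h1
  have h2 : x.all \ x.P = x.left ∪ Y := by
    ext v
    have := @hx.left_subset v
    have h3 := @mem_beta_iff _ x v
    have h4 : v ∈ x.P → v ∉ x.left := fun h => hx.notMem_left_of_P h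
    simp only [Set.mem_sdiff, Set.mem_union, hY, Set.mem_ofPred_eq]
    tauto
  have hu : ∀ g : V → ZMod 2, ∑ᶠ t ∈ x.left ∪ Y, g t = ∑ᶠ t ∈ x.left, g t + ∑ᶠ t ∈ Y, g t :=
    fun g => finsum_mem_union hdis (Set.toFinite _) (Set.toFinite _)
  rw [h1, h2]
  simp only [hu]
  rw [finsum_mem_add_distrib (Set.toFinite _), finsum_mem_add_distrib (Set.toFinite _), hf.pairs,
    zero_add]
  have h3 : ∑ᶠ t ∈ Y, ∑ᶠ y ∈ Y, x.above f t y = 0 := by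
    refine finsum_mem_eq_zero_of_forall_eq_zero fun t ht =>
      finsum_mem_eq_zero_of_forall_eq_zero fun y hy => ?_
    by_contra hne
    have htl := (mem_beta_iff.1 ht.1).2
    have hyl := (mem_beta_iff.1 hy.1).2
    rcases hf.cases_of_ne_zero (beta_subset_all ht.1) (beta_subset_all hy.1)
      (above_ne_zero hne).2 with ⟨h1, h2⟩ | ⟨h1, h2⟩ | ⟨h1, h2⟩ | ⟨h1, h2⟩ | ⟨h1, h2⟩
    · exact htl h1
    · exact ht.2 h1
    · exact hy.2 h1
    · exact hyl h2.1
    · exact htl h2.1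
  rw [h3, add_zero, finsum_mem_comm _ (Set.toFinite _) (Set.toFinite _),
    ← finsum_mem_add_distrib (Set.toFinite _)]
  refine finsum_mem_eq_zero_of_forall_eq_zero fun b hb => ?_
  rw [← finsum_mem_add_distrib (Set.toFinite _)]
  have hbl := (mem_beta_iff.1 hb.1).2
  have hba := beta_subset_all hb.1
  have h4 : ∑ᶠ t ∈ x.left, (x.above f t b + x.above f b t) = ∑ᶠ t ∈ x.left, f b t := by
    refine finsum_mem_congr rfl fun t ht => ?_
    have hne : rank x.order t ≠ rank x.order b := fun h =>
      hbl (rank_inj (hx.left_subset ht) hba h ▸ ht)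
    unfold above
    rcases lt_or_gt_of_ne hne with h | h
    · rw [if_pos h.le, if_neg (not_le.2 h), add_zero, hf.symm]
    · rw [if_neg (not_le.2 h), if_pos h.le, zero_add]
  have hcase : ∀ t ∈ x.left, f b t ≠ 0 → b ∈ x.Q ∧ t ∈ x.TQ := by
    intro t ht hne
    rcases hf.cases_of_ne_zero hba (hx.left_subset ht) hne with
      ⟨h1, h2⟩ | ⟨h1, h2⟩ | ⟨h1, h2⟩ | ⟨h1, h2⟩ | ⟨h1, h2⟩
    · exact absurd h1 hbl
    · exact absurd h1 hb.2
    · exact absurd ht (hx.notMem_left_of_P h1)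
    · exact ⟨h1, h2⟩
    · exact absurd h2.1 hbl
  rw [h4]
  by_cases hbQ : b ∈ x.Q
  · rw [← hQ b hbQ]
    exact finsum_mem_eq_of_support fun t ht => ⟨fun h => (hcase t h ht).2, fun h => h.1⟩
  · refine finsum_mem_eq_zero_of_forall_eq_zero fun t ht => ?_
    by_contra hne
    exact hbQ (hcase t ht hne).1

end BaseEq

end Side

/-! ### Parities as sums of entries of the adjacency matrix -/

theorem ncard_cast_eq_sum {X : Type*} [Fintype X] (S : Set X) [DecidablePred (· ∈ S)] :
    (S.ncard : ZMod 2) = ∑ z, if z ∈ S then 1 else 0 := by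
  rw [Set.ncard_eq_toFinset_card', ← Finset.sum_filter, Finset.sum_const, nsmul_eq_mul, mul_one]
  congr 2
  ext z
  simp

theorem finsum_mem_eq_sum_ite {V : Type*} [Fintype V] (X : Set V) [DecidablePred (· ∈ X)]
    (f : V → ZMod 2) : ∑ᶠ y ∈ X, f y = ∑ y, if y ∈ X then f y else 0 := by
  rw [finsum_eq_sum_of_fintype]
  refine Finset.sum_congr rfl fun y _ => ?_
  rw [finsum_eq_if]

theorem par_star {V : Type*} [Finite V] (G : SimpleGraph V) (v : V) (X : Set V) :
    par G (potentialEdges {v} X) = ∑ᶠ y ∈ X, adjBit G v y := by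
  classical
  cases nonempty_fintype V
  have h : G.edgeSet ∩ potentialEdges {v} X = (fun y => s(v, y)) '' {y | y ∈ X ∧ G.Adj v y} := by
    ext e
    constructor
    · rintro ⟨he, x, rfl, y, hy, -, rfl⟩
      exact ⟨y, ⟨hy, he⟩, rfl⟩
    · rintro ⟨y, ⟨hy, ha⟩, rfl⟩
      exact ⟨ha, v, rfl, y, hy, ha.ne, rfl⟩
  rw [par, h, Set.ncard_image_of_injective _ fun y z hyz => Sym2.congr_right.1 hyz,
    ncard_cast_eq_sum, finsum_mem_eq_sum_ite]
  refine Finset.sum_congr rfl fun y _ => ?_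
  by_cases h1 : y ∈ X <;> by_cases h2 : G.Adj v y <;> simp [h1, h2, adjBit]

/-- Every edge with both ends in `X` is counted at its end with the smaller rank. -/
theorem par_pairs {V : Type*} [Finite V] (G : SimpleGraph V) {X : Set V} {r : V → ℕ}
    (hr : Set.InjOn r X) : par G (potentialEdges X X) =
      ∑ᶠ u ∈ X, ∑ᶠ y ∈ X, if r u ≤ r y then adjBit G u y else 0 := by
  classical
  cases nonempty_fintype V
  have h : G.edgeSet ∩ potentialEdges X X =
      (fun z : V × V => s(z.1, z.2)) ''
        {z | (z.1 ∈ X ∧ z.2 ∈ X) ∧ r z.1 ≤ r z.2 ∧ G.Adj z.1 z.2} := by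
    ext e
    constructor
    · rintro ⟨he, u, hu, y, hy, -, rfl⟩
      rcases le_total (r u) (r y) with hle | hle
      · exact ⟨(u, y), ⟨⟨hu, hy⟩, hle, he⟩, rfl⟩
      · exact ⟨(y, u), ⟨⟨hy, hu⟩, hle, he.symm⟩, Sym2.eq_swap⟩
    · rintro ⟨z, ⟨⟨hu, hy⟩, hle, ha⟩, rfl⟩
      exact ⟨ha, z.1, hu, z.2, hy, ha.ne, rfl⟩
  rw [par, h, Set.InjOn.ncard_image, ncard_cast_eq_sum, Fintype.sum_prod_type]
  · simp only [finsum_mem_eq_sum_ite]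
    refine Finset.sum_congr rfl fun u _ => ?_
    by_cases hu : u ∈ X
    · rw [if_pos hu]
      refine Finset.sum_congr rfl fun y _ => ?_
      by_cases h1 : y ∈ X <;> by_cases h2 : G.Adj u y <;> by_cases h3 : r u ≤ r y <;>
        simp [hu, h1, h2, h3, adjBit]
    · simp [hu]
  · rintro ⟨u, y⟩ ⟨⟨hu, hy⟩, hle, ha⟩ ⟨u', y'⟩ ⟨⟨hu', hy'⟩, hle', ha'⟩ hz
    rcases Sym2.eq_iff.1 hz with ⟨h1, h2⟩ | ⟨h1, h2⟩
    · exact Prod.ext h1 h2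
    · simp only at h1 h2 hle hle' ha
      subst h1 h2
      exact absurd (hr hu hy (le_antisymm hle hle')) ha.ne

theorem par_union {V : Type*} [Finite V] (G : SimpleGraph V) {S T : Set (Sym2 V)}
    (h : Disjoint S T) : par G (S ∪ T) = par G S + par G T := by
  rw [par, par, par, Set.inter_union_distrib_left, Set.ncard_union_eq, Nat.cast_add]
  · exact h.mono Set.inter_subset_right Set.inter_subset_right

theorem par_congr {V : Type*} {G H : SimpleGraph V} {S : Set (Sym2 V)}
    (h : ∀ e ∈ S, (e ∈ G.edgeSet ↔ e ∈ H.edgeSet)) : par G S = par H S := by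
  have : G.edgeSet ∩ S = H.edgeSet ∩ S := by
    ext e
    exact and_congr_left fun he => h e he
  rw [par, par, this]

/-- The difference of the adjacency matrices of two graphs. -/
noncomputable def diff {V : Type*} (G H : SimpleGraph V) (u v : V) : ZMod 2 :=
  adjBit G u v + adjBit H u v

theorem diff_eq_zero {V : Type*} {G H : SimpleGraph V} {u v : V} :
    diff G H u v = 0 ↔ (G.Adj u v ↔ H.Adj u v) := by
  rw [diff, add_eq_zero_iff_zmod, adjBit_eq_iff]

theorem diff_comm {V : Type*} (G H : SimpleGraph V) (u v : V) : diff G H u v = diff G H v u := by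
  rw [diff, diff, adjBit_comm, adjBit_comm H]

theorem diff_self {V : Type*} (G H : SimpleGraph V) (u : V) : diff G H u u = 0 := by
  rw [diff, adjBit_self, adjBit_self, add_zero]

theorem par_star_eq_iff {V : Type*} [Finite V] {G H : SimpleGraph V} {v : V} {X : Set V} :
    par G (potentialEdges {v} X) = par H (potentialEdges {v} X) ↔
      ∑ᶠ y ∈ X, diff G H v y = 0 := by
  rw [par_star, par_star, ← add_eq_zero_iff_zmod, ← finsum_mem_add_distrib (Set.toFinite _)]
  rfl

theorem par_pairs_eq_iff {V : Type*} [Finite V] {G H : SimpleGraph V} {X : Set V} {r : V → ℕ}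
    (hr : Set.InjOn r X) : par G (potentialEdges X X) = par H (potentialEdges X X) ↔
      ∑ᶠ u ∈ X, ∑ᶠ y ∈ X, (if r u ≤ r y then diff G H u y else 0) = 0 := by
  rw [par_pairs G hr, par_pairs H hr, ← add_eq_zero_iff_zmod,
    ← finsum_mem_add_distrib (Set.toFinite _)]
  refine Eq.congr (finsum_mem_congr rfl fun u _ => ?_) rfl
  rw [← finsum_mem_add_distrib (Set.toFinite _)]
  refine finsum_mem_congr rfl fun y _ => ?_
  split_ifs
  · rfl
  · rfl

theorem graphInfo_eq_iff {V : Type*} {G H : SimpleGraph V} {S : Set (Sym2 V)} :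
    graphInfo G S = graphInfo H S ↔ ∀ e ∈ S, (e ∈ G.edgeSet ↔ e ∈ H.edgeSet) := by
  simp only [graphInfo, Prod.mk.injEq, true_and, Set.ext_iff, Set.mem_inter_iff]
  exact forall_congr' fun e => by tauto

theorem parInfo_eq_iff {V : Type*} {G H : SimpleGraph V} {S : Set (Sym2 V)} :
    parInfo G S = parInfo H S ↔ par G S = par H S := by
  simp [parInfo]

theorem parInfo_family_eq_iff {V : Type*} {G H : SimpleGraph V} {X : Set V}
    {S : V → Set (Sym2 V)} :
    {i | ∃ v ∈ X, i = parInfo G (S v)} = {i | ∃ v ∈ X, i = parInfo H (S v)} ↔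
      ∀ v ∈ X, par G (S v) = par H (S v) := by
  constructor
  · intro h v hv
    have : parInfo G (S v) ∈ {i | ∃ v ∈ X, i = parInfo H (S v)} := h ▸ ⟨v, hv, rfl⟩
    obtain ⟨w, -, hw⟩ := this
    simp only [parInfo, Prod.mk.injEq] at hw
    rw [hw.2, hw.1]
  · intro h
    ext i
    refine exists_congr fun v => and_congr_right fun hv => ?_
    rw [parInfo_eq_iff.2 (h v hv)]

theorem agree_pairs_iff {V : Type*} {G H : SimpleGraph V} {X Y : Set V} :
    (∀ e ∈ potentialEdges X Y, (e ∈ G.edgeSet ↔ e ∈ H.edgeSet)) ↔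
      ∀ u ∈ X, ∀ v ∈ Y, diff G H u v = 0 := by
  constructor
  · intro h u hu v hv
    by_cases huv : u = v
    · rw [huv, diff_self]
    · exact diff_eq_zero.2 (h s(u, v) (mem_potentialEdges.2 ⟨huv, Or.inl ⟨hu, hv⟩⟩))
  · rintro h e ⟨u, hu, v, hv, -, rfl⟩
    exact diff_eq_zero.1 (h u hu v hv)

theorem agree_iff_diff {V : Type*} {G H : SimpleGraph V} {S : Set (Sym2 V)} :
    (∀ e ∈ S, (e ∈ G.edgeSet ↔ e ∈ H.edgeSet)) ↔ ∀ u v, s(u, v) ∈ S → diff G H u v = 0 := by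
  constructor
  · exact fun h u v huv => diff_eq_zero.2 (h _ huv)
  · intro h e he
    induction e using Sym2.ind with
    | _ u v => exact diff_eq_zero.1 (h u v he)

/-! ### The event that the revealed information is the given one -/

theorem Side.info_eq_iff {V : Type*} [Finite V] {x : Side V} (hx : x.left ⊆ x.all)
    {G H : SimpleGraph V} : x.info G = x.info H ↔ x.BaseEq (diff G H) := by
  have hr : Set.InjOn (rank x.order) x.left := fun u hu v hv h => rank_inj (hx hu) (hx hv) h
  simp only [Side.info, SideInfo.mk.injEq, graphInfo_eq_iff, parInfo_family_eq_iff,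
    parInfo_eq_iff, par_star_eq_iff, par_pairs_eq_iff hr, agree_pairs_iff]
  constructor
  · rintro ⟨h1, h2, h3, h4⟩
    exact ⟨diff_comm G H, diff_self G H, agree_iff_diff.1 h4, h1, h2, h3⟩
  · intro h
    exact ⟨h.revealed, h.star, h.pairs, agree_iff_diff.2 h.sigma⟩

/-- In the `(U, W)`-removal, the revealed information outside `G[U]` and `G[W]` consists of
equations for the forward stars in `U` and for the stars in `W` which avoid the vertices removed
so far. -/
theorem RemovalInv.agrees_iff {V : Type*} [Finite V] {G G₀ : SimpleGraph V} {a u w : List V}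
    {blocks : ℕ → Set V} {s : ℕ} {st : RemovalState V}
    (h : RemovalInv G₀ a u w blocks s (a ++ u).length st) (hst : st.Agrees G₀)
    (hnd : (a ++ u ++ w).Nodup) (hblocks : ∀ j, blocks j ⊆ {v | v ∈ w})
    (hcross : ∀ v y, ¬ (v ∈ u ∧ y ∈ u) → ¬ (v ∈ w ∧ y ∈ w) → diff G G₀ v y = 0) :
    st.Agrees G ↔
      (∀ v ∈ u, ∑ᶠ y ∈ {y | y ∈ u}, (if rank u v ≤ rank u y then diff G G₀ v y else 0) = 0) ∧
      ∀ m < (removedFrom w st.removed).length, ∀ v ∈ blocks (cyc s (m + 1)),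
        v ∉ (removedFrom w st.removed).take m →
        ∑ᶠ y ∈ {y | y ∈ w ∧ y ∉ (removedFrom w st.removed).take m}, diff G G₀ v y = 0 := by
  have hnd1 := List.nodup_append'.1 hnd
  have hnd2 := List.nodup_append'.1 hnd1.1
  have hrank : ∀ v ∈ u, rank (a ++ u) v = a.length + rank u v := fun v hv =>
    rank_append hnd1.1 hv
  have huw : ∀ v ∈ u, v ∉ w := fun v hv hw => hnd1.2.2 (List.mem_append_right a hv) hw
  have hau : ∀ v ∈ a, v ∉ u := fun v hv hu => hnd2.2.2 hv hu
  have haw : ∀ v ∈ a, v ∉ w := fun v hv hw => hnd1.2.2 (List.mem_append_left u hv) hw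
  -- the parity of a star centered in `U`
  have kU : ∀ v ∈ u, ∀ X : Set V,
      (∀ y ∈ a ++ u, (y ∈ X ↔ rank (a ++ u) v ≤ rank (a ++ u) y)) →
      (par G (potentialEdges {v} X) = par G₀ (potentialEdges {v} X) ↔
        ∑ᶠ y ∈ {y | y ∈ u}, (if rank u v ≤ rank u y then diff G G₀ v y else 0) = 0) := by
    intro v hv X hX
    rw [par_star_eq_iff]
    refine Eq.congr ?_ rfl
    rw [← finsum_mem_inter_support_eq' (fun y => diff G G₀ v y) {y | y ∈ X ∧ y ∈ u} X]
    · refine finsum_congr fun y => ?_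
      by_cases hy : y ∈ u
      · have := hX y (List.mem_append_right a hy)
        rw [hrank v hv, hrank y hy, add_le_add_iff_left] at this
        by_cases hle : rank u v ≤ rank u y <;> simp [hy, this, hle]
      · simp [hy]
    · intro y hy
      refine ⟨fun h => h.1, fun h => ⟨h, ?_⟩⟩
      by_contra hyu
      exact hy (hcross v y (fun h => hyu h.2) fun h => huw v hv h.1)
  -- the parity of a star centered in `W`
  have kW : ∀ m, ∀ v ∈ w, ∀ X : Set V,
      (∀ y ∈ w, (y ∈ X ↔ y ∉ (removedFrom w st.removed).take m)) →
      (par G (potentialEdges {v} X) = par G₀ (potentialEdges {v} X) ↔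
        ∑ᶠ y ∈ {y | y ∈ w ∧ y ∉ (removedFrom w st.removed).take m}, diff G G₀ v y = 0) := by
    intro m v hv X hX
    rw [par_star_eq_iff]
    refine Eq.congr (finsum_mem_eq_of_support fun y hy => ?_) rfl
    have hyw : y ∈ w := by
      by_contra hyw
      exact hy (hcross v y (fun h => huw v h.1 hv) fun h => hyw h.2)
    exact ⟨fun h => ⟨hyw, (hX y hyw).1 h⟩, fun h => (hX y hyw).2 h.2⟩
  constructor
  · intro hG
    refine ⟨fun v hv => ?_, fun m hm v hv hvm => ?_⟩
    · obtain ⟨X, hX, hmem⟩ := h.exists_parU v hv (rank_lt (List.mem_append_right a hv))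
      exact (kU v hv X hX).1 (hG.2.1 _ hmem)
    · obtain ⟨X, hX, hmem⟩ := h.exists_parW m hm v hv hvm
      exact (kW m v (hblocks _ hv) X hX).1 (hG.2.2.1 _ hmem)
  · rintro ⟨hU, hW⟩
    refine ⟨fun i hi => ?_, fun i hi => ?_, fun i hi => ?_, fun i hi => ?_⟩
    · have h0 := hst.1 i hi
      obtain ⟨v, hv, X, rfl⟩ := h.parA i hi
      refine (par_star_eq_iff.2 ?_).trans h0
      exact finsum_mem_eq_zero_of_forall_eq_zero fun y _ =>
        hcross v y (fun h => hau v hv h.1) fun h => haw v hv h.1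
    · have h0 := hst.2.1 i hi
      obtain ⟨v, hv, X, hX, rfl⟩ := h.parU i hi
      exact ((kU v hv X hX).2 (hU v hv)).trans h0
    · have h0 := hst.2.2.1 i hi
      obtain ⟨m, hm, v, hv, hvm, X, hX, rfl⟩ := h.parW i hi
      exact ((kW m v (hblocks _ hv) X hX).2 (hW m hm v hv hvm)).trans h0
    · have h0 := hst.2.2.2 i hi
      obtain ⟨v, hv, X, hX, rfl⟩ := h.graphs i hi
      refine Eq.trans ?_ h0
      have := (graphInfo_eq_iff (G := G) (H := G₀) (S := potentialEdges {v} X)).2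
        (agree_pairs_iff.2 ?_)
      · exact congrArg Prod.snd this
      · rintro v' rfl y hy
        have hyw : y ∈ w := hX hy
        exact hcross v' y (fun h => huw y h.2 hyw)
          fun h => hnd1.2.2 hv h.1

theorem block_subset {V : Type*} (l : List V) (s : ℕ) (r : ℕ → ℕ) (j : ℕ) :
    block l s r j ⊆ {v | v ∈ l} := by
  rintro v ⟨k, -, -, h⟩
  exact List.mem_of_getElem? h

/-- The final states of the two removals on `G₀`, when both succeed. -/
structure Setup.Run {V : Type*} (S : Setup V) (G₀ : SimpleGraph V) (stBC stCB : RemovalState V) :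
    Prop where
  bc : S.removalBC G₀ = some stBC
  cb : S.removalCB G₀ = some stCB

theorem Setup.exists_run {V : Type*} {S : Setup V} {G₀ : SimpleGraph V} {x y : Side V}
    (h : S.outcome G₀ = some (x, y)) :
    ∃ stBC stCB, S.Run G₀ stBC stCB ∧ x = S.sideB stCB ∧ y = S.sideC stBC := by
  obtain ⟨stBC, h1, h2⟩ := Option.bind_eq_some_iff.1 h
  obtain ⟨stCB, h3, h4⟩ := Option.map_eq_some_iff.1 h2
  rw [Prod.mk.injEq] at h4
  exact ⟨stBC, stCB, ⟨h1, h3⟩, h4.1.symm, h4.2.symm⟩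

namespace Setup.Run

variable {V : Type*} {S : Setup V} {G₀ : SimpleGraph V} {stBC stCB : RemovalState V}

theorem _root_.EvenDegenerate.Setup.nodup_acb (S : Setup V) : (S.a ++ S.c ++ S.b).Nodup := by
  have h := S.nodup
  have hp : (S.a ++ S.b ++ S.c).Perm (S.a ++ S.c ++ S.b) := by
    rw [List.append_assoc, List.append_assoc]
    exact List.Perm.append_left _ List.perm_append_comm
  exact hp.nodup_iff.1 h

theorem _root_.EvenDegenerate.Setup.disjoint_bc (S : Setup V) {v : V} (hb : v ∈ S.b)
    (hc : v ∈ S.c) : False :=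
  (List.nodup_append'.1 S.nodup).2.2 (List.mem_append_right _ hb) hc

theorem outcome_eq (h : S.Run G₀ stBC stCB) : S.outcome G₀ = some (S.sideB stCB, S.sideC stBC) := by
  rw [Setup.outcome, h.bc, h.cb]
  rfl

theorem invBC (h : S.Run G₀ stBC stCB) :
    RemovalInv G₀ S.a S.b S.c (block S.c S.s S.cutC) S.s (S.a ++ S.b).length stBC :=
  removal_inv S.nodup (block_subset _ _ _) S.pickBC_mem h.bc

theorem invCB (h : S.Run G₀ stBC stCB) :
    RemovalInv G₀ S.a S.c S.b (block S.b S.s S.cutB) S.s (S.a ++ S.c).length stCB :=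
  removal_inv S.nodup_acb (block_subset _ _ _) S.pickCB_mem h.cb

theorem left_sideB (h : S.Run G₀ stBC stCB) : (S.sideB stCB).left ⊆ (S.sideB stCB).all := by
  intro v hv
  have hcov := S.cover v
  by_contra hb
  have hv' : v ∈ S.a ++ S.c := by
    simp only [List.mem_append] at hcov ⊢
    have : v ∉ S.b := hb
    tauto
  exact hv ((h.invCB.mem_removed v hv').2 (rank_lt hv'))

theorem left_sideC (h : S.Run G₀ stBC stCB) : (S.sideC stBC).left ⊆ (S.sideC stBC).all := by
  intro v hv
  have hcov := S.cover v
  by_contra hb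
  have hv' : v ∈ S.a ++ S.b := by
    simp only [List.mem_append] at hcov ⊢
    have : v ∉ S.c := hb
    tauto
  exact hv ((h.invBC.mem_removed v hv').2 (rank_lt hv'))

variable {G : SimpleGraph V}

theorem Gam_eq (h : S.Run G₀ stBC stCB) : S.Gam G₀ = some
    { graphA := graphInfo G₀ (potentialEdges S.A S.A)
      parStarsA := {i | ∃ v ∈ S.A, i = parInfo G₀ (potentialEdges {v} Set.univ)}
      parV := parInfo G₀ (potentialEdges Set.univ Set.univ)
      parABC := stBC.parA
      parACB := stCB.parA
      parBP := stBC.parU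
      parBQ := stCB.parW
      parCP := stCB.parU
      parCQ := stBC.parW
      graphsBC := stBC.graphs
      graphsCB := stCB.graphs
      infoB := (S.sideB stCB).info G₀
      infoC := (S.sideC stBC).info G₀
      graphCross := graphInfo G₀ (potentialEdges Set.univ Set.univ \
        (potentialEdges (S.sideB stCB).all (S.sideB stCB).all ∪
          potentialEdges (S.sideC stBC).all (S.sideC stBC).all)) } := by
  rw [Setup.Gam, h.bc, h.cb]
  rfl

/-- If `Γ` takes the same value at `G` and `G₀`, then the removals are the same. -/
theorem of_Gam_eq (h : S.Run G₀ stBC stCB) (hG : S.Gam G = S.Gam G₀) : S.Run G stBC stCB := by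
  rw [h.Gam_eq] at hG
  obtain ⟨stBC', h1, h2⟩ := Option.bind_eq_some_iff.1 hG
  obtain ⟨stCB', h3, h4⟩ := Option.map_eq_some_iff.1 h2
  simp only [Info.mk.injEq] at h4
  obtain ⟨-, -, -, e1, e2, e3, e4, e5, e6, e7, e8, -⟩ := h4
  have a1 : stBC'.Agrees G := agrees_of_removal h1
  have a2 : stCB'.Agrees G := agrees_of_removal h3
  unfold RemovalState.Agrees at a1 a2
  rw [e1, e3, e6, e7] at a1
  rw [e2, e5, e4, e8] at a2
  exact ⟨removal_replay h.bc a1, removal_replay h.cb a2⟩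

theorem of_agrees (h : S.Run G₀ stBC stCB) (h1 : stBC.Agrees G) (h2 : stCB.Agrees G) :
    S.Run G stBC stCB :=
  ⟨removal_replay h.bc h1, removal_replay h.cb h2⟩

theorem agree_cross_iff : (∀ e ∈ potentialEdges Set.univ Set.univ \
        (potentialEdges (S.sideB stCB).all (S.sideB stCB).all ∪
          potentialEdges (S.sideC stBC).all (S.sideC stBC).all),
        (e ∈ G.edgeSet ↔ e ∈ G₀.edgeSet)) ↔
    ∀ u v, ¬ (u ∈ S.b ∧ v ∈ S.b) → ¬ (u ∈ S.c ∧ v ∈ S.c) → diff G G₀ u v = 0 := by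
  rw [agree_iff_diff]
  refine forall₂_congr fun u v => ?_
  constructor
  · intro hh h1 h2
    by_cases huv : u = v
    · rw [huv, diff_self]
    refine hh ⟨mem_potentialEdges.2 ⟨huv, Or.inl ⟨trivial, trivial⟩⟩, ?_⟩
    rintro (h' | h') <;> rw [mem_potentialEdges] at h'
    · exact h1 (by rcases h'.2 with h | h; exacts [h, h.symm])
    · exact h2 (by rcases h'.2 with h | h; exacts [h, h.symm])
  · rintro hh ⟨hne, hn⟩
    have huv := (mem_potentialEdges.1 hne).1
    refine hh (fun h' => hn (Or.inl ?_)) fun h' => hn (Or.inr ?_)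
    · exact mem_potentialEdges.2 ⟨huv, Or.inl h'⟩
    · exact mem_potentialEdges.2 ⟨huv, Or.inl h'⟩

/-- The event that `Γ` takes its value at `G₀` is given by linear equations for the difference of
the adjacency matrices. The parity of all edges of `G` is determined by the parities of the
forward stars. -/
theorem Gam_eq_iff [Finite V] (h : S.Run G₀ stBC stCB) : S.Gam G = S.Gam G₀ ↔
    (∀ u v, ¬ (u ∈ S.b ∧ v ∈ S.b) → ¬ (u ∈ S.c ∧ v ∈ S.c) → diff G G₀ u v = 0) ∧
    ((S.sideB stCB).BaseEq (diff G G₀) ∧ (S.sideC stBC).BaseEq (diff G G₀)) ∧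
    ((S.sideB stCB).ForwardEq (diff G G₀) ∧ (S.sideB stCB).BackwardEq (diff G G₀)) ∧
    ((S.sideC stBC).ForwardEq (diff G G₀) ∧ (S.sideC stBC).BackwardEq (diff G G₀)) := by
  have aBC : stBC.Agrees G₀ := agrees_of_removal h.bc
  have aCB : stCB.Agrees G₀ := agrees_of_removal h.cb
  have kBC := fun hcross => h.invBC.agrees_iff (G := G) aBC S.nodup (block_subset _ _ _) hcross
  have kCB := fun hcross => h.invCB.agrees_iff (G := G) aCB S.nodup_acb (block_subset _ _ _) hcross
  constructor
  · intro hG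
    have hrun := h.of_Gam_eq hG
    rw [h.Gam_eq, hrun.Gam_eq] at hG
    simp only [Option.some_inj, Info.mk.injEq] at hG
    obtain ⟨-, -, -, -, -, -, -, -, -, -, -, hB, hC, hcr⟩ := hG
    have hcross := agree_cross_iff.1 (graphInfo_eq_iff.1 hcr)
    have b1 := (kBC hcross).1 (agrees_of_removal hrun.bc)
    have b2 := (kCB fun v y h1 h2 => hcross v y h2 h1).1 (agrees_of_removal hrun.cb)
    exact ⟨hcross, ⟨(Side.info_eq_iff h.left_sideB).1 hB, (Side.info_eq_iff h.left_sideC).1 hC⟩,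
      ⟨b1.1, b2.2⟩, ⟨b2.1, b1.2⟩⟩
  · rintro ⟨hcross, ⟨hB, hC⟩, ⟨fB, bB⟩, ⟨fC, bC⟩⟩
    have hrun : S.Run G stBC stCB := h.of_agrees ((kBC hcross).2 ⟨fB, bC⟩)
      ((kCB fun v y h1 h2 => hcross v y h2 h1).2 ⟨fC, bB⟩)
    have hA : ∀ v ∈ S.A, ∀ y, diff G G₀ v y = 0 := by
      intro v hv y
      have h1 := List.nodup_append'.1 S.nodup
      have h2 := List.nodup_append'.1 h1.1
      exact hcross v y (fun h' => h2.2.2 hv h'.1)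
        fun h' => h1.2.2 (List.mem_append_left _ hv) h'.1
    rw [h.Gam_eq, hrun.Gam_eq, Option.some_inj, Info.mk.injEq]
    refine ⟨?_, ?_, ?_, rfl, rfl, rfl, rfl, rfl, rfl, rfl, rfl, ?_, ?_, ?_⟩
    · exact graphInfo_eq_iff.2 (agree_pairs_iff.2 fun u hu v _ => hA u hu v)
    · refine parInfo_family_eq_iff.2 fun v hv => par_star_eq_iff.2 ?_
      exact finsum_mem_eq_zero_of_forall_eq_zero fun y _ => hA v hv y
    · rw [parInfo_eq_iff]
      set EB := potentialEdges (S.sideB stCB).all (S.sideB stCB).all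
      set EC := potentialEdges (S.sideC stBC).all (S.sideC stBC).all
      have hsub : EB ∪ EC ⊆ potentialEdges Set.univ Set.univ := by
        rintro e (⟨u, -, v, -, hne, rfl⟩ | ⟨u, -, v, -, hne, rfl⟩) <;>
          exact ⟨u, trivial, v, trivial, hne, rfl⟩
      have hd : Disjoint EB EC := by
        refine Set.disjoint_left.2 ?_
        rintro e ⟨u, hu, v, hv, hne, rfl⟩ he
        rcases (mem_potentialEdges.1 he).2 with h' | h'
        · exact S.disjoint_bc hu h'.1
        · exact S.disjoint_bc hu h'.2
      rw [← Set.sdiff_union_of_subset hsub, par_union _ Set.disjoint_sdiff_left,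
        par_union _ Set.disjoint_sdiff_left, par_union _ hd, par_union _ hd]
      congr 1
      · exact par_congr (agree_cross_iff.2 hcross)
      congr 1
      · refine (par_pairs_eq_iff (r := rank S.b) fun u hu v hv h => rank_inj hu hv h).2 ?_
        exact finsum_mem_eq_zero_of_forall_eq_zero fun u hu => fB u hu
      · refine (par_pairs_eq_iff (r := rank S.c) fun u hu v hv h => rank_inj hu hv h).2 ?_
        exact finsum_mem_eq_zero_of_forall_eq_zero fun u hu => fC u hu
    · exact (Side.info_eq_iff h.left_sideB).2 hB
    · exact (Side.info_eq_iff h.left_sideC).2 hC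
    · exact graphInfo_eq_iff.2 (agree_cross_iff.2 hcross)

end Setup.Run

/-! ### Counting the free edges of one side -/

namespace Side

variable {V : Type*}

/-- The pairs in `S(B^P, T_B^P)` and `S(B^Q, T_B^Q)`. -/
noncomputable def free (x : Side V) : Set (Sym2 V) :=
  potentialEdges x.P x.TP ∪ potentialEdges x.Q x.TQ

/-- The number of equations for the rows and columns of `S(B^P, T_B^P)` and `S(B^Q, T_B^Q)`
determines the approximate probability of these equations. -/
noncomputable def scale (x : Side V) : ℝ :=
  2 * (1 / 2) ^ (x.P.ncard + x.TP.ncard) * (2 * (1 / 2) ^ (x.Q.ncard + x.TQ.ncard))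

theorem scale_pos (x : Side V) : 0 < x.scale := by unfold scale; positivity

theorem PEq.congr {x : Side V} (hx : x.Regular) {f g : V → V → ZMod 2}
    (h : ∀ u ∈ x.all, ∀ v ∈ x.all, f u v = g u v) (hf : x.PEq f) : x.PEq g := by
  refine ⟨fun b hb => ?_, fun t ht => ?_⟩
  · rw [← hf.1 b hb]
    exact finsum_mem_congr rfl fun t ht => (h b (hx.P_subset_all hb) t (hx.TP_subset_all ht)).symm
  · have e1 : ∑ᶠ b ∈ x.P, g t b = ∑ᶠ b ∈ x.P, f t b :=
      finsum_mem_congr rfl fun b hb => (h t (hx.TP_subset_all ht) b (hx.P_subset_all hb)).symm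
    rw [e1, hf.2 t ht]
    refine finsum_mem_congr rfl fun y hy => ?_
    rw [above, above, h t (hx.TP_subset_all ht) y hy.1]

theorem QEq.congr {x : Side V} {f g : V → V → ZMod 2}
    (h : ∀ u ∈ x.TQ, ∀ v, (v ∈ x.left ∨ v ∈ x.Q) → f u v = g u v ∧ f v u = g v u)
    (hf : x.QEq f) : x.QEq g := by
  refine ⟨fun b hb => ?_, fun t ht => ?_⟩
  · rw [← hf.1 b hb]
    exact finsum_mem_congr rfl fun t ht => ((h t ht b (Or.inr hb)).2).symm
  · have e1 : ∑ᶠ b ∈ x.Q, g t b = ∑ᶠ b ∈ x.Q, f t b :=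
      finsum_mem_congr rfl fun b hb => ((h t ht b (Or.inr hb)).1).symm
    rw [e1, hf.2 t ht]
    exact finsum_mem_congr rfl fun y hy => (h t ht y (Or.inl hy)).1

end Side

theorem AgreeOff.edge_iff {V : Type*} {P T : Set V} {G G' : SimpleGraph V}
    (h : AgreeOff P T G G') (hd : Disjoint P T) {e : Sym2 V} (he : e ∉ potentialEdges P T) :
    e ∈ G.edgeSet ↔ e ∈ G'.edgeSet := by
  induction e using Sym2.ind with
  | _ u v =>
    refine h u v (fun h' => he ?_) fun h' => he ?_
    · exact mem_potentialEdges.2 ⟨fun e => Set.disjoint_left.1 hd h'.1 (e ▸ h'.2), Or.inl h'⟩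
    · exact mem_potentialEdges.2 ⟨fun e => Set.disjoint_left.1 hd h'.1 (e ▸ h'.2), Or.inr h'⟩

theorem AgreeOff.diff_eq {V : Type*} {P T : Set V} {G G' : SimpleGraph V}
    (h : AgreeOff P T G G') (H : SimpleGraph V) {u v : V} (h1 : ¬ (u ∈ P ∧ v ∈ T))
    (h2 : ¬ (v ∈ P ∧ u ∈ T)) : diff G H u v = diff G' H u v := by
  rw [diff, diff, adjBit_eq_iff.2 (h u v h1 h2)]

/-- The prescribed values of the sums of the rows and columns of a rectangle, when these sums
should exceed those for `H` by `0` and `r`. -/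
theorem mem_paritiesEvent_diff_iff {V : Type*} [Finite V] {P T : Set V} {G H : SimpleGraph V}
    {r : SimpleGraph V → V → ZMod 2} :
    G ∈ paritiesEvent P T (fun _ b => ∑ᶠ t ∈ T, adjBit H b t)
      (fun G t => ∑ᶠ b ∈ P, adjBit H t b + r G t) ↔
    (∀ b ∈ P, ∑ᶠ t ∈ T, diff G H b t = 0) ∧ ∀ t ∈ T, ∑ᶠ b ∈ P, diff G H t b = r G t := by
  have h3 : ∀ a b c : ZMod 2, a = b + c ↔ a + b = c := by decide
  have hs : ∀ (X : Set V) (v : V), ∑ᶠ t ∈ X, diff G H v t =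
      ∑ᶠ t ∈ X, adjBit G v t + ∑ᶠ t ∈ X, adjBit H v t := fun X v =>
    finsum_mem_add_distrib (Set.toFinite _)
  simp only [paritiesEvent, Set.mem_ofPred_eq, hs, h3, add_eq_zero_iff_zmod]

/-- The probability of the equations for the rows and columns of `S(B^P, T_B^P)` and
`S(B^Q, T_B^Q)` is almost the same under any condition that does not involve these edges and
implies the remaining equations of the side. -/
theorem Side.Regular.real_bounds {V : Type*} [Finite V] (p : unitInterval) {l ε : ℝ}
    (hl : |1 - 2 * (p : ℝ)| ≤ l) (hl1 : l ≤ 1) {x : Side V} (hx : x.Regular)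
    (hP : x.P.Nonempty) (hQ : x.Q.Nonempty)
    (hεP : parityError l x.P.ncard x.TP.ncard ≤ ε) (hεQ : parityError l x.Q.ncard x.TQ.ncard ≤ ε)
    (hε0 : 0 ≤ ε) (hε1 : ε ≤ 1) (H : SimpleGraph V) (A : Set (SimpleGraph V))
    (hA : ∀ G G', (∀ e ∉ x.free, (e ∈ G.edgeSet ↔ e ∈ G'.edgeSet)) → G ∈ A → G' ∈ A)
    (hbase : ∀ G ∈ A, x.BaseEq (diff G H)) :
    x.scale * (1 - ε) ^ 2 * (SimpleGraph.binomialRandom V p).real A ≤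
      (SimpleGraph.binomialRandom V p).real
        (A ∩ {G | x.PEq (diff G H) ∧ x.QEq (diff G H)}) ∧
    (SimpleGraph.binomialRandom V p).real (A ∩ {G | x.PEq (diff G H) ∧ x.QEq (diff G H)}) ≤
      x.scale * (1 + ε) ^ 2 * (SimpleGraph.binomialRandom V p).real A := by
  have swap : ∀ X Y : Set V, ∑ᶠ b ∈ X, ∑ᶠ t ∈ Y, adjBit H b t =
      ∑ᶠ t ∈ Y, ∑ᶠ b ∈ X, adjBit H t b := by
    intro X Y
    rw [finsum_mem_comm _ (Set.toFinite _) (Set.toFinite _)]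
    exact finsum_mem_congr rfl fun t _ => finsum_mem_congr rfl fun b _ => adjBit_comm H b t
  -- the rectangle `S(B^Q, T_B^Q)`
  have bQ := paritiesEvent_bounds p hl hl1 hx.disjoint_Q_TQ hQ A
    (fun _ b => ∑ᶠ t ∈ x.TQ, adjBit H b t)
    (fun G t => ∑ᶠ b ∈ x.Q, adjBit H t b + ∑ᶠ y ∈ x.left, diff G H t y)
    (fun G G' h => hA G G' fun e he => h.edge_iff hx.disjoint_Q_TQ fun h' => he (Or.inr h'))
    (fun _ _ _ _ _ => rfl)
    (fun G G' h t ht => by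
      congr 1
      refine finsum_mem_congr rfl fun y hy => h.diff_eq H ?_ ?_
      · exact fun h' => hx.notMem_left_of_Q h'.1 ht.1
      · exact fun h' => hx.notMem_left_of_Q h'.1 hy)
    (fun G hG => by
      rw [finsum_mem_add_distrib (Set.toFinite _), (hbase G hG).compatible_Q, add_zero]
      exact swap _ _)
  have eQ : paritiesEvent x.Q x.TQ (fun _ b => ∑ᶠ t ∈ x.TQ, adjBit H b t)
      (fun G t => ∑ᶠ b ∈ x.Q, adjBit H t b + ∑ᶠ y ∈ x.left, diff G H t y) =
      {G | x.QEq (diff G H)} := by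
    ext G
    exact mem_paritiesEvent_diff_iff
  rw [eQ] at bQ
  -- the rectangle `S(B^P, T_B^P)`
  have bP := paritiesEvent_bounds p hl hl1 hx.disjoint_P_TP hP (A ∩ {G | x.QEq (diff G H)})
    (fun _ b => ∑ᶠ t ∈ x.TP, adjBit H b t)
    (fun G t => ∑ᶠ b ∈ x.P, adjBit H t b + ∑ᶠ y ∈ x.all \ x.P, x.above (diff G H) t y)
    (fun G G' h hG => by
      refine ⟨hA G G' (fun e he => h.edge_iff hx.disjoint_P_TP fun h' => he (Or.inl h')) hG.1,
        Side.QEq.congr (fun u hu v hv => ?_) hG.2⟩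
      have hv' : v ∉ x.P := by
        rcases hv with hv | hv
        · exact fun h' => hx.notMem_left_of_P h' hv
        · exact fun h' => hx.notMem_Q_of_P h' hv
      have hu' : u ∉ x.P := fun h' => hx.notMem_left_of_P h' hu.1
      exact ⟨h.diff_eq H (fun h' => hu' h'.1) fun h' => hv' h'.1,
        h.diff_eq H (fun h' => hv' h'.1) fun h' => hu' h'.1⟩)
    (fun _ _ _ _ _ => rfl)
    (fun G G' h t ht => by
      congr 1
      refine finsum_mem_congr rfl fun y hy => ?_
      rw [Side.above, Side.above, h.diff_eq H]
      · exact fun h' => hx.notMem_TP_of_P h'.1 ht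
      · exact fun h' => hy.2 h'.1)
    (fun G hG => by
      rw [finsum_mem_add_distrib (Set.toFinite _), (hbase G hG.1).compatible_P hx hG.2.1, add_zero]
      exact swap _ _)
  have eP : paritiesEvent x.P x.TP (fun _ b => ∑ᶠ t ∈ x.TP, adjBit H b t)
      (fun G t => ∑ᶠ b ∈ x.P, adjBit H t b + ∑ᶠ y ∈ x.all \ x.P, x.above (diff G H) t y) =
      {G | x.PEq (diff G H)} := by
    ext G
    exact mem_paritiesEvent_diff_iff
  rw [eP] at bP
  have e : A ∩ {G | x.PEq (diff G H) ∧ x.QEq (diff G H)} =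
      A ∩ {G | x.QEq (diff G H)} ∩ {G | x.PEq (diff G H)} := by
    ext G
    simp only [Set.mem_inter_iff, Set.mem_ofPred_eq]
    tauto
  rw [e, Side.scale]
  set μ := SimpleGraph.binomialRandom V p
  set kP : ℝ := 2 * (1 / 2) ^ (x.P.ncard + x.TP.ncard) with hkP
  set kQ : ℝ := 2 * (1 / 2) ^ (x.Q.ncard + x.TQ.ncard) with hkQ
  have kP0 : 0 ≤ kP := by positivity
  have kQ0 : 0 ≤ kQ := by positivity
  have m0 : 0 ≤ μ.real A := measureReal_nonneg
  have m1 : 0 ≤ μ.real (A ∩ {G | x.QEq (diff G H)}) := measureReal_nonneg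
  have h1ε : 0 ≤ 1 - ε := sub_nonneg.2 hε1
  constructor
  · calc kP * kQ * (1 - ε) ^ 2 * μ.real A = kP * (1 - ε) * (kQ * (1 - ε) * μ.real A) := by ring
      _ ≤ kP * (1 - ε) * μ.real (A ∩ {G | x.QEq (diff G H)}) := by
          refine mul_le_mul_of_nonneg_left (le_trans ?_ bQ.1) (by positivity)
          gcongr
      _ ≤ _ := by
          refine le_trans ?_ bP.1
          gcongr
  · calc _ ≤ kP * (1 + ε) * μ.real (A ∩ {G | x.QEq (diff G H)}) := by
          refine bP.2.trans ?_
          gcongr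
      _ ≤ kP * (1 + ε) * (kQ * (1 + ε) * μ.real A) := by
          refine mul_le_mul_of_nonneg_left (bQ.2.trans ?_) (by positivity)
          gcongr
      _ = kP * kQ * (1 + ε) ^ 2 * μ.real A := by ring

/-! ### Revealed information of induced subgraphs -/

theorem par_induce {V : Type*} (G : SimpleGraph V) (X : Set V) (Y Z : Set X) :
    par (G.induce X) (potentialEdges Y Z) =
      par G (potentialEdges (Subtype.val '' Y) (Subtype.val '' Z)) := by
  have h : G.edgeSet ∩ potentialEdges (Subtype.val '' Y) (Subtype.val '' Z) =
      Sym2.map Subtype.val '' ((G.induce X).edgeSet ∩ potentialEdges Y Z) := by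
    ext e
    constructor
    · rintro ⟨he, _, ⟨u, hu, rfl⟩, _, ⟨v, hv, rfl⟩, hne, rfl⟩
      exact ⟨s(u, v), ⟨he, u, hu, v, hv, fun h => hne (congrArg _ h), rfl⟩, rfl⟩
    · rintro ⟨_, ⟨he, u, hu, v, hv, hne, rfl⟩, rfl⟩
      exact ⟨he, u, ⟨u, hu, rfl⟩, v, ⟨v, hv, rfl⟩, fun h => hne (Subtype.ext h), rfl⟩
  rw [par, par, h, Set.ncard_image_of_injective _ (Sym2.map.injective Subtype.val_injective)]

theorem induce_mem_sameRevealed_iff {V : Type*} {G H : SimpleGraph V} {X R : Set V} (hR : R ⊆ X) :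
    G.induce X ∈ sameRevealed (Subtype.val ⁻¹' R) (H.induce X) ↔
      (∀ u ∈ R, ∀ v ∈ R, diff G H u v = 0) ∧
      (∀ u ∈ R, par G (potentialEdges {u} X) = par H (potentialEdges {u} X)) ∧
      par G (potentialEdges X X) = par H (potentialEdges X X) := by
  simp only [sameRevealed, Set.mem_ofPred_eq, par_induce, Set.image_univ, Subtype.range_coe_subtype,
    Set.image_singleton, Set.ofPred_mem_eq, SimpleGraph.comap_adj, Function.Embedding.subtype_apply,
    Set.mem_preimage, Subtype.forall, diff_eq_zero]
  refine and_congr ?_ (and_congr ?_ Iff.rfl)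
  · exact ⟨fun h u hu v hv => h u (hR hu) hu v (hR hv) hv, fun h u _ hu v _ hv => h u hu v hv⟩
  · exact ⟨fun h u hu => h u (hR hu) hu, fun h u _ hu => h u hu⟩

theorem Side.baseEq_diff_iff {V : Type*} [Finite V] {x : Side V} (hx : x.left ⊆ x.all)
    {G H : SimpleGraph V} : x.BaseEq (diff G H) ↔
      (∀ u v, s(u, v) ∈ x.sigma → diff G H u v = 0) ∧
      G.induce x.left ∈ sameRevealed (Subtype.val ⁻¹' x.revealed) (H.induce x.left) := by
  have hr : Set.InjOn (rank x.order) x.left := fun u hu v hv h => rank_inj (hx hu) (hx hv) h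
  rw [induce_mem_sameRevealed_iff x.revealed_subset_left, par_pairs_eq_iff hr]
  simp only [par_star_eq_iff]
  constructor
  · exact fun h => ⟨h.sigma, h.revealed, h.star, h.pairs⟩
  · rintro ⟨h1, h2, h3, h4⟩
    exact ⟨diff_comm G H, diff_self G H, h1, h2, h3, h4⟩

theorem spanningCoe_sup_adj {V : Type*} {X Y : Set V} {F : SimpleGraph X} {F' : SimpleGraph Y}
    {u v : V} : (F.spanningCoe ⊔ F'.spanningCoe).Adj u v ↔
      (∃ (hu : u ∈ X) (hv : v ∈ X), F.Adj ⟨u, hu⟩ ⟨v, hv⟩) ∨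
        ∃ (hu : u ∈ Y) (hv : v ∈ Y), F'.Adj ⟨u, hu⟩ ⟨v, hv⟩ := by
  simp [SimpleGraph.sup_adj, SimpleGraph.map_adj]

theorem induce_sup_left {V : Type*} {X Y : Set V} (h : Disjoint X Y) (F : SimpleGraph X)
    (F' : SimpleGraph Y) : (F.spanningCoe ⊔ F'.spanningCoe).induce X = F := by
  ext u v
  rw [SimpleGraph.comap_adj, spanningCoe_sup_adj]
  constructor
  · rintro (⟨_, _, h'⟩ | ⟨hu, _, _⟩)
    · exact h'
    · exact absurd hu (Set.disjoint_left.1 h u.2)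
  · exact fun h' => Or.inl ⟨u.2, v.2, h'⟩

theorem induce_sup_right {V : Type*} {X Y : Set V} (h : Disjoint X Y) (F : SimpleGraph X)
    (F' : SimpleGraph Y) : (F.spanningCoe ⊔ F'.spanningCoe).induce Y = F' := by
  rw [sup_comm]
  exact induce_sup_left h.symm F' F

/-! ### The law of the leftover graphs -/

theorem mem_agree_pairs_iff {V : Type*} {G H : SimpleGraph V} {X : Set V} :
    G ∈ agree (potentialEdges X X) H ↔ G.induce X = H.induce X := by
  constructor
  · intro h
    ext u v
    rw [SimpleGraph.comap_adj, SimpleGraph.comap_adj]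
    exact diff_eq_zero.1 (agree_pairs_iff.1 h u u.2 v v.2)
  · intro h
    refine agree_pairs_iff.2 fun u hu v hv => diff_eq_zero.2 ?_
    have := congrArg (fun F : SimpleGraph X => F.Adj ⟨u, hu⟩ ⟨v, hv⟩) h
    simpa using this

theorem mem_agree_union_iff {V : Type*} {G H : SimpleGraph V} {K L : Set (Sym2 V)} :
    G ∈ agree (K ∪ L) H ↔ G ∈ agree K H ∧ G ∈ agree L H := by
  simp only [agree, Set.mem_ofPred_eq, Set.mem_union, or_imp, forall_and]

theorem Side.Regular.free_subset {V : Type*} {x : Side V} (hx : x.Regular) :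
    x.free ⊆ potentialEdges x.all x.all := by
  rintro e (⟨u, hu, v, hv, hne, rfl⟩ | ⟨u, hu, v, hv, hne, rfl⟩)
  · exact ⟨u, hx.P_subset_all hu, v, hx.TP_subset_all hv, hne, rfl⟩
  · exact ⟨u, hx.Q_subset_all hu, v, hx.left_subset hv.1, hne, rfl⟩

theorem Side.Regular.disjoint_free_left {V : Type*} {x : Side V} (hx : x.Regular) :
    Disjoint x.free (potentialEdges x.left x.left) := by
  refine Set.disjoint_left.2 ?_
  rintro e (⟨u, hu, v, hv, hne, rfl⟩ | ⟨u, hu, v, hv, hne, rfl⟩) h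
  · exact hx.notMem_left_of_P hu (by
      rcases (mem_potentialEdges.1 h).2 with h | h; exacts [h.1, h.2])
  · exact hx.notMem_left_of_Q hu (by
      rcases (mem_potentialEdges.1 h).2 with h | h; exacts [h.1, h.2])

theorem potentialEdges_mono {V : Type*} {X Y : Set V} (h : X ⊆ Y) :
    potentialEdges X X ⊆ potentialEdges Y Y := by
  rintro e ⟨u, hu, v, hv, hne, rfl⟩
  exact ⟨u, h hu, v, h hv, hne, rfl⟩

theorem disjoint_potentialEdges {V : Type*} {X Y : Set V} (h : Disjoint X Y) :
    Disjoint (potentialEdges X X) (potentialEdges Y Y) := by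
  refine Set.disjoint_left.2 ?_
  rintro e ⟨u, hu, v, hv, hne, rfl⟩ he
  rcases (mem_potentialEdges.1 he).2 with h' | h'
  · exact Set.disjoint_left.1 h hu h'.1
  · exact Set.disjoint_left.1 h hu h'.2

theorem Side.BaseEq.mem_free_or_left {V : Type*} {x : Side V} {f : V → V → ZMod 2}
    (hf : x.BaseEq f) {u v : V} (hu : u ∈ x.all) (hv : v ∈ x.all) (h : f u v ≠ 0) :
    s(u, v) ∈ x.free ∨ s(u, v) ∈ potentialEdges x.left x.left := by
  have huv : u ≠ v := fun e => h (by rw [e]; exact hf.diag v)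
  rcases hf.cases_of_ne_zero hu hv h with h' | h' | h' | h' | h'
  · exact Or.inr (mem_potentialEdges.2 ⟨huv, Or.inl h'⟩)
  · exact Or.inl (Or.inl (mem_potentialEdges.2 ⟨huv, Or.inl h'⟩))
  · exact Or.inl (Or.inl (mem_potentialEdges.2 ⟨huv, Or.inr h'⟩))
  · exact Or.inl (Or.inr (mem_potentialEdges.2 ⟨huv, Or.inl h'⟩))
  · exact Or.inl (Or.inr (mem_potentialEdges.2 ⟨huv, Or.inr h'⟩))

/-- The potential edges that are neither inside `V_B` or `V_C` nor free. -/
noncomputable def known {V : Type*} (x y : Side V) : Set (Sym2 V) :=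
  (x.free ∪ y.free ∪ (potentialEdges x.left x.left ∪ potentialEdges y.left y.left))ᶜ

theorem known_comm {V : Type*} (x y : Side V) : known x y = known y x := by
  rw [known, known, Set.union_comm x.free, Set.union_comm (potentialEdges x.left x.left)]

theorem mem_known_of_notMem {V : Type*} {x y : Side V} (hx : x.Regular) (hy : y.Regular)
    {e : Sym2 V} (h : e ∉ potentialEdges x.all x.all) (h' : e ∉ potentialEdges y.all y.all) :
    e ∈ known x y := by
  rintro ((h1 | h1) | h1 | h1)
  · exact h (hx.free_subset h1)
  · exact h' (hy.free_subset h1)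
  · exact h (potentialEdges_mono hx.left_subset h1)
  · exact h' (potentialEdges_mono hy.left_subset h1)

theorem sigma_subset_known {V : Type*} {x y : Side V} (hy : y.Regular)
    (hd : Disjoint x.all y.all) : x.sigma ⊆ known x y := by
  intro e he
  have hn := Set.disjoint_left.1 (disjoint_potentialEdges hd) he.1
  rintro ((h' | h') | h' | h')
  · exact he.2 (h'.elim (fun h => Or.inl (Or.inr h)) Or.inr)
  · exact hn (hy.free_subset h')
  · exact he.2 (Or.inl (Or.inl h'))
  · exact hn (potentialEdges_mono hy.left_subset h')

namespace Setup.Run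

variable {V : Type*} {S : Setup V} {G₀ : SimpleGraph V} {stBC stCB : RemovalState V}

theorem leftover_eq (h : S.Run G₀ stBC stCB) :
    S.leftover G₀ = (G₀.induce (S.sideB stCB).left).spanningCoe ⊔
      (G₀.induce (S.sideC stBC).left).spanningCoe := by
  rw [Setup.leftover, h.outcome_eq]

theorem disjoint_all : Disjoint (S.sideB stCB).all (S.sideC stBC).all :=
  Set.disjoint_left.2 fun _ hb hc => S.disjoint_bc hb hc

theorem disjoint_left (h : S.Run G₀ stBC stCB) :
    Disjoint (S.sideB stCB).left (S.sideC stBC).left :=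
  disjoint_all.mono h.left_sideB h.left_sideC

/-- The graphs on which `Γ` has its value at `G₀` and which have given feasible leftover graphs:
everything but the free edges is determined, and the free edges satisfy linear equations. -/
theorem fiber_eq [Finite V] (h : S.Run G₀ stBC stCB) (hx : (S.sideB stCB).Regular)
    (hy : (S.sideC stBC).Regular) {G₁ : SimpleGraph V}
    (h0 : G₁ ∈ agree (known (S.sideB stCB) (S.sideC stBC)) G₀)
    (hF : G₁.induce (S.sideB stCB).left ∈ sameRevealed (Subtype.val ⁻¹' (S.sideB stCB).revealed)
      (G₀.induce (S.sideB stCB).left))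
    (hF' : G₁.induce (S.sideC stBC).left ∈ sameRevealed (Subtype.val ⁻¹' (S.sideC stBC).revealed)
      (G₀.induce (S.sideC stBC).left)) :
    {G | S.Gam G = S.Gam G₀} ∩ S.leftover ⁻¹' {(G₁.induce (S.sideB stCB).left).spanningCoe ⊔
        (G₁.induce (S.sideC stBC).left).spanningCoe} =
      agree (known (S.sideB stCB) (S.sideC stBC) ∪
        (potentialEdges (S.sideB stCB).left (S.sideB stCB).left ∪
          potentialEdges (S.sideC stBC).left (S.sideC stBC).left)) G₁ ∩
      {G | (S.sideB stCB).PEq (diff G G₀) ∧ (S.sideB stCB).QEq (diff G G₀)} ∩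
      {G | (S.sideC stBC).PEq (diff G G₀) ∧ (S.sideC stBC).QEq (diff G G₀)} := by
  set x := S.sideB stCB with hxdef
  set y := S.sideC stBC with hydef
  have hdis : Disjoint x.left y.left := h.disjoint_left
  have hall : Disjoint x.all y.all := disjoint_all
  ext G
  simp only [Set.mem_inter_iff, mem_agree_union_iff, mem_agree_pairs_iff, Set.mem_ofPred_eq,
    Set.mem_preimage, Set.mem_singleton_iff]
  constructor
  · rintro ⟨hG, hleft⟩
    have hrun := h.of_Gam_eq hG
    obtain ⟨hcross, ⟨bx, by'⟩, ex, ey⟩ := h.Gam_eq_iff.1 hG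
    rw [hrun.leftover_eq] at hleft
    refine ⟨⟨⟨?_, ?_, ?_⟩, (bx.forward_and_backward_iff hx).1 ex⟩,
      (by'.forward_and_backward_iff hy).1 ey⟩
    · intro e he
      refine Iff.trans ?_ (h0 e he).symm
      induction e using Sym2.ind with
      | _ u v =>
        refine diff_eq_zero.1 ?_
        by_contra hne
        refine he ?_
        by_cases h1 : u ∈ S.b ∧ v ∈ S.b
        · exact (bx.mem_free_or_left h1.1 h1.2 hne).elim (fun h => Or.inl (Or.inl h))
            fun h => Or.inr (Or.inl h)
        by_cases h2 : u ∈ S.c ∧ v ∈ S.c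
        · exact (by'.mem_free_or_left h2.1 h2.2 hne).elim (fun h => Or.inl (Or.inr h))
            fun h => Or.inr (Or.inr h)
        exact absurd (hcross u v h1 h2) hne
    · have := congrArg (SimpleGraph.induce x.left) hleft
      rwa [induce_sup_left hdis, induce_sup_left hdis] at this
    · have := congrArg (SimpleGraph.induce y.left) hleft
      rwa [induce_sup_right hdis, induce_sup_right hdis] at this
  · rintro ⟨⟨⟨hk, hl, hl'⟩, ex⟩, ey⟩
    have hk' : ∀ u v, s(u, v) ∈ known x y → diff G G₀ u v = 0 := fun u v huv =>
      diff_eq_zero.2 ((hk _ huv).trans (h0 _ huv))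
    have bx : x.BaseEq (diff G G₀) := (Side.baseEq_diff_iff hx.left_subset).2
      ⟨fun u v huv => hk' u v (sigma_subset_known hy hall huv), by rwa [hl]⟩
    have by' : y.BaseEq (diff G G₀) := (Side.baseEq_diff_iff hy.left_subset).2
      ⟨fun u v huv => hk' u v (known_comm y x ▸ sigma_subset_known hx hall.symm huv),
        by rwa [hl']⟩
    have hG : S.Gam G = S.Gam G₀ := by
      refine h.Gam_eq_iff.2 ⟨fun u v h1 h2 => ?_, ⟨bx, by'⟩,
        (bx.forward_and_backward_iff hx).2 ex, (by'.forward_and_backward_iff hy).2 ey⟩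
      refine hk' u v (mem_known_of_notMem hx hy ?_ ?_)
      · rw [mem_potentialEdges]
        rintro ⟨-, h' | h'⟩
        exacts [h1 h', h1 h'.symm]
      · rw [mem_potentialEdges]
        rintro ⟨-, h' | h'⟩
        exacts [h2 h', h2 h'.symm]
    exact ⟨hG, by rw [(h.of_Gam_eq hG).leftover_eq, hl, hl']⟩

/-- A graph with given induced subgraphs on two disjoint sets that agrees with `G₀` outside. -/
theorem exists_composite {X Y : Set V} (hd : Disjoint X Y) (G₀ : SimpleGraph V)
    (F : SimpleGraph X) (F' : SimpleGraph Y) : ∃ G₁ : SimpleGraph V,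
      G₁ ∈ agree (potentialEdges X X ∪ potentialEdges Y Y)ᶜ G₀ ∧
        G₁.induce X = F ∧ G₁.induce Y = F' := by
  set L := potentialEdges X X ∪ potentialEdges Y Y with hL
  set D := F.spanningCoe ⊔ F'.spanningCoe with hD
  refine ⟨SimpleGraph.fromEdgeSet ((D.edgeSet ∩ L) ∪ (G₀.edgeSet \ L)), ?_, ?_, ?_⟩
  · intro e he
    have h1 : e ∈ G₀.edgeSet → ¬ e.IsDiag := G₀.not_isDiag_of_mem_edgeSet
    have he' : e ∉ L := he
    simp only [SimpleGraph.edgeSet_fromEdgeSet, Set.mem_sdiff, Set.mem_union, Set.mem_inter_iff,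
      he', and_false, not_false_eq_true, and_true, false_or, Sym2.mem_diagSet]
    exact ⟨fun h => h.1, fun h => ⟨h, h1 h⟩⟩
  · rw [← induce_sup_left hd F F', ← hD, ← mem_agree_pairs_iff]
    intro e he
    have h1 : e ∈ D.edgeSet → ¬ e.IsDiag := D.not_isDiag_of_mem_edgeSet
    have he' : e ∈ L := Or.inl he
    simp only [SimpleGraph.edgeSet_fromEdgeSet, Set.mem_sdiff, Set.mem_union, Set.mem_inter_iff,
      he', not_true_eq_false, and_true, and_false, or_false, Sym2.mem_diagSet]
    exact ⟨fun h => h.1, fun h => ⟨h, h1 h⟩⟩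
  · rw [← induce_sup_right hd F F', ← hD, ← mem_agree_pairs_iff]
    intro e he
    have h1 : e ∈ D.edgeSet → ¬ e.IsDiag := D.not_isDiag_of_mem_edgeSet
    have he' : e ∈ L := Or.inr he
    simp only [SimpleGraph.edgeSet_fromEdgeSet, Set.mem_sdiff, Set.mem_union, Set.mem_inter_iff,
      he', not_true_eq_false, and_true, and_false, or_false, Sym2.mem_diagSet]
    exact ⟨fun h => h.1, fun h => ⟨h, h1 h⟩⟩

/-- The numerical assumptions on a side. -/
structure _root_.EvenDegenerate.Side.ErrorBound (x : Side V) (l ε : ℝ) : Prop where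
  nonempty_P : x.P.Nonempty
  nonempty_Q : x.Q.Nonempty
  error_P : parityError l x.P.ncard x.TP.ncard ≤ ε
  error_Q : parityError l x.Q.ncard x.TQ.ncard ≤ ε

/-- The probability of given feasible leftover graphs is almost proportional to the product of
their probabilities in the binomial random graphs. -/
theorem fiber_bounds [Finite V] (h : S.Run G₀ stBC stCB) (hx : (S.sideB stCB).Regular)
    (hy : (S.sideC stBC).Regular) (p : unitInterval) {l ε : ℝ}
    (hl : |1 - 2 * (p : ℝ)| ≤ l) (hl1 : l ≤ 1) (hε0 : 0 ≤ ε) (hε1 : ε ≤ 1)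
    (ex : (S.sideB stCB).ErrorBound l ε) (ey : (S.sideC stBC).ErrorBound l ε)
    {F : SimpleGraph (S.sideB stCB).left} {F' : SimpleGraph (S.sideC stBC).left}
    (hF : F ∈ sameRevealed (Subtype.val ⁻¹' (S.sideB stCB).revealed)
      (G₀.induce (S.sideB stCB).left))
    (hF' : F' ∈ sameRevealed (Subtype.val ⁻¹' (S.sideC stBC).revealed)
      (G₀.induce (S.sideC stBC).left)) :
    (S.sideB stCB).scale * (S.sideC stBC).scale * (1 - ε) ^ 4 *
        ((SimpleGraph.binomialRandom V p).real
            (agree (known (S.sideB stCB) (S.sideC stBC)) G₀) *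
          ((SimpleGraph.binomialRandom _ p).real {F} *
            (SimpleGraph.binomialRandom _ p).real {F'})) ≤
      (SimpleGraph.binomialRandom V p).real ({G | S.Gam G = S.Gam G₀} ∩
        S.leftover ⁻¹' {F.spanningCoe ⊔ F'.spanningCoe}) ∧
    (SimpleGraph.binomialRandom V p).real ({G | S.Gam G = S.Gam G₀} ∩
        S.leftover ⁻¹' {F.spanningCoe ⊔ F'.spanningCoe}) ≤
      (S.sideB stCB).scale * (S.sideC stBC).scale * (1 + ε) ^ 4 *
        ((SimpleGraph.binomialRandom V p).real
            (agree (known (S.sideB stCB) (S.sideC stBC)) G₀) *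
          ((SimpleGraph.binomialRandom _ p).real {F} *
            (SimpleGraph.binomialRandom _ p).real {F'})) := by
  cases nonempty_fintype V
  obtain ⟨G₁, h1, rfl, rfl⟩ := exists_composite h.disjoint_left G₀ F F'
  have h0 : G₁ ∈ agree (known (S.sideB stCB) (S.sideC stBC)) G₀ := fun e he =>
    h1 e fun h' => he (Or.inr h')
  rw [h.fiber_eq hx hy h0 hF hF']
  set x := S.sideB stCB with hxdef
  set y := S.sideC stBC with hydef
  set K := known x y ∪ (potentialEdges x.left x.left ∪ potentialEdges y.left y.left) with hK
  set μ := SimpleGraph.binomialRandom V p with hμ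
  have hall : Disjoint x.all y.all := disjoint_all
  have hEE : Disjoint (potentialEdges x.all x.all) (potentialEdges y.all y.all) :=
    disjoint_potentialEdges hall
  have dxx : ∀ e ∈ x.free, e ∉ potentialEdges x.left x.left := fun e he =>
    Set.disjoint_left.1 hx.disjoint_free_left he
  have dyy : ∀ e ∈ y.free, e ∉ potentialEdges y.left y.left := fun e he =>
    Set.disjoint_left.1 hy.disjoint_free_left he
  have dxy : ∀ e ∈ x.free, e ∉ potentialEdges y.left y.left := fun e he he' =>
    Set.disjoint_left.1 hEE (hx.free_subset he) (potentialEdges_mono hy.left_subset he')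
  have dyx : ∀ e ∈ y.free, e ∉ potentialEdges x.left x.left := fun e he he' =>
    Set.disjoint_left.1 hEE (potentialEdges_mono hx.left_subset he') (hy.free_subset he)
  have hKx : ∀ e ∈ K, e ∉ x.free := by
    rintro e (he | he | he) hfree
    · exact he (Or.inl (Or.inl hfree))
    · exact dxx e hfree he
    · exact dxy e hfree he
  have hKy : ∀ e ∈ K, e ∉ y.free := by
    rintro e (he | he | he) hfree
    · exact he (Or.inl (Or.inr hfree))
    · exact dyx e hfree he
    · exact dyy e hfree he
  have hkn : ∀ G ∈ agree K G₁, ∀ e ∈ known x y, (e ∈ G.edgeSet ↔ e ∈ G₀.edgeSet) := fun G hG e he =>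
    (hG e (Or.inl he)).trans (h0 e he)
  have hbx : ∀ G ∈ agree K G₁, x.BaseEq (diff G G₀) := by
    intro G hG
    obtain ⟨-, hG2⟩ := mem_agree_union_iff.1 hG
    obtain ⟨hG3, -⟩ := mem_agree_union_iff.1 hG2
    rw [mem_agree_pairs_iff] at hG3
    exact (Side.baseEq_diff_iff hx.left_subset).2
      ⟨fun u v huv => diff_eq_zero.2 (hkn G hG s(u, v) (sigma_subset_known hy hall huv)),
        by rwa [hG3]⟩
  have hby : ∀ G ∈ agree K G₁, y.BaseEq (diff G G₀) := by
    intro G hG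
    obtain ⟨-, hG2⟩ := mem_agree_union_iff.1 hG
    obtain ⟨-, hG3⟩ := mem_agree_union_iff.1 hG2
    rw [mem_agree_pairs_iff] at hG3
    exact (Side.baseEq_diff_iff hy.left_subset).2
      ⟨fun u v huv => diff_eq_zero.2 (hkn G hG s(u, v)
        (known_comm y x ▸ sigma_subset_known hx hall.symm huv)), by rwa [hG3]⟩
  obtain ⟨lx, ux⟩ := hx.real_bounds p hl hl1 ex.nonempty_P ex.nonempty_Q ex.error_P ex.error_Q
    hε0 hε1 G₀ (agree K G₁)
    (fun G G' hGG hG e he => (hGG e (hKx e he)).symm.trans (hG e he)) hbx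
  obtain ⟨ly, uy⟩ := hy.real_bounds p hl hl1 ey.nonempty_P ey.nonempty_Q ey.error_P ey.error_Q
    hε0 hε1 G₀ (agree K G₁ ∩ {G | x.PEq (diff G G₀) ∧ x.QEq (diff G G₀)})
    (fun G G' hGG hG => by
      have hd : ∀ u ∈ x.all, ∀ v ∈ x.all, diff G G₀ u v = diff G' G₀ u v := by
        intro u hu v hv
        by_cases huv : u = v
        · rw [huv, diff_self, diff_self]
        · rw [diff, diff, adjBit_eq_iff.2 (hGG s(u, v) fun hfree => ?_)]
          exact Set.disjoint_left.1 hEE (mem_potentialEdges.2 ⟨huv, Or.inl ⟨hu, hv⟩⟩)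
            (hy.free_subset hfree)
      refine ⟨fun e he => (hGG e (hKy e he)).symm.trans (hG.1 e he), hG.2.1.congr hx hd,
        hG.2.2.congr fun u hu v hv => ?_⟩
      have hva : v ∈ x.all := hv.elim (fun h => hx.left_subset h) fun h => hx.Q_subset_all h
      exact ⟨hd u (hx.left_subset hu.1) v hva, hd v hva u (hx.left_subset hu.1)⟩)
    (fun G hG => hby G hG.1)
  have hprod : μ.real (agree K G₁) = μ.real (agree (known x y) G₀) *
      ((SimpleGraph.binomialRandom _ p).real {G₁.induce x.left} *
        (SimpleGraph.binomialRandom _ p).real {G₁.induce y.left}) := by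
    rw [hK, hμ, binomialRandom_real_agree_union, binomialRandom_real_agree_union,
      binomialRandom_real_agree_induce, binomialRandom_real_agree_induce]
    · congr 2
      ext G
      exact forall₂_congr fun e he => by rw [h0 e he]
    · exact hEE.mono (potentialEdges_mono hx.left_subset) (potentialEdges_mono hy.left_subset)
    · exact Set.disjoint_left.2 fun e he he' => he (Or.inr he')
  rw [hprod] at lx ux
  have sx := x.scale_pos
  have sy := y.scale_pos
  have h1ε : 0 ≤ 1 - ε := sub_nonneg.2 hε1
  set m := μ.real (agree (known x y) G₀) *
      ((SimpleGraph.binomialRandom _ p).real {G₁.induce x.left} *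
        (SimpleGraph.binomialRandom _ p).real {G₁.induce y.left}) with hm
  constructor
  · calc x.scale * y.scale * (1 - ε) ^ 4 * m
        = y.scale * (1 - ε) ^ 2 * (x.scale * (1 - ε) ^ 2 * m) := by ring
      _ ≤ _ := le_trans (mul_le_mul_of_nonneg_left lx (by positivity)) ly
  · calc _ ≤ y.scale * (1 + ε) ^ 2 * (x.scale * (1 + ε) ^ 2 * m) :=
          uy.trans (mul_le_mul_of_nonneg_left ux (by positivity))
      _ = x.scale * y.scale * (1 + ε) ^ 4 * m := by ring

end Setup.Run

theorem one_sub_eight_mul_le {ε : ℝ} (h0 : 0 ≤ ε) (h1 : 8 * ε < 1) :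
    (1 - 8 * ε) * (1 + ε) ^ 4 ≤ (1 - ε) ^ 4 := by
  have h2 : 1 - 8 * ε ≤ (1 - 2 * ε) ^ 4 := by
    have := one_add_mul_le_pow (a := -(2 * ε)) (by linarith) 4
    push_cast at this
    rw [sub_eq_add_neg 1 (2 * ε)]
    linarith
  have h3 : ((1 - 2 * ε) * (1 + ε)) ^ 4 ≤ (1 - ε) ^ 4 := by
    refine pow_le_pow_left₀ (mul_nonneg (by linarith) (by linarith)) ?_ 4
    nlinarith [sq_nonneg ε]
  rw [mul_pow] at h3
  exact (mul_le_mul_of_nonneg_right h2 (by positivity)).trans h3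

/-- Two probability measures on a finite space are close if they are almost proportional. -/
theorem isClose_of_bounds {X : Type*} [Finite X] [MeasurableSpace X] [MeasurableSingletonClass X]
    {μ ν : Measure X} [IsProbabilityMeasure μ] [IsProbabilityMeasure ν] {c ε ε' : ℝ}
    (hc : 0 < c) (h0 : 0 ≤ ε) (h1 : 8 * ε ≤ ε') (h2 : ε' < 1)
    (hl : ∀ x, c * (1 - ε) ^ 4 * ν.real {x} ≤ μ.real {x})
    (hu : ∀ x, μ.real {x} ≤ c * (1 + ε) ^ 4 * ν.real {x}) : IsClose ε' μ ν := by
  classical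
  cases nonempty_fintype X
  have hsum : ∀ (ρ : Measure X) [IsProbabilityMeasure ρ], ∑ x, ρ.real {x} = 1 := by
    intro ρ _
    rw [sum_measureReal_singleton, Finset.coe_univ, probReal_univ]
  have hlow : 0 < 1 - ε := by linarith
  have s1 : c * (1 - ε) ^ 4 ≤ 1 := by
    have := Finset.sum_le_sum fun x (_ : x ∈ Finset.univ) => hl x
    rwa [← Finset.mul_sum, hsum, hsum, mul_one] at this
  have s2 : 1 ≤ c * (1 + ε) ^ 4 := by
    have := Finset.sum_le_sum fun x (_ : x ∈ Finset.univ) => hu x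
    rwa [← Finset.mul_sum, hsum, hsum, mul_one] at this
  have key := one_sub_eight_mul_le h0 (h1.trans_lt h2)
  have hε' : 0 < 1 - ε' := by linarith
  have hkey : (1 - ε') * (1 + ε) ^ 4 ≤ (1 - ε) ^ 4 :=
    le_trans (mul_le_mul_of_nonneg_right (by linarith) (by positivity)) key
  have hne : ∀ (ρ : Measure X) [IsProbabilityMeasure ρ] (x : X), ρ {x} ≠ 0 ↔ 0 < ρ.real {x} := by
    intro ρ _ x
    rw [measureReal_def, ENNReal.toReal_pos_iff, pos_iff_ne_zero]
    exact ⟨fun h => ⟨h, measure_lt_top _ _⟩, fun h => h.1⟩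
  have hp1 : 0 < (1 - ε) ^ 4 := by positivity
  have hp2 : 0 < (1 + ε) ^ 4 := by positivity
  refine ⟨fun x => ?_, fun x hx => ?_⟩
  · rw [hne, hne]
    constructor
    · intro h
      exact pos_of_mul_pos_right (h.trans_le (hu x)) (by positivity)
    · intro h
      exact lt_of_lt_of_le (by positivity) (hl x)
  · rw [hne] at hx
    have n0 : 0 ≤ ν.real {x} := measureReal_nonneg
    constructor
    · rw [le_div_iff₀ hx]
      calc (1 - ε') * μ.real {x} ≤ (1 - ε') * (c * (1 + ε) ^ 4 * ν.real {x}) :=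
            mul_le_mul_of_nonneg_left (hu x) hε'.le
        _ = c * ((1 - ε') * (1 + ε) ^ 4) * ν.real {x} := by ring
        _ ≤ c * (1 - ε) ^ 4 * ν.real {x} := by gcongr
        _ ≤ ν.real {x} := mul_le_of_le_one_left n0 s1
    · rw [div_le_iff₀ hx, ← div_eq_inv_mul, le_div_iff₀ hε']
      calc ν.real {x} * (1 - ε') = (1 - ε') * ν.real {x} * 1 := by ring
        _ ≤ (1 - ε') * ν.real {x} * (c * (1 + ε) ^ 4) := by gcongr
        _ = c * ((1 - ε') * (1 + ε) ^ 4) * ν.real {x} := by ring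
        _ ≤ c * (1 - ε) ^ 4 * ν.real {x} := by gcongr
        _ ≤ μ.real {x} := hl x

theorem cond_measureReal {Ω : Type*} [MeasurableSpace Ω] {A : Set Ω} (hA : MeasurableSet A)
    (μ : Measure Ω) (T : Set Ω) :
    (ProbabilityTheory.cond μ A).real T = (μ.real A)⁻¹ * μ.real (A ∩ T) := by
  rw [measureReal_def, ProbabilityTheory.cond_apply hA, ENNReal.toReal_mul, ENNReal.toReal_inv]
  rfl

theorem binomialRandom_real_pos {V : Type*} [Finite V] {p : unitInterval} (h0 : 0 < (p : ℝ))
    (h1 : (p : ℝ) < 1) {A : Set (SimpleGraph V)} (hA : A.Nonempty) :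
    0 < (SimpleGraph.binomialRandom V p).real A := by
  classical
  cases nonempty_fintype V
  obtain ⟨G, hG⟩ := hA
  refine lt_of_lt_of_le ?_ (measureReal_mono (Set.singleton_subset_iff.2 hG))
  rw [binomialRandom_real_singleton]
  refine Finset.prod_pos fun e _ => ?_
  unfold bitWeight
  split_ifs
  · exact h0
  · exact sub_pos.2 h1

theorem Setup.Run.sameRevealed_of_Gam_eq {V : Type*} {S : Setup V} {G G₀ : SimpleGraph V}
    {stBC stCB : RemovalState V} (h : S.Run G₀ stBC stCB) (hG : S.Gam G = S.Gam G₀) :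
    G ∈ sameRevealed S.A G₀ := by
  have hrun := h.of_Gam_eq hG
  rw [h.Gam_eq, hrun.Gam_eq] at hG
  simp only [Option.some_inj, Info.mk.injEq] at hG
  obtain ⟨h1, h2, h3, -⟩ := hG
  rw [graphInfo_eq_iff, agree_pairs_iff] at h1
  exact ⟨fun u hu v hv => diff_eq_zero.1 (h1 u hu v hv), parInfo_family_eq_iff.1 h2,
    parInfo_eq_iff.1 h3⟩

open ProbabilityTheory in
/-- The law of the leftover graphs given `Γ` is close to the law of the union of two independent
partially revealed graphs. -/
theorem Setup.Run.isClose {V : Type*} [Finite V] {S : Setup V} {G₀ : SimpleGraph V}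
    {stBC stCB : RemovalState V} (h : S.Run G₀ stBC stCB) (hx : (S.sideB stCB).Regular)
    (hy : (S.sideC stBC).Regular) {p : unitInterval} (hp0 : 0 < (p : ℝ)) (hp1 : (p : ℝ) < 1)
    {l ε ε' : ℝ} (hl : |1 - 2 * (p : ℝ)| ≤ l) (hl1 : l ≤ 1) (hε0 : 0 ≤ ε) (hε : 8 * ε ≤ ε')
    (hε' : ε' < 1) (ex : (S.sideB stCB).ErrorBound l ε) (ey : (S.sideC stBC).ErrorBound l ε)
    {H : SimpleGraph V} (hG₀ : revealedLaw p S.A H {G₀} ≠ 0) :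
    IsClose ε' ((cond (revealedLaw p S.A H) {G | S.Gam G = S.Gam G₀}).map S.leftover)
      (unionLaw ((S.sideB stCB).law p G₀) ((S.sideC stBC).law p G₀)) := by
  set x := S.sideB stCB with hxdef
  set y := S.sideC stBC with hydef
  set E := {G | S.Gam G = S.Gam G₀} with hE
  set B := SimpleGraph.binomialRandom V p with hB
  have hdis : Disjoint x.left y.left := h.disjoint_left
  have hSR : G₀ ∈ sameRevealed S.A H := by
    by_contra hcon
    refine hG₀ ?_
    rw [revealedLaw, cond_apply (Set.toFinite _).measurableSet,
      Set.inter_singleton_eq_empty.2 hcon, measure_empty, mul_zero]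
  have hESR : E ⊆ sameRevealed S.A H := by
    intro G hG
    obtain ⟨h1, h2, h3⟩ := h.sameRevealed_of_Gam_eq hG
    exact ⟨fun u hu v hv => (h1 u hu v hv).trans (hSR.1 u hu v hv),
      fun u hu => (h2 u hu).trans (hSR.2.1 u hu), h3.trans hSR.2.2⟩
  have hcond : cond (revealedLaw p S.A H) E = cond B E := by
    rw [revealedLaw, cond_cond_eq_cond_inter (Set.toFinite _).measurableSet
      (Set.toFinite _).measurableSet, Set.inter_eq_self_of_subset_right hESR]
  rw [hcond]
  have hEpos : 0 < B.real E := binomialRandom_real_pos hp0 hp1 ⟨G₀, rfl⟩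
  have hE0 : B E ≠ 0 := fun h0 => by
    rw [measureReal_def, h0, ENNReal.toReal_zero] at hEpos
    exact lt_irrefl _ hEpos
  have hm : Measurable S.leftover := Measurable.of_discrete
  have hprob1 : IsProbabilityMeasure (cond B E) := cond_isProbabilityMeasure hE0
  have hprob2 : IsProbabilityMeasure ((cond B E).map S.leftover) :=
    Measure.isProbabilityMeasure_map hm.aemeasurable
  set SRx := sameRevealed (Subtype.val ⁻¹' x.revealed) (G₀.induce x.left) with hSRx
  set SRy := sameRevealed (Subtype.val ⁻¹' y.revealed) (G₀.induce y.left) with hSRy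
  set Bx := SimpleGraph.binomialRandom x.left p with hBx
  set By := SimpleGraph.binomialRandom y.left p with hBy
  have hxpos : 0 < Bx.real SRx := binomialRandom_real_pos hp0 hp1
    ⟨G₀.induce x.left, fun _ _ _ _ => Iff.rfl, fun _ _ => rfl, rfl⟩
  have hypos : 0 < By.real SRy := binomialRandom_real_pos hp0 hp1
    ⟨G₀.induce y.left, fun _ _ _ _ => Iff.rfl, fun _ _ => rfl, rfl⟩
  have hx0 : Bx SRx ≠ 0 := fun h0 => by
    rw [measureReal_def, h0, ENNReal.toReal_zero] at hxpos
    exact lt_irrefl _ hxpos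
  have hy0 : By SRy ≠ 0 := fun h0 => by
    rw [measureReal_def, h0, ENNReal.toReal_zero] at hypos
    exact lt_irrefl _ hypos
  have hprob3 : IsProbabilityMeasure (x.law p G₀) := cond_isProbabilityMeasure hx0
  have hprob4 : IsProbabilityMeasure (y.law p G₀) := cond_isProbabilityMeasure hy0
  let g : SimpleGraph x.left × SimpleGraph y.left → SimpleGraph V :=
    fun z => z.1.spanningCoe ⊔ z.2.spanningCoe
  have hg : Measurable g := Measurable.of_discrete
  have hprob5 : IsProbabilityMeasure (unionLaw (V := V) (x.law p G₀) (y.law p G₀)) :=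
    Measure.isProbabilityMeasure_map hg.aemeasurable
  have hleft : ∀ F, ((cond B E).map S.leftover).real {F} =
      (B.real E)⁻¹ * B.real (E ∩ S.leftover ⁻¹' {F}) := by
    intro F
    rw [map_measureReal_apply hm (Set.toFinite _).measurableSet,
      cond_measureReal (Set.toFinite _).measurableSet]
  have hunion : ∀ F F', (unionLaw (V := V) (x.law p G₀) (y.law p G₀)).real {g (F, F')} =
      ((Bx.real SRx)⁻¹ * Bx.real (SRx ∩ {F})) * ((By.real SRy)⁻¹ * By.real (SRy ∩ {F'})) := by
    intro F F'
    have hpre : g ⁻¹' {g (F, F')} = {F} ×ˢ {F'} := by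
      ext ⟨z, z'⟩
      simp only [Set.mem_preimage, Set.mem_singleton_iff, Set.mem_prod]
      constructor
      · intro hz
        have h1 := congrArg (SimpleGraph.induce x.left) hz
        have h2 := congrArg (SimpleGraph.induce y.left) hz
        simp only [g] at h1 h2
        rw [induce_sup_left hdis, induce_sup_left hdis] at h1
        rw [induce_sup_right hdis, induce_sup_right hdis] at h2
        exact ⟨h1, h2⟩
      · rintro ⟨rfl, rfl⟩
        rfl
    change (((x.law p G₀).prod (y.law p G₀)).map g).real _ = _
    rw [map_measureReal_apply hg (Set.toFinite _).measurableSet, hpre, measureReal_prod_prod,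
      Side.law, Side.law, revealedLaw, revealedLaw,
      cond_measureReal (Set.toFinite _).measurableSet,
      cond_measureReal (Set.toFinite _).measurableSet]
  have hunion0 : ∀ F, F ∉ Set.range g →
      (unionLaw (V := V) (x.law p G₀) (y.law p G₀)).real {F} = 0 := by
    intro F hF
    change (((x.law p G₀).prod (y.law p G₀)).map g).real _ = _
    rw [map_measureReal_apply hg (Set.toFinite _).measurableSet,
      Set.preimage_singleton_eq_empty.2 hF, measureReal_empty]
  -- the leftover graphs are feasible
  have hfeas : ∀ G ∈ E, S.leftover G = g (G.induce x.left, G.induce y.left) ∧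
      G.induce x.left ∈ SRx ∧ G.induce y.left ∈ SRy := by
    intro G hG
    obtain ⟨-, ⟨bx, by'⟩, -⟩ := h.Gam_eq_iff.1 hG
    exact ⟨(h.of_Gam_eq hG).leftover_eq, ((Side.baseEq_diff_iff hx.left_subset).1 bx).2,
      ((Side.baseEq_diff_iff hy.left_subset).1 by').2⟩
  set m := B.real (agree (known x y) G₀) with hmdef
  have hmpos : 0 < m := binomialRandom_real_pos hp0 hp1 ⟨G₀, fun _ _ => Iff.rfl⟩
  have sx := x.scale_pos
  have sy := y.scale_pos
  set c := x.scale * y.scale * m * Bx.real SRx * By.real SRy * (B.real E)⁻¹ with hc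
  have hcpos : 0 < c := by positivity
  have key : ∀ F, c * (1 - ε) ^ 4 * (unionLaw (V := V) (x.law p G₀) (y.law p G₀)).real {F} ≤
      ((cond B E).map S.leftover).real {F} ∧
      ((cond B E).map S.leftover).real {F} ≤
        c * (1 + ε) ^ 4 * (unionLaw (V := V) (x.law p G₀) (y.law p G₀)).real {F} := by
    intro D
    rw [hleft]
    by_cases hD : D ∈ Set.range g
    · obtain ⟨⟨F, F'⟩, rfl⟩ := hD
      rw [hunion]
      by_cases hF : F ∈ SRx ∧ F' ∈ SRy
      · obtain ⟨b1, b2⟩ := h.fiber_bounds hx hy p hl hl1 hε0 (by linarith) ex ey hF.1 hF.2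
        rw [Set.inter_eq_self_of_subset_right (Set.singleton_subset_iff.2 hF.1),
          Set.inter_eq_self_of_subset_right (Set.singleton_subset_iff.2 hF.2)]
        have hinv : 0 ≤ (B.real E)⁻¹ := by positivity
        have e : ∀ δ : ℝ, c * δ * ((Bx.real SRx)⁻¹ * Bx.real {F} *
            ((By.real SRy)⁻¹ * By.real {F'})) = (B.real E)⁻¹ *
              (x.scale * y.scale * δ * (m * (Bx.real {F} * By.real {F'}))) := by
          intro δ
          rw [hc]
          field_simp
        rw [e, e]
        exact ⟨mul_le_mul_of_nonneg_left b1 hinv, mul_le_mul_of_nonneg_left b2 hinv⟩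
      · have h1 : E ∩ S.leftover ⁻¹' {g (F, F')} = ∅ := by
          refine Set.eq_empty_of_forall_notMem ?_
          rintro G ⟨hG, hGF⟩
          obtain ⟨h1, h2, h3⟩ := hfeas G hG
          have h4 : g (G.induce x.left, G.induce y.left) = g (F, F') := h1.symm.trans hGF
          have h5 := congrArg (SimpleGraph.induce x.left) h4
          have h6 := congrArg (SimpleGraph.induce y.left) h4
          simp only [g] at h5 h6
          rw [induce_sup_left hdis, induce_sup_left hdis] at h5
          rw [induce_sup_right hdis, induce_sup_right hdis] at h6
          exact hF ⟨h5 ▸ h2, h6 ▸ h3⟩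
        have h2 : (Bx.real SRx)⁻¹ * Bx.real (SRx ∩ {F}) *
            ((By.real SRy)⁻¹ * By.real (SRy ∩ {F'})) = 0 := by
          rw [not_and_or] at hF
          rcases hF with hF | hF
          · rw [Set.inter_singleton_eq_empty.2 hF, measureReal_empty, mul_zero, zero_mul]
          · rw [Set.inter_singleton_eq_empty.2 hF, measureReal_empty, mul_zero, mul_zero]
        rw [h1, measureReal_empty, h2, mul_zero, mul_zero, mul_zero]
        exact ⟨le_rfl, le_rfl⟩
    · have h1 : E ∩ S.leftover ⁻¹' {D} = ∅ := by
        refine Set.eq_empty_of_forall_notMem ?_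
        rintro G ⟨hG, hGF⟩
        exact hD ⟨_, (hfeas G hG).1.symm.trans hGF⟩
      rw [hunion0 D hD, h1, measureReal_empty]
      simp
  exact isClose_of_bounds hcpos hε0 hε hε' (fun F => (key F).1) fun F => (key F).2

/-! ### Sizes of the vertex sets -/

theorem ncard_mem_list {V : Type*} {l : List V} (h : l.Nodup) : {v | v ∈ l}.ncard = l.length := by
  classical
  rw [← List.coe_toFinset, Set.ncard_coe_finset, List.toFinset_card_of_nodup h]

theorem IsCut.last_length {m s : ℕ} {r : ℕ → ℕ} (h : IsCut m s r) :
    (s + 1) * (m - r s - 1) ≤ m := by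
  have key : ∀ i ≤ s + 1, i * (m - r s - 1) ≤ r i := by
    intro i
    induction i with
    | zero => simp
    | succ i ih =>
      intro hi
      have h1 := ih (by omega)
      have h2 := h.balanced s le_rfl i (by omega)
      rw [h.last] at h2
      have h3 := h.mono i (by omega)
      rw [add_mul, one_mul]
      omega
  have := key (s + 1) le_rfl
  rwa [h.last] at this

theorem Setup.length_add (V : Type*) (S : Setup V) :
    S.a.length + S.b.length + S.c.length = Nat.card V := by
  rw [← List.length_append, ← List.length_append, ← ncard_mem_list S.nodup, ← Set.ncard_univ]
  congr 1
  exact Set.eq_univ_of_forall S.cover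

theorem Setup.ncard_A {V : Type*} (S : Setup V) : S.A.ncard = S.a.length :=
  ncard_mem_list (List.nodup_append'.1 (List.nodup_append'.1 S.nodup).1).1

namespace Side

variable {V : Type*} [Finite V] {x : Side V}

theorem ncard_left_add_num (h1 : x.order.Nodup) (h2 : x.removed.Nodup) (h3 : x.left ⊆ x.all) :
    x.left.ncard + x.num = x.order.length := by
  have hb : x.beta.Nodup := h2.filter _
  have h : x.all = x.left ∪ {v | v ∈ x.beta} := by
    ext v
    rw [Set.mem_union, Set.mem_ofPred_eq, mem_beta_iff]
    have := @h3 v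
    tauto
  rw [num, ← ncard_mem_list hb, ← ncard_mem_list h1, ← Set.ncard_union_eq]
  · exact (congrArg Set.ncard h).symm
  · exact Set.disjoint_left.2 fun v hv hv' => (mem_beta_iff.1 hv').2 hv

theorem ncard_blk_zero_le (h1 : x.order.Nodup) (h2 : IsCut x.order.length x.s x.cut) :
    (x.s + 1) * ((x.blk 0).ncard - 1) ≤ x.order.length := by
  have h : x.blk 0 ⊆ {v | v ∈ x.order.drop (x.cut x.s)} := by
    rintro v ⟨k, hk, -, hv⟩
    rw [Nat.sub_zero] at hk
    refine (mem_drop_iff_rank h1).2 ⟨List.mem_of_getElem? hv, ?_⟩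
    rwa [rank_eq h1 hv]
  have hc := Set.ncard_le_ncard h (Set.toFinite _)
  rw [ncard_mem_list (h1.sublist (List.drop_sublist _ _)), List.length_drop] at hc
  exact (Nat.mul_le_mul_left _ (Nat.sub_le_sub_right hc 1)).trans h2.last_length

theorem ncard_revealed_le (x : Side V) :
    x.revealed.ncard ≤ (x.blk 0).ncard + x.DP.ncard + x.DQ.ncard :=
  (Set.ncard_le_ncard Set.inter_subset_left (Set.toFinite _)).trans <|
    (Set.ncard_union_le _ _).trans <| Nat.add_le_add_right (Set.ncard_union_le _ _) _

theorem ncard_left_le (x : Side V) : x.left.ncard ≤ x.TQ.ncard + x.revealed.ncard := by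
  refine (Set.ncard_le_ncard (t := x.TQ ∪ x.revealed) ?_ (Set.toFinite _)).trans
    (Set.ncard_union_le _ _)
  intro v hv
  by_cases h : v ∈ x.revealed
  · exact Or.inr h
  · exact Or.inl ⟨hv, h⟩

namespace Regular

omit [Finite V] in
theorem ncard_P (hx : x.Regular) : x.P.ncard = x.η := by
  have h := hx.two_η_le
  rw [P, ncard_mem_list (hx.beta_nodup.sublist (List.take_sublist _ _)), List.length_take]
  exact min_eq_left (by rw [num] at h; omega)

omit [Finite V] in
theorem ncard_Q (hx : x.Regular) : x.Q.ncard = x.η := by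
  have h := hx.two_η_le
  rw [Q, ncard_mem_list (hx.beta_nodup.sublist (List.drop_sublist _ _)), List.length_drop]
  rw [num] at h ⊢
  omega

theorem ncard_TQ_le_TP : x.TQ.ncard ≤ x.TP.ncard :=
  Set.ncard_le_ncard (fun _ h => TQ_subset_TP h) (Set.toFinite _)

end Regular

/-- A side is regular, its revealed part is small and its two rectangles are large, if
`n = |V|` is large in comparison with the numbers `s` and `η` and the exceptional sets. -/
theorem regular_of_sizes {n u : ℝ} (h1 : x.order.Nodup) (h2 : x.removed.Nodup)
    (h3 : x.left ⊆ x.all) (hcut : IsCut x.order.length x.s x.cut)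
    (hblk : ∀ m v, x.beta[m]? = some v → v ∈ x.blk (cyc x.s (m + 1)))
    (hη : x.η ≤ x.s) (hs : (x.s : ℝ) ≤ n / 10) (hlen : 0.49 * n ≤ x.order.length)
    (hleft : |(x.left.ncard : ℝ) - n / 4| ≤ n / 100) (hlen' : (x.order.length : ℝ) ≤ n)
    (hu : n / (x.s + 1) + 1 ≤ 0.01 * u) (hun : u ≤ n / 100)
    (hP : (x.DP.ncard : ℝ) ≤ 0.01 * u) (hQ : (x.DQ.ncard : ℝ) ≤ 0.01 * u) :
    x.Regular ∧ (x.revealed.ncard : ℝ) ≤ 0.03 * u ∧ n / 8 ≤ x.TQ.ncard := by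
  obtain ⟨hl1, hl2⟩ := abs_le.1 hleft
  have hn : 0 ≤ n := (Nat.cast_nonneg _).trans hlen'
  have hnum : (x.left.ncard : ℝ) + x.num = x.order.length := mod_cast ncard_left_add_num h1 h2 h3
  have hs' : (x.s : ℝ) + x.s ≤ x.num := by linarith
  have hs'' : x.s + x.s ≤ x.num := mod_cast hs'
  have hb : ((x.blk 0).ncard : ℝ) ≤ n / (x.s + 1) + 1 := by
    have h := ncard_blk_zero_le h1 hcut
    have h' : ((x.s : ℝ) + 1) * (((x.blk 0).ncard - 1 : ℕ) : ℝ) ≤ x.order.length := mod_cast h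
    have hc : ((x.blk 0).ncard : ℝ) ≤ (((x.blk 0).ncard - 1 : ℕ) : ℝ) + 1 := by
      exact_mod_cast (show (x.blk 0).ncard ≤ (x.blk 0).ncard - 1 + 1 by omega)
    have hpos : (0 : ℝ) < (x.s : ℝ) + 1 := by positivity
    have : (((x.blk 0).ncard - 1 : ℕ) : ℝ) ≤ n / (x.s + 1) := by
      rw [le_div_iff₀ hpos]
      linarith
    linarith
  have hr : (x.revealed.ncard : ℝ) ≤ (x.blk 0).ncard + x.DP.ncard + x.DQ.ncard :=
    mod_cast x.ncard_revealed_le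
  have hr' : (x.revealed.ncard : ℝ) ≤ 0.03 * u := by linarith
  have ht : (x.left.ncard : ℝ) ≤ x.TQ.ncard + x.revealed.ncard := mod_cast x.ncard_left_le
  exact ⟨⟨h1, h2.filter _, h3, hcut, hblk, hη, by omega, by omega⟩, hr', by linarith⟩

theorem Regular.errorBound (hx : x.Regular) (hη : 0 < x.η) {n : ℕ} (hn : n = Nat.card V) {l ε : ℝ}
    (hT : (n : ℝ) / 8 ≤ x.TQ.ncard)
    (h : ∀ c : ℕ, (c : ℝ) ≤ n → (n : ℝ) / 8 ≤ c → parityError l x.η c ≤ ε) :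
    x.ErrorBound l ε := by
  have hcard : ∀ X : Set V, (X.ncard : ℝ) ≤ n := fun X => by
    rw [hn, ← Set.ncard_univ]
    exact_mod_cast Set.ncard_le_ncard (Set.subset_univ X) (Set.toFinite _)
  have hTP : (x.TQ.ncard : ℝ) ≤ x.TP.ncard := mod_cast Regular.ncard_TQ_le_TP
  refine ⟨?_, ?_, ?_, ?_⟩
  · exact Set.nonempty_of_ncard_ne_zero (by rw [hx.ncard_P]; omega)
  · exact Set.nonempty_of_ncard_ne_zero (by rw [hx.ncard_Q]; omega)
  · rw [hx.ncard_P]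
    exact h _ (hcard _) (hT.trans hTP)
  · rw [hx.ncard_Q]
    exact h _ (hcard _) hT

omit [Finite V] in
theorem isPartiallyRevealed_law {α n : ℝ} (hα₀ : 0 < α) (hα₁ : α < 1 / 2) (hn : 0 < n)
    (hleft : n / 5 ≤ x.left.ncard) (hr : (x.revealed.ncard : ℝ) ≤ 0.03 * n ^ (1 - 2 * α))
    (p : unitInterval) (G : SimpleGraph V) :
    IsPartiallyRevealed α p (Subtype.val ⁻¹' x.revealed) (x.law p G) := by
  refine ⟨?_, _, rfl⟩
  rw [Set.ncard_preimage_of_injective_subset_range Subtype.val_injective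
    (by rw [Subtype.range_coe]; exact x.revealed_subset_left), Nat.card_coe_set_eq]
  have hu0 := Real.rpow_pos_of_pos hn (1 - 2 * α)
  calc (x.revealed.ncard : ℝ) ≤ n ^ (1 - 2 * α) / 5 := by linarith
    _ ≤ n ^ (1 - 2 * α) / 5 ^ (1 - 2 * α) := by
        refine div_le_div_of_nonneg_left hu0.le (by positivity) ?_
        exact Real.rpow_le_self_of_one_le (by norm_num) (by linarith)
    _ = (n / 5) ^ (1 - 2 * α) := (Real.div_rpow hn.le (by norm_num) _).symm
    _ ≤ _ := Real.rpow_le_rpow (by positivity) hleft (by linarith)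

end Side

/-! ### Asymptotics -/

theorem one_add_pow_sub_one_le {a n : ℝ} {c : ℕ} (ha : 0 ≤ a) (hc : (c : ℝ) ≤ n)
    (hna : n * a ≤ 1) : (1 + a) ^ c - 1 ≤ 2 * (n * a) := by
  have h0 : 0 ≤ n * a := mul_nonneg ((Nat.cast_nonneg _).trans hc) ha
  have h1 : (1 + a) ^ c ≤ Real.exp (n * a) := by
    calc (1 + a) ^ c ≤ Real.exp a ^ c :=
          pow_le_pow_left₀ (by linarith) (by linarith [Real.add_one_le_exp a]) _
      _ = Real.exp (c * a) := (Real.exp_nat_mul a c).symm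
      _ ≤ _ := Real.exp_le_exp.2 (mul_le_mul_of_nonneg_right hc ha)
  have h2 := Real.abs_exp_sub_one_le (x := n * a) (by rwa [abs_of_nonneg h0])
  rw [abs_of_nonneg h0] at h2
  linarith [le_abs_self (Real.exp (n * a) - 1)]

/-- The error is exponentially small in `m` if the number of columns is between `n / 8` and `n`
and that of rows is of the order `m`, which is much less than `n` but more than `log n`. -/
theorem parityError_le {l κ m n θ : ℝ} {r c : ℕ} (hl0 : 0 < l) (hl1 : l < 1)
    (hr : 2 * κ * m ≤ -Real.log l * r) (hr' : (r : ℝ) ≤ θ * m)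
    (hg : l ^ (r - 1) ≤ (1 - l) / 2) (hκm : 0 ≤ κ * m)
    (hc : (c : ℝ) ≤ n) (hc' : n / 8 ≤ c)
    (hn : 32 * n ≤ Real.exp (κ * m))
    (hm : Real.log 16 + (κ + θ * Real.log 2) * m ≤ -Real.log ((1 + l) / 2) / 8 * n) :
    parityError l r c ≤ Real.exp (-κ * m) / 8 := by
  have hn0 : 0 ≤ n := (Nat.cast_nonneg _).trans hc
  have e1 : l ^ r ≤ Real.exp (-(2 * κ * m)) := by
    rw [← Real.exp_log hl0, ← Real.exp_nat_mul, Real.exp_le_exp]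
    linarith
  have e2 : n * l ^ r ≤ Real.exp (-κ * m) / 32 := by
    calc n * l ^ r ≤ Real.exp (κ * m) / 32 * Real.exp (-(2 * κ * m)) :=
          mul_le_mul (by linarith) e1 (by positivity) (by positivity)
      _ = Real.exp (-κ * m) / 32 := by
          rw [div_mul_eq_mul_div, ← Real.exp_add]
          ring_nf
  have e3 : Real.exp (-κ * m) ≤ 1 := Real.exp_le_one_iff.2 (by linarith)
  have e4 := one_add_pow_sub_one_le (a := l ^ r) (by positivity) hc (by linarith)
  have hg0 : 0 < (1 + l) / 2 := by linarith
  have hlogg : Real.log ((1 + l) / 2) < 0 := Real.log_neg hg0 (by linarith)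
  have e5 : (2 : ℝ) ^ r ≤ Real.exp (θ * Real.log 2 * m) := by
    nth_rewrite 1 [← Real.exp_log (zero_lt_two (α := ℝ))]
    rw [← Real.exp_nat_mul, Real.exp_le_exp]
    have := mul_le_mul_of_nonneg_right hr' (Real.log_nonneg one_le_two)
    linarith
  have e6 : (l + l ^ (r - 1)) ^ c ≤ Real.exp (Real.log ((1 + l) / 2) / 8 * n) := by
    calc (l + l ^ (r - 1)) ^ c ≤ ((1 + l) / 2) ^ c :=
          pow_le_pow_left₀ (by positivity) (by linarith) _
      _ = Real.exp (c * Real.log ((1 + l) / 2)) := by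
          rw [Real.exp_nat_mul, Real.exp_log hg0]
      _ ≤ _ := Real.exp_le_exp.2 (by
          have := mul_le_mul_of_nonpos_right hc' hlogg.le
          linarith)
  have e7 : (2 : ℝ) ^ r * (l + l ^ (r - 1)) ^ c ≤ Real.exp (-κ * m) / 16 := by
    calc (2 : ℝ) ^ r * (l + l ^ (r - 1)) ^ c
        ≤ Real.exp (θ * Real.log 2 * m) * Real.exp (Real.log ((1 + l) / 2) / 8 * n) :=
          mul_le_mul e5 e6 (by positivity) (by positivity)
      _ ≤ Real.exp (-κ * m - Real.log 16) := by
          rw [← Real.exp_add, Real.exp_le_exp]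
          linarith
      _ = _ := by rw [Real.exp_sub, Real.exp_log (by norm_num)]
  rw [parityError]
  linarith

theorem eventually_rpow_le {a b : ℝ} (h : a < b) (C : ℝ) {c : ℝ} (hc : 0 < c) :
    ∀ᶠ n : ℕ in Filter.atTop, C * (n : ℝ) ^ a ≤ c * (n : ℝ) ^ b := by
  have h1 := (tendsto_rpow_atTop (sub_pos.2 h)).comp (tendsto_natCast_atTop_atTop (R := ℝ))
  filter_upwards [h1.eventually_ge_atTop (C / c), Filter.eventually_gt_atTop 0] with n hn hn0
  have hn0' : (0 : ℝ) < n := mod_cast hn0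
  simp only [Function.comp_apply] at hn
  rw [Real.rpow_sub hn0', div_le_div_iff₀ hc (Real.rpow_pos_of_pos hn0' _)] at hn
  linarith

theorem eventually_mul_le_exp_rpow {a κ : ℝ} (ha : 0 < a) (hκ : 0 < κ) :
    ∀ᶠ n : ℕ in Filter.atTop, 32 * (n : ℝ) ≤ Real.exp (κ * (n : ℝ) ^ a) := by
  have h1 := (tendsto_rpow_atTop ha).comp (tendsto_natCast_atTop_atTop (R := ℝ))
  have h2 := (isLittleO_rpow_exp_pos_mul_atTop a⁻¹ hκ).comp_tendsto h1
  filter_upwards [h2.bound (c := 1 / 32) (by norm_num)] with n hn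
  simp only [Function.comp_apply, Real.norm_eq_abs, Real.abs_exp] at hn
  rw [← Real.rpow_mul (Nat.cast_nonneg _), mul_inv_cancel₀ ha.ne', Real.rpow_one,
    Nat.abs_cast] at hn
  linarith

/-- The numerical consequences, for large `n`, of the orders of magnitude of `s` and `η`. -/
theorem eventually_numerics {α l : ℝ} (hα₀ : 0 < α) (hα₁ : α < 1 / 2) (hl0 : 0 < l) (hl1 : l < 1)
    (σ₁ σ₂ θ₁ θ₂ : ℝ) (hσ₁ : 0 < σ₁) (hθ₁ : 0 < θ₁) :
    ∃ κ : ℝ, 0 < κ ∧ ∀ᶠ n : ℕ in Filter.atTop, ∀ s η : ℕ,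
      σ₁ * (n : ℝ) ^ (1 / 2 + α) ≤ s → (s : ℝ) ≤ σ₂ * (n : ℝ) ^ (1 / 2 + α) →
      θ₁ * (n : ℝ) ^ (1 / 2 - α) ≤ η → (η : ℝ) ≤ θ₂ * (n : ℝ) ^ (1 / 2 - α) →
      0 < η ∧ η ≤ s ∧ (s : ℝ) ≤ n / 10 ∧ (n : ℝ) / (s + 1) + 1 ≤ 0.01 * (n : ℝ) ^ (1 - 2 * α) ∧
      (n : ℝ) ^ (1 - 2 * α) ≤ n / 100 ∧ Real.exp (-κ * (n : ℝ) ^ (1 / 2 - α)) < 1 ∧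
      ∀ c : ℕ, (c : ℝ) ≤ n → (n : ℝ) / 8 ≤ c →
        parityError l η c ≤ Real.exp (-κ * (n : ℝ) ^ (1 / 2 - α)) / 8 := by
  have hlog : 0 < -Real.log l := neg_pos.2 (Real.log_neg hl0 hl1)
  have hlogg : 0 < -Real.log ((1 + l) / 2) :=
    neg_pos.2 (Real.log_neg (by linarith) (by linarith))
  -- half of the exponential rate of `l ^ η`, so that `n * l ^ η` is still small enough
  obtain ⟨κ, hκ_def⟩ : ∃ κ, κ = -Real.log l * θ₁ / 2 := ⟨_, rfl⟩
  have hκ : 0 < κ := by rw [hκ_def]; positivity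
  refine ⟨κ, hκ, ?_⟩
  have hm0 : 0 < 1 / 2 - α := by linarith
  obtain ⟨R, hR⟩ := Filter.eventually_atTop.1
    ((tendsto_pow_atTop_nhds_zero_of_lt_one hl0.le hl1).eventually_le_const
      (show 0 < (1 - l) / 2 by linarith))
  have E1 := eventually_rpow_le hm0 ((R : ℝ) + 1) hθ₁
  have E2 := eventually_mul_le_exp_rpow hm0 hκ
  have E3 := eventually_rpow_le (show 1 / 2 - α < 1 by linarith)
    (κ + θ₂ * Real.log 2) (show 0 < -Real.log ((1 + l) / 2) / 16 by positivity)
  have E3' := eventually_rpow_le (show (0 : ℝ) < 1 by norm_num)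
    (Real.log 16) (show 0 < -Real.log ((1 + l) / 2) / 16 by positivity)
  have E4 := eventually_rpow_le (show 1 / 2 - α < 1 / 2 + α by linarith) θ₂ hσ₁
  have E5 := eventually_rpow_le (show 1 / 2 + α < 1 by linarith) σ₂
    (show (0 : ℝ) < 1 / 10 by norm_num)
  have E6 := eventually_rpow_le (show 1 - 2 * α < 1 by linarith) 1
    (show (0 : ℝ) < 1 / 100 by norm_num)
  have E7 := eventually_rpow_le (show 1 / 2 - α < 1 - 2 * α by linarith) σ₁⁻¹
    (show (0 : ℝ) < 0.005 by norm_num)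
  have E8 := eventually_rpow_le (show 0 < 1 - 2 * α by linarith) 1
    (show (0 : ℝ) < 0.005 by norm_num)
  filter_upwards [E1, E2, E3, E3', E4, E5, E6, E7, E8, Filter.eventually_gt_atTop 0] with n
    F1 F2 F3 F3' F4 F5 F6 F7 F8 F10 s η hs1 hs2 hη1 hη2
  simp only [Real.rpow_zero, Real.rpow_one, mul_one, one_mul] at F1 F2 F3 F3' F4 F5 F6 F7 F8
  have hnpos : (0 : ℝ) < n := Nat.cast_pos.2 F10
  have hmpos := Real.rpow_pos_of_pos hnpos (1 / 2 - α)
  have hκm : 0 < κ * (n : ℝ) ^ (1 / 2 - α) := mul_pos hκ hmpos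
  have hηs : η ≤ s := by
    have : (η : ℝ) ≤ s := hη2.trans (F4.trans hs1)
    exact_mod_cast this
  have hRη : R + 1 ≤ η := by
    have : (R : ℝ) + 1 ≤ η := F1.trans hη1
    exact_mod_cast this
  refine ⟨by omega, hηs, by linarith, ?_, by linarith, Real.exp_lt_one_iff.2 (by linarith), ?_⟩
  · have hv := Real.rpow_pos_of_pos hnpos (1 / 2 + α)
    have : (n : ℝ) / (s + 1) ≤ σ₁⁻¹ * (n : ℝ) ^ (1 / 2 - α) := by
      rw [div_le_iff₀ (by positivity)]
      calc (n : ℝ) = (n : ℝ) ^ (1 / 2 - α) * (n : ℝ) ^ (1 / 2 + α) := by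
            rw [← Real.rpow_add hnpos, sub_add_add_cancel, add_halves, Real.rpow_one]
        _ = σ₁⁻¹ * (n : ℝ) ^ (1 / 2 - α) * (σ₁ * (n : ℝ) ^ (1 / 2 + α)) := by
            field_simp
        _ ≤ _ := mul_le_mul_of_nonneg_left (by linarith) (by positivity)
    linarith
  · intro c hc hc'
    refine parityError_le (θ := θ₂) hl0 hl1 ?_ hη2 (hR _ (by omega)) hκm.le hc hc' F2
      (by linarith)
    have := mul_le_mul_of_nonneg_left hη1 hlog.le
    rw [hκ_def]
    linarith

end EvenDegenerate

theorem proposition5p3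
    (α : ℝ) (hα₀ : 0 < α) (hα₁ : α < 1 / 2)
    (p : unitInterval) (hp₀ : 0 < (p : ℝ)) (hp₁ : (p : ℝ) < 1)
    -- the constants hidden in the choices of `s` and `η`
    (σ₁ σ₂ θ₁ θ₂ : ℝ) (hσ₁ : 0 < σ₁) (hθ₁ : 0 < θ₁) :
    ∃ κ : ℝ, 0 < κ ∧
      -- `δ` is the `o(n)` term
      ∀ δ : ℕ → ℝ, δ =o[Filter.atTop] (fun n : ℕ => (n : ℝ)) →
      ∃ N : ℕ, ∀ (V : Type*) [Finite V] (n : ℕ), n = Nat.card V → N ≤ n →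
      ∀ S : EvenDegenerate.Setup V,
        σ₁ * (n : ℝ) ^ (1 / 2 + α) ≤ S.s → (S.s : ℝ) ≤ σ₂ * (n : ℝ) ^ (1 / 2 + α) →
        θ₁ * (n : ℝ) ^ (1 / 2 - α) ≤ S.η → (S.η : ℝ) ≤ θ₂ * (n : ℝ) ^ (1 / 2 - α) →
      -- the law of the partially revealed `p`-graph `G`
      ∀ μ : MeasureTheory.Measure (SimpleGraph V),
        EvenDegenerate.IsPartiallyRevealed α p S.A μ →
      -- a realization `G₀` of `G`, such that the value `Γ₀` that `Γ` takes at it satisfies `ℰ`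
      ∀ (G₀ : SimpleGraph V) (x y : EvenDegenerate.Side V),
        μ {G₀} ≠ 0 → S.outcome G₀ = some (x, y) →
        |(x.left.ncard : ℝ) - n / 4| ≤ δ n → |(y.left.ncard : ℝ) - n / 4| ≤ δ n →
        (∀ D ∈ ({x.DP, x.DQ, y.DP, y.DQ} : Set (Set V)),
          (D.ncard : ℝ) ≤ 0.01 * (n : ℝ) ^ (1 - 2 * α)) →
      EvenDegenerate.IsPartiallyRevealed α p (Subtype.val ⁻¹' x.revealed) (x.law p G₀) ∧
      EvenDegenerate.IsPartiallyRevealed α p (Subtype.val ⁻¹' y.revealed) (y.law p G₀) ∧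
      EvenDegenerate.IsClose (Real.exp (-κ * (n : ℝ) ^ (1 / 2 - α)))
        ((ProbabilityTheory.cond μ {G | S.Gam G = S.Gam G₀}).map S.leftover)
        (EvenDegenerate.unionLaw (x.law p G₀) (y.law p G₀)) := by
  -- the base of the exponential error: the bias of one edge, or `1 / 2` if this is larger
  obtain ⟨l, hl, hl0, hl1⟩ : ∃ l : ℝ, |1 - 2 * (p : ℝ)| ≤ l ∧ 0 < l ∧ l < 1 :=
    ⟨max |1 - 2 * (p : ℝ)| (1 / 2), le_max_left _ _, lt_max_of_lt_right (by norm_num),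
      max_lt (abs_lt.2 ⟨by linarith, by linarith⟩) (by norm_num)⟩
  obtain ⟨κ, hκ, hκn⟩ :=
    EvenDegenerate.eventually_numerics hα₀ hα₁ hl0 hl1 σ₁ σ₂ θ₁ θ₂ hσ₁ hθ₁
  refine ⟨κ, hκ, fun δ hδ => ?_⟩
  obtain ⟨N, hN⟩ := Filter.eventually_atTop.1 (hκn.and
    ((hδ.bound (show (0 : ℝ) < 1 / 100 by norm_num)).and (Filter.eventually_ge_atTop 1000)))
  refine ⟨N, fun V _ n hn hNn S hs1 hs2 hη1 hη2 μ hμ G₀ x y hG₀ hxy hx hy hD => ?_⟩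
  obtain ⟨F1, F2, F3⟩ := hN n hNn
  obtain ⟨hη0, hηs, hsn, hu, hun, hlt, error⟩ := F1 S.s S.η hs1 hs2 hη1 hη2
  rw [Real.norm_eq_abs, Real.norm_eq_abs, Nat.abs_cast] at F2
  have hn1000 : (1000 : ℝ) ≤ n := mod_cast F3
  have hnpos : (0 : ℝ) < n := by linarith
  have hδn : δ n ≤ n / 100 := by linarith [le_abs_self (δ n)]
  -- as `A` has at most `n / 100` vertices, `B` and `C` have almost `n / 2` vertices each
  have hlen : (S.a.length : ℝ) + S.b.length + S.c.length = n := by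
    rw [hn]; exact_mod_cast S.length_add
  obtain ⟨hA, H, rfl⟩ := hμ
  rw [S.ncard_A, ← hn] at hA
  obtain ⟨hbc1, hbc2⟩ := S.balanced
  have hbc1' : (S.b.length : ℝ) ≤ S.c.length + 1 := mod_cast hbc1
  have hbc2' : (S.c.length : ℝ) ≤ S.b.length + 1 := mod_cast hbc2
  have ha0 : (0 : ℝ) ≤ S.a.length := Nat.cast_nonneg _
  have hb0 : (0 : ℝ) ≤ S.b.length := Nat.cast_nonneg _
  have hc0 : (0 : ℝ) ≤ S.c.length := Nat.cast_nonneg _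
  obtain ⟨stBC, stCB, h, rfl, rfl⟩ := EvenDegenerate.Setup.exists_run hxy
  obtain ⟨rB, kB, tB⟩ := EvenDegenerate.Side.regular_of_sizes (x := S.sideB stCB)
    (List.nodup_append'.1 S.nodup_acb).2.1 h.invCB.nodup h.left_sideB S.isCutB h.invCB.mem_block
    hηs hsn (by simp only [EvenDegenerate.Setup.sideB]; linarith) (hx.trans hδn)
    (by simp only [EvenDegenerate.Setup.sideB]; linarith) hu hun
    (hD _ (by simp)) (hD _ (by simp))
  obtain ⟨rC, kC, tC⟩ := EvenDegenerate.Side.regular_of_sizes (x := S.sideC stBC)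
    (List.nodup_append'.1 S.nodup).2.1 h.invBC.nodup h.left_sideC S.isCutC h.invBC.mem_block
    hηs hsn (by simp only [EvenDegenerate.Setup.sideC]; linarith) (hy.trans hδn)
    (by simp only [EvenDegenerate.Setup.sideC]; linarith) hu hun
    (hD _ (by simp)) (hD _ (by simp))
  have eB := rB.errorBound hη0 hn tB error
  have eC := rC.errorBound hη0 hn tC error
  refine ⟨EvenDegenerate.Side.isPartiallyRevealed_law hα₀ hα₁ hnpos
      (by linarith [(abs_le.1 (hx.trans hδn)).1]) kB p G₀,
    EvenDegenerate.Side.isPartiallyRevealed_law hα₀ hα₁ hnpos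
      (by linarith [(abs_le.1 (hy.trans hδn)).1]) kC p G₀, ?_⟩
  exact h.isClose rB rC hp₀ hp₁ hl hl1.le (by positivity) (by linarith) hlt eB eC hG₀
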